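/- **Hypergraphs.** A hypergraph $G$ consists of a set $W(G)$ of wires and, for all $k,\ell\in\mathbb N$, a set $B_{k,\ell}(G)$ of boxes, each box having an ordered list of $k$ input wires and an ordered list of $\ell$ output wires. A morphism of hypergraphs consists of a map on wires and maps $B_{k,\ell}(G)\to B_{k,\ell}(H)$ on boxes that preserve the input and output lists. For a box $b$ and a wire $w$, let $\mathsf{in}(b,w)$ and $\mathsf{out}(b,w)$ be the number of times that $w$ occurs as an input, respectively output, of $b$. A hypergraph is acyclic if it has no cycle $w_1,b_1,w_2,\dots,w_n,b_n,w_{n+1}=w_1$ with $n\ge 1$, $\mathsf{in}(b_i,w_i)\ge 1$ and $\mathsf{out}(b_i,w_{i+1})\ge 1$. Write $\underline n$ for the hypergraph with $n$ wires and no boxes. Every monoidal category $\mathsf C$ has an underlying hypergraph $\mathrm{hyp}(\mathsf C)$: its wires are the objects of $\mathsf C$, and the boxes with inputs $A_1,\dots,A_k$ and outputs $B_1,\dots,B_\ell$ are the morphisms $A_1\otimes\cdots\otimes A_k\to B_1\otimes\cdots\otimes B_\ell$. **String diagrams.** Let $\Sigma$ be a hypergraph, possibly infinite. For $\sigma:\underline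 m\to\Sigma$ and $\tau:\underline n\to\Sigma$, a gs-monoidal string diagram $(m,\sigma)\to(n,\tau)$ is a cospan $\underline m\xrightarrow{p}G\xleftarrow{q}\underline n$ of hypergraphs over $\Sigma$ with $G$ finite and acyclic, such that $$|p^{-1}(w)|+\sum_{b\in B(G)}\mathsf{out}(b,w)=1\qquad\text{for every } w\in W(G).$$ A box $b$ of $G$ is eliminable if every output wire $w$ of $b$ satisfies $q^{-1}(w)=\emptyset$ and $\mathsf{in}(b',w)=0$ for all boxes $b'$ of $G$. The diagram is normalized if it has no eliminable boxes. The normalization of a string diagram is obtained by repeatedly removing eliminable boxes together with their output wires. **The category $\mathsf{FreeMarkov}_\Sigma$.** Its objects are the pairs $(n,\sigma:\underline n\to\Sigma)$ with $n\in\mathbb N$, and its morphisms are the isomorphism classes of normalized gs-monoidal string diagrams. Composition is given by composition of cospans by pushout, followed by normalization. The tensor product is given by concatenation of the labelings on objects and disjoint union on string diagrams; the symmetry, the copy morphisms and the discard morphisms are given by the string diagrams without boxes that permute, duplicate and discard wires. This is a strict Markov category. The canonical hypergraph morphism $\iota:\Sigma\to\mathrm{hyp}(\mathsf{FreeMarkov}_\Sigma)$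 sends a wire $w$ to the object given by the single wire $w$, and a box $b$ to the normalization of the string diagram that consists of $b$ alone. **Strict gs-monoidal functors.** A strict gs-monoidal functor between strict Markov categories is a functor that preserves the unit object, the tensor product of objects and of morphisms, the symmetry, and the copy and discard morphisms on the nose. **Statement.** Let $\Sigma$ be a hypergraph and let $\mathsf C$ be a strict Markov category whose monoid of objects (under $\otimes$) is the free monoid with generating set $W(\Sigma)$. Then $F\mapsto \mathrm{hyp}(F)\circ\iota$ is a bijection from the set of strict gs-monoidal functors $\mathsf{FreeMarkov}_\Sigma\to\mathsf C$ to the set of hypergraph morphisms $\Sigma\to\mathrm{hyp}(\mathsf C)$. It restricts to a bijection from the identity-on-objects strict gs-monoidal functors, i.e. those that send every object $(n,\sigma)$ to the word $\sigma(1)\cdots\sigma(n)$, to the identity-on-wires hypergraph morphisms, i.e. those that send every wire $w$ to the generator $w$. -/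

import Mathlib

open CategoryTheory MonoidalCategory

universe u v u₁ v₁ u₂ v₂

set_option linter.checkUnivs false

namespace GSMon

/-! ### Hypergraphs -/

/-- A (directed) hypergraph, i.e. a functor `I ⥤ Type` written out: a type `W` of wires and, for
all `k l : ℕ`, a type `B k l` of boxes with an ordered list of `k` input wires and an ordered list
of `l` output wires. A hypergraph in this sense is also what is called a monoidal signature. -/
structure Hypergraph where
  W : Type u
  B : ℕ → ℕ → Type v
  src : ∀ {k l : ℕ}, B k l → Fin k → W
  tgt : ∀ {k l : ℕ}, B k l → Fin l → W

namespace Hypergraph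

/-- Morphisms of hypergraphs, i.e. natural transformations. -/
@[ext]
structure Hom (G : Hypergraph.{u, v}) (H : Hypergraph.{u₁, v₁}) where
  wire : G.W → H.W
  box : ∀ {k l : ℕ}, G.B k l → H.B k l
  wire_src : ∀ {k l : ℕ} (b : G.B k l) (i : Fin k), wire (G.src b i) = H.src (box b) i
  wire_tgt : ∀ {k l : ℕ} (b : G.B k l) (j : Fin l), wire (G.tgt b j) = H.tgt (box b) j

/-- Composition of hypergraph morphisms (first `f`, then `g`). -/
def Hom.comp {G : Hypergraph.{u, v}} {H : Hypergraph.{u₁, v₁}} {K : Hypergraph.{u₂, v₂}}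
    (f : Hom G H) (g : Hom H K) : Hom G K where
  wire w := g.wire (f.wire w)
  box b := g.box (f.box b)
  wire_src b i := by rw [f.wire_src, g.wire_src]
  wire_tgt b j := by rw [f.wire_tgt, g.wire_tgt]

/-- The set of all boxes, of whatever arity `k` and coarity `l`. -/
abbrev Box (G : Hypergraph.{u, v}) : Type v := (k : ℕ) × (l : ℕ) × G.B k l

/-- The number of times that the wire `w` is an input of the box `b`. -/
noncomputable def inCount (G : Hypergraph.{u, v}) (b : G.Box) (w : G.W) : ℕ :=
  Nat.card {i : Fin b.1 // G.src b.2.2 i = w}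

/-- The number of times that the wire `w` is an output of the box `b`. -/
noncomputable def outCount (G : Hypergraph.{u, v}) (b : G.Box) (w : G.W) : ℕ :=
  Nat.card {j : Fin b.2.1 // G.tgt b.2.2 j = w}

/-- `w'` can be reached from `w` by traversing one box from an input to an output. -/
def Step (G : Hypergraph.{u, v}) (w w' : G.W) : Prop :=
  ∃ b : G.Box, 1 ≤ G.inCount b w ∧ 1 ≤ G.outCount b w'

/-- There is no cycle `w₁, b₁, w₂, …, wₙ, bₙ, w₁` with `n ≥ 1`. -/
def Acyclic (G : Hypergraph.{u, v}) : Prop :=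
  ∀ w : G.W, ¬ Relation.TransGen G.Step w w

theorem inCount_pos {G : Hypergraph.{u, v}} {b : G.Box} {w : G.W} :
    0 < G.inCount b w ↔ ∃ i, G.src b.2.2 i = w := by
  simp [inCount, Finite.card_pos_iff, nonempty_subtype]

theorem outCount_pos {G : Hypergraph.{u, v}} {b : G.Box} {w : G.W} :
    0 < G.outCount b w ↔ ∃ j, G.tgt b.2.2 j = w := by
  simp [outCount, Finite.card_pos_iff, nonempty_subtype]

theorem step_iff {G : Hypergraph.{u, v}} {w w' : G.W} :
    G.Step w w' ↔ ∃ b : G.Box, (∃ i, G.src b.2.2 i = w) ∧ ∃ j, G.tgt b.2.2 j = w' := by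
  simp only [Step, ← inCount_pos, ← outCount_pos, Nat.succ_le_iff]

theorem Step.map {G : Hypergraph.{u, v}} {H : Hypergraph.{u₁, v₁}} (f : Hom G H) {w w' : G.W}
    (h : G.Step w w') : H.Step (f.wire w) (f.wire w') := by
  rw [step_iff] at h ⊢
  obtain ⟨b, ⟨i, rfl⟩, ⟨j, rfl⟩⟩ := h
  exact ⟨⟨b.1, b.2.1, f.box b.2.2⟩, ⟨i, (f.wire_src _ _).symm⟩, ⟨j, (f.wire_tgt _ _).symm⟩⟩

theorem Acyclic.of_hom {G : Hypergraph.{u, v}} {H : Hypergraph.{u₁, v₁}} (f : Hom G H)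
    (h : H.Acyclic) : G.Acyclic := fun w hw =>
  h (f.wire w) (Relation.TransGen.lift f.wire (fun _ _ => Step.map f) _ _ hw)

end Hypergraph

/-! ### String diagrams -/

/-- An object of the free category on the signature `S`: a natural number `n` together with a
labelling of the discrete hypergraph with wires `1, …, n` by wires of `S`. -/
@[ext]
structure FreeMarkov (S : Hypergraph.{u, v}) where
  n : ℕ
  label : Fin n → S.W

variable {S : Hypergraph.{u, v}}

/-- A cospan of finite hypergraphs over `S` between two discrete hypergraphs. -/
structure Cospan (X Y : FreeMarkov S) where
  G : Hypergraph.{0, 0}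
  finite_wires : Finite G.W
  finite_boxes : Finite G.Box
  lab : Hypergraph.Hom G S
  left : Fin X.n → G.W
  right : Fin Y.n → G.W
  lab_left : ∀ i, lab.wire (left i) = X.label i
  lab_right : ∀ i, lab.wire (right i) = Y.label i

namespace Cospan

attribute [instance] finite_wires finite_boxes

variable {X Y Z : FreeMarkov S}

/-- Left monogamy: `|p⁻¹(w)| + ∑ b, out(b, w) = 1` for every wire `w`, where `p` is the left leg. -/
def LeftMonogamous (α : Cospan X Y) : Prop :=
  ∀ w : α.G.W, Nat.card {i : Fin X.n // α.left i = w} + ∑ᶠ b : α.G.Box, α.G.outCount b w = 1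

/-- A gs-monoidal string diagram is an acyclic left monogamous cospan. -/
structure IsStringDiagram (α : Cospan X Y) : Prop where
  acyclic : α.G.Acyclic
  monogamous : α.LeftMonogamous

/-- A morphism of cospans over `S` with the same feet. -/
structure Map (α β : Cospan X Y) extends Hypergraph.Hom α.G β.G where
  lab_wire : ∀ w, β.lab.wire (wire w) = α.lab.wire w
  lab_box : ∀ {k l : ℕ} (b : α.G.B k l), β.lab.box (box b) = α.lab.box b
  map_left : ∀ i, wire (α.left i) = β.left i
  map_right : ∀ i, wire (α.right i) = β.right i

/-- Two cospans are isomorphic if there is an isomorphism of hypergraphs over `S` between their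
apices that commutes with the legs. -/
def Isomorphic (α β : Cospan X Y) : Prop :=
  ∃ φ : Map α β, φ.wire.Bijective ∧ ∀ k l, (φ.box (k := k) (l := l)).Bijective

theorem Isomorphic.refl (α : Cospan X Y) : α.Isomorphic α :=
  ⟨{ wire := id, box := id, wire_src := fun _ _ => rfl, wire_tgt := fun _ _ => rfl,
     lab_wire := fun _ => rfl, lab_box := fun _ => rfl, map_left := fun _ => rfl,
     map_right := fun _ => rfl }, Function.bijective_id, fun _ _ => Function.bijective_id⟩

theorem Isomorphic.trans {α β γ : Cospan X Y} (h : α.Isomorphic β) (h' : β.Isomorphic γ) :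
    α.Isomorphic γ := by
  obtain ⟨φ, hφ, hφ'⟩ := h
  obtain ⟨ψ, hψ, hψ'⟩ := h'
  exact ⟨{ toHom := φ.toHom.comp ψ.toHom
           lab_wire := fun w => (ψ.lab_wire _).trans (φ.lab_wire w)
           lab_box := fun b => (ψ.lab_box _).trans (φ.lab_box b)
           map_left := fun i => (congrArg ψ.wire (φ.map_left i)).trans (ψ.map_left i)
           map_right := fun i => (congrArg ψ.wire (φ.map_right i)).trans (ψ.map_right i) },
    hψ.comp hφ, fun k l => (hψ' k l).comp (hφ' k l)⟩

theorem Isomorphic.symm {α β : Cospan X Y} (h : α.Isomorphic β) : β.Isomorphic α := by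
  obtain ⟨φ, hφ, hφ'⟩ := h
  let e := Equiv.ofBijective _ hφ
  let E := fun k l => Equiv.ofBijective _ (hφ' k l)
  have he : ∀ w, φ.wire (e.symm w) = w := e.apply_symm_apply
  have hE : ∀ {k l} (b : β.G.B k l), φ.box ((E k l).symm b) = b :=
    fun {k l} b => (E k l).apply_symm_apply b
  refine ⟨{ wire := e.symm, box := fun {k l} => (E k l).symm, wire_src := ?_, wire_tgt := ?_,
            lab_wire := ?_, lab_box := ?_, map_left := ?_, map_right := ?_ },
    e.symm.bijective, fun k l => (E k l).symm.bijective⟩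
  · intro k l b i
    apply hφ.1
    rw [he, φ.wire_src, hE]
  · intro k l b i
    apply hφ.1
    rw [he, φ.wire_tgt, hE]
  · intro w
    rw [← φ.lab_wire, he]
  · intro k l b
    rw [← φ.lab_box, hE]
  · intro i
    apply hφ.1
    rw [he, φ.map_left]
  · intro i
    apply hφ.1
    rw [he, φ.map_right]

/-- The places at which a wire can start: the input interfaces, and the outputs of the boxes. -/
abbrev Start (α : Cospan X Y) : Type := Fin X.n ⊕ (b : α.G.Box) × Fin b.2.1

/-- The wire that starts at a given place. -/
def start (α : Cospan X Y) : α.Start → α.G.W :=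
  Sum.elim α.left (fun s => α.G.tgt s.1.2.2 s.2)

theorem leftMonogamous_iff {α : Cospan X Y} : α.LeftMonogamous ↔ α.start.Bijective := by
  have key : ∀ w, Nat.card {i : Fin X.n // α.left i = w} + ∑ᶠ b : α.G.Box, α.G.outCount b w
      = Nat.card {s : α.Start // α.start s = w} := by
    intro w
    let E : {s : α.Start // α.start s = w} ≃
        {i : Fin X.n // α.left i = w} ⊕ (b : α.G.Box) × {j : Fin b.2.1 // α.G.tgt b.2.2 j = w} :=
      { toFun := fun s => match s with
          | ⟨Sum.inl i, h⟩ => Sum.inl ⟨i, h⟩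
          | ⟨Sum.inr ⟨b, j⟩, h⟩ => Sum.inr ⟨b, j, h⟩
        invFun := fun s => match s with
          | Sum.inl ⟨i, h⟩ => ⟨Sum.inl i, h⟩
          | Sum.inr ⟨b, j, h⟩ => ⟨Sum.inr ⟨b, j⟩, h⟩
        left_inv := by rintro ⟨_ | _, _⟩ <;> rfl
        right_inv := by rintro (_ | _) <;> rfl }
    have := Fintype.ofFinite α.G.Box
    rw [Nat.card_congr E, Nat.card_sum, Nat.card_sigma, finsum_eq_sum_of_fintype]
    rfl
  simp only [LeftMonogamous, key, Function.bijective_iff_existsUnique]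
  refine forall_congr' fun w => ?_
  rw [Nat.card_eq_one_iff_exists]
  constructor
  · rintro ⟨⟨s, hs⟩, h⟩
    exact ⟨s, hs, fun t ht => congrArg Subtype.val (h ⟨t, ht⟩)⟩
  · rintro ⟨s, hs, h⟩
    exact ⟨⟨s, hs⟩, fun t => Subtype.ext (h t.1 t.2)⟩

theorem IsStringDiagram.bij {α : Cospan X Y} (h : α.IsStringDiagram) : α.start.Bijective :=
  leftMonogamous_iff.1 h.monogamous

theorem IsStringDiagram.left_ne_tgt {α : Cospan X Y} (h : α.IsStringDiagram) (i : Fin X.n)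
    {k l : ℕ} (b : α.G.B k l) (j : Fin l) : α.left i ≠ α.G.tgt b j := fun e => by
  have := h.bij.1 (a₁ := Sum.inl i) (a₂ := Sum.inr ⟨⟨k, l, b⟩, j⟩) e
  cases this

/-- The action of a map of cospans on starting places. -/
def Map.start {α β : Cospan X Y} (φ : Map α β) : α.Start → β.Start :=
  Sum.map id (fun s => ⟨⟨s.1.1, s.1.2.1, φ.box s.1.2.2⟩, s.2⟩)

theorem Map.wire_start {α β : Cospan X Y} (φ : Map α β) (s : α.Start) :
    φ.wire (α.start s) = β.start (φ.start s) := by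
  rcases s with i | ⟨b, j⟩
  · exact φ.map_left i
  · exact φ.wire_tgt _ _

theorem Map.start_injective {α β : Cospan X Y} (φ : Map α β)
    (h : ∀ k l, (φ.box (k := k) (l := l)).Injective) : φ.start.Injective := by
  rintro (i | ⟨⟨k, l, b⟩, j⟩) (i' | ⟨⟨k', l', b'⟩, j'⟩) e
  · simpa [Map.start] using e
  · cases e
  · cases e
  · simp only [Map.start, Sum.map_inr, Sum.inr.injEq] at e
    obtain ⟨rfl, e⟩ := Sigma.mk.inj_iff.1 (Sigma.mk.inj_iff.1 e).1
    obtain ⟨rfl, e⟩ := Sigma.mk.inj_iff.1 (eq_of_heq e)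
    obtain rfl := h _ _ (eq_of_heq e)
    obtain rfl := eq_of_heq (Sigma.mk.inj_iff.1 (by assumption : _ = _)).2
    rfl

theorem Map.wire_injective {α β : Cospan X Y} (hα : α.IsStringDiagram) (hβ : β.IsStringDiagram)
    (φ : Map α β) (h : ∀ k l, (φ.box (k := k) (l := l)).Injective) : φ.wire.Injective := by
  intro w w' e
  obtain ⟨s, rfl⟩ := hα.bij.2 w
  obtain ⟨s', rfl⟩ := hα.bij.2 w'
  rw [φ.wire_start, φ.wire_start] at e
  rw [φ.start_injective h (hβ.bij.1 e)]

theorem Map.wire_surjective {α β : Cospan X Y} (hβ : β.IsStringDiagram)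
    (φ : Map α β) (h : ∀ k l, (φ.box (k := k) (l := l)).Surjective) : φ.wire.Surjective := by
  intro w
  obtain ⟨i | ⟨⟨k, l, b⟩, j⟩, rfl⟩ := hβ.bij.2 w
  · exact ⟨α.left i, φ.map_left i⟩
  · obtain ⟨b, rfl⟩ := h _ _ b
    exact ⟨α.G.tgt b j, φ.wire_tgt b j⟩

/-! ### Normalization -/

/-- A box is eliminable if each of its outputs is discarded. -/
def Eliminable (α : Cospan X Y) (b : α.G.Box) : Prop :=
  ∀ w, 0 < α.G.outCount b w → (∀ i, α.right i ≠ w) ∧ ∀ b', α.G.inCount b' w = 0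

/-- A cospan is normalized if it has no eliminable boxes. -/
def Normalized (α : Cospan X Y) : Prop :=
  ∀ b, ¬ α.Eliminable b

/-- The boxes that disappear when eliminable boxes (and their output wires) are removed
repeatedly: a box is removed if none of its outputs is connected to an output interface, and
all boxes that take one of its outputs as an input are removed before it. -/
inductive Removed (α : Cospan X Y) : α.G.Box → Prop
  | intro (b : α.G.Box)
      (h₁ : ∀ w, 0 < α.G.outCount b w → ∀ i, α.right i ≠ w)
      (h₂ : ∀ w b', 0 < α.G.outCount b w → 0 < α.G.inCount b' w → α.Removed b') :
      α.Removed b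

theorem Removed.mk {α : Cospan X Y} (b : α.G.Box)
    (h₁ : ∀ j i, α.right i ≠ α.G.tgt b.2.2 j)
    (h₂ : ∀ (b' : α.G.Box) i j, α.G.src b'.2.2 i = α.G.tgt b.2.2 j → α.Removed b') :
    α.Removed b := by
  refine .intro b ?_ ?_
  · intro w hw i
    obtain ⟨j, rfl⟩ := Hypergraph.outCount_pos.1 hw
    exact h₁ j i
  · intro w b' hw hw'
    obtain ⟨j, rfl⟩ := Hypergraph.outCount_pos.1 hw
    obtain ⟨i, hi⟩ := Hypergraph.inCount_pos.1 hw'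
    exact h₂ b' i j hi

theorem Removed.right_ne {α : Cospan X Y} {b : α.G.Box} (h : α.Removed b) (j i) :
    α.right i ≠ α.G.tgt b.2.2 j := by
  cases h with
  | intro _ h₁ h₂ => exact h₁ _ (Hypergraph.outCount_pos.2 ⟨j, rfl⟩) i

theorem Removed.of_src {α : Cospan X Y} {b : α.G.Box} (h : α.Removed b) (b' : α.G.Box) (i j)
    (e : α.G.src b'.2.2 i = α.G.tgt b.2.2 j) : α.Removed b' := by
  cases h with
  | intro _ h₁ h₂ =>
    exact h₂ _ b' (Hypergraph.outCount_pos.2 ⟨j, rfl⟩) (Hypergraph.inCount_pos.2 ⟨i, e⟩)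

theorem Removed.rec' {α : Cospan X Y} {P : α.G.Box → Prop}
    (H : ∀ b : α.G.Box, (∀ j i, α.right i ≠ α.G.tgt b.2.2 j) →
      (∀ (b' : α.G.Box) i j, α.G.src b'.2.2 i = α.G.tgt b.2.2 j → P b') → P b)
    {b : α.G.Box} (h : α.Removed b) : P b := by
  induction h with
  | intro b h₁ h₂ ih =>
    exact H b (fun j i => h₁ _ (Hypergraph.outCount_pos.2 ⟨j, rfl⟩) i) fun b' i j e =>
      ih _ b' (Hypergraph.outCount_pos.2 ⟨j, rfl⟩) (Hypergraph.inCount_pos.2 ⟨i, e⟩)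

/-- A wire survives normalization if it is not an output of a removed box. -/
def Kept (α : Cospan X Y) (w : α.G.W) : Prop :=
  ∀ b, α.Removed b → α.G.outCount b w = 0

theorem kept_iff {α : Cospan X Y} {w : α.G.W} :
    α.Kept w ↔ ∀ b : α.G.Box, α.Removed b → ∀ j, α.G.tgt b.2.2 j ≠ w := by
  refine forall₂_congr fun b _ => ?_
  rw [← not_iff_not, ← Ne.eq_def, ← Nat.pos_iff_ne_zero, Hypergraph.outCount_pos]
  simp

/-- The normalization of a string diagram: repeatedly remove the eliminable boxes together with
their output wires, and keep everything else. -/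
def norm (α : Cospan X Y) (hα : α.IsStringDiagram) : Cospan X Y where
  G :=
    { W := {w : α.G.W // α.Kept w}
      B := fun k l => {b : α.G.B k l // ¬ α.Removed ⟨k, l, b⟩}
      src := fun {k l} b i => ⟨α.G.src b.1 i, kept_iff.2 fun b' hb' j e =>
        b.2 (hb'.of_src ⟨k, l, b.1⟩ i j e.symm)⟩
      tgt := fun {k l} b j => ⟨α.G.tgt b.1 j, kept_iff.2 fun b' hb' j' e => by
        have := hα.bij.1 (a₁ := Sum.inr ⟨b', j'⟩) (a₂ := Sum.inr ⟨⟨k, l, b.1⟩, j⟩) e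
        cases this
        exact b.2 hb'⟩ }
  finite_wires := Subtype.finite
  finite_boxes := Finite.of_injective (β := α.G.Box) (fun b => ⟨b.1, b.2.1, b.2.2.1⟩) <| by
    rintro ⟨k, l, b, hb⟩ ⟨k', l', b', hb'⟩ e
    cases e
    rfl
  lab :=
    { wire := fun w => α.lab.wire w.1
      box := fun b => α.lab.box b.1
      wire_src := fun b i => α.lab.wire_src b.1 i
      wire_tgt := fun b i => α.lab.wire_tgt b.1 i }
  left i := ⟨α.left i, kept_iff.2 fun b _ j e => hα.left_ne_tgt i b.2.2 j e.symm⟩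
  right i := ⟨α.right i, kept_iff.2 fun _ hb j e => hb.right_ne j i e.symm⟩
  lab_left i := α.lab_left i
  lab_right i := α.lab_right i

/-- The inclusion of the normalization. -/
def normIncl (α : Cospan X Y) (hα : α.IsStringDiagram) : Map (α.norm hα) α where
  wire w := w.1
  box b := b.1
  wire_src _ _ := rfl
  wire_tgt _ _ := rfl
  lab_wire _ := rfl
  lab_box _ := rfl
  map_left _ := rfl
  map_right _ := rfl

theorem norm_isStringDiagram (α : Cospan X Y) (hα : α.IsStringDiagram) :
    (α.norm hα).IsStringDiagram := by
  refine ⟨hα.acyclic.of_hom (α.normIncl hα).toHom, leftMonogamous_iff.2 ⟨?_, ?_⟩⟩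
  · intro s t e
    refine (α.normIncl hα).start_injective (fun _ _ => Subtype.val_injective) (hα.bij.1 ?_)
    rw [← Map.wire_start, ← Map.wire_start, e]
  · rintro ⟨w, hw⟩
    obtain ⟨i | ⟨⟨k, l, b⟩, j⟩, rfl⟩ := hα.bij.2 w
    · exact ⟨Sum.inl i, rfl⟩
    · have hb : ¬ α.Removed ⟨k, l, b⟩ := fun hb => kept_iff.1 hw _ hb j rfl
      exact ⟨Sum.inr ⟨⟨k, l, ⟨b, hb⟩⟩, j⟩, rfl⟩

theorem norm_normalized (α : Cospan X Y) (hα : α.IsStringDiagram) :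
    (α.norm hα).Normalized := by
  rintro ⟨k, l, b, hb⟩ h
  apply hb
  refine .mk _ ?_ ?_
  · intro j i e
    exact (h ((α.norm hα).G.tgt ⟨b, hb⟩ j) (Hypergraph.outCount_pos.2 ⟨j, rfl⟩)).1 i
      (Subtype.ext e)
  · rintro ⟨k', l', b'⟩ i j e
    by_contra hb'
    have h₀ := (h ((α.norm hα).G.tgt ⟨b, hb⟩ j) (Hypergraph.outCount_pos.2 ⟨j, rfl⟩)).2
      ⟨k', l', b', hb'⟩
    have h₁ : 0 < (α.norm hα).G.inCount ⟨k', l', b', hb'⟩ ((α.norm hα).G.tgt ⟨b, hb⟩ j) :=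
      Hypergraph.inCount_pos.2 ⟨i, Subtype.ext e⟩
    exact h₁.ne' h₀

theorem not_removed_of_normalized {α : Cospan X Y} (h : α.Normalized) (b : α.G.Box) :
    ¬ α.Removed b := fun hb => by
  induction hb with
  | intro b h₁ h₂ ih =>
    refine h b fun w hw => ⟨h₁ w hw, fun b' => ?_⟩
    by_contra hb'
    exact ih w b' hw (Nat.pos_of_ne_zero hb')

/-- If a string diagram `β` is obtained from `α` by leaving out some boxes that are removed in the
normalization of `α`, then `α` and `β` have isomorphic normalizations. -/
theorem norm_isomorphic {β α : Cospan X Y} (hβ : β.IsStringDiagram) (hα : α.IsStringDiagram)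
    (φ : Map β α) (hφ : ∀ k l, (φ.box (k := k) (l := l)).Injective)
    (hr : ∀ b : α.G.Box, (∀ b' : β.G.B b.1 b.2.1, φ.box b' ≠ b.2.2) → α.Removed b) :
    (β.norm hβ).Isomorphic (α.norm hα) := by
  have hw := φ.wire_injective hβ hα hφ
  have hr' : ∀ {k l} (b : α.G.B k l), ¬ α.Removed ⟨k, l, b⟩ → ∃ b', φ.box b' = b :=
    fun b hb => not_forall_not.1 fun h => hb (hr ⟨_, _, b⟩ h)
  have h₁ : ∀ {k l} {b : β.G.B k l}, β.Removed ⟨k, l, b⟩ → α.Removed ⟨k, l, φ.box b⟩ := by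
    intro k l b hb
    refine Removed.rec' (P := fun b => α.Removed ⟨b.1, b.2.1, φ.box b.2.2⟩) ?_ hb
    rintro ⟨k, l, b⟩ h ih
    refine .mk _ (fun j i e => h j i (hw ?_)) fun b' i j e => ?_
    · rw [φ.map_right, φ.wire_tgt]
      exact e
    · by_contra hb'
      obtain ⟨k', l', b'⟩ := b'
      obtain ⟨b'', rfl⟩ := hr' b' hb'
      exact hb' (ih ⟨k', l', b''⟩ i j (hw (by rw [φ.wire_src, φ.wire_tgt]; exact e)))
  have h₂ : ∀ {b : α.G.Box}, α.Removed b → ∀ b' : β.G.B b.1 b.2.1, φ.box b' = b.2.2 →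
      β.Removed ⟨b.1, b.2.1, b'⟩ := by
    intro b hb
    refine Removed.rec' (P := fun b => ∀ b' : β.G.B b.1 b.2.1, φ.box b' = b.2.2 →
      β.Removed ⟨b.1, b.2.1, b'⟩) ?_ hb
    rintro ⟨k, l, b⟩ h ih b' e'
    dsimp only at b' e'
    subst e'
    refine .mk _ (fun j i e => h j i ?_) fun b'' i j e => ?_
    · rw [← φ.map_right, ← φ.wire_tgt, e]
    · refine ih ⟨b''.1, b''.2.1, φ.box b''.2.2⟩ i j ?_ b''.2.2 rfl
      rw [← φ.wire_src, ← φ.wire_tgt, e]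
  let ψ : Map (β.norm hβ) (α.norm hα) :=
    { wire := fun w => ⟨φ.wire w.1, kept_iff.2 fun b hb j e => by
        obtain ⟨w, hkw⟩ := w
        by_cases hb' : ∃ b', φ.box b' = b.2.2
        · obtain ⟨b', hb'⟩ := hb'
          refine kept_iff.1 hkw _ (h₂ hb b' hb') j (hw ?_)
          rw [φ.wire_tgt, ← e, ← hb']
        · obtain ⟨i | ⟨b', j'⟩, rfl⟩ := hβ.bij.2 w
          · exact hα.left_ne_tgt i b.2.2 j ((φ.map_left i).symm.trans e.symm)
          · have := hα.bij.1 (a₁ := Sum.inr ⟨⟨b'.1, b'.2.1, φ.box b'.2.2⟩, j'⟩)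
              (a₂ := Sum.inr ⟨b, j⟩) ((φ.wire_tgt _ _).symm.trans e.symm)
            cases this
            exact hb' ⟨_, rfl⟩⟩
      box := fun b => ⟨φ.box b.1, fun h => b.2 (h₂ h b.1 rfl)⟩
      wire_src := fun b i => Subtype.ext (φ.wire_src b.1 i)
      wire_tgt := fun b i => Subtype.ext (φ.wire_tgt b.1 i)
      lab_wire := fun w => φ.lab_wire w.1
      lab_box := fun b => φ.lab_box b.1
      map_left := fun i => Subtype.ext (φ.map_left i)
      map_right := fun i => Subtype.ext (φ.map_right i) }
  have hψ : ∀ k l, (ψ.box (k := k) (l := l)).Bijective := fun k l =>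
    ⟨fun b b' e => Subtype.ext (hφ k l (congrArg Subtype.val e)), fun ⟨b, hb⟩ => by
      obtain ⟨b', rfl⟩ := hr' b hb
      exact ⟨⟨b', fun h => hb (h₁ h)⟩, rfl⟩⟩
  exact ⟨ψ, ⟨ψ.wire_injective (norm_isStringDiagram _ _) (norm_isStringDiagram _ _)
    fun k l => (hψ k l).1, ψ.wire_surjective (norm_isStringDiagram _ _) fun k l => (hψ k l).2⟩, hψ⟩

/-! ### Composition by pushout -/

/-- The relation that generates the gluing of two cospans along the common foot. -/
inductive Glue (α : Cospan X Y) (β : Cospan Y Z) : α.G.W ⊕ β.G.W → α.G.W ⊕ β.G.W → Prop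
  | mk (i : Fin Y.n) : Glue α β (Sum.inl (α.right i)) (Sum.inr (β.left i))

/-- Composition of cospans: the apex is the pushout, computed separately on wires and on boxes of
every arity and coarity. -/
def comp (α : Cospan X Y) (β : Cospan Y Z) : Cospan X Z where
  G :=
    { W := Quot (Glue α β)
      B := fun k l => α.G.B k l ⊕ β.G.B k l
      src := fun b i => Sum.elim (fun b => Quot.mk _ (Sum.inl (α.G.src b i)))
        (fun b => Quot.mk _ (Sum.inr (β.G.src b i))) b
      tgt := fun b j => Sum.elim (fun b => Quot.mk _ (Sum.inl (α.G.tgt b j)))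
        (fun b => Quot.mk _ (Sum.inr (β.G.tgt b j))) b }
  finite_wires := inferInstance
  finite_boxes := Finite.of_surjective (α := α.G.Box ⊕ β.G.Box)
    (Sum.elim (fun b => ⟨b.1, b.2.1, Sum.inl b.2.2⟩) (fun b => ⟨b.1, b.2.1, Sum.inr b.2.2⟩)) <| by
      rintro ⟨k, l, b | b⟩
      · exact ⟨Sum.inl ⟨k, l, b⟩, rfl⟩
      · exact ⟨Sum.inr ⟨k, l, b⟩, rfl⟩
  lab :=
    { wire := Quot.lift (Sum.elim α.lab.wire β.lab.wire) <| by
        rintro _ _ ⟨i⟩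
        exact (α.lab_right i).trans (β.lab_left i).symm
      box := fun b => Sum.elim α.lab.box β.lab.box b
      wire_src := by
        rintro k l (b | b) i
        · exact α.lab.wire_src b i
        · exact β.lab.wire_src b i
      wire_tgt := by
        rintro k l (b | b) i
        · exact α.lab.wire_tgt b i
        · exact β.lab.wire_tgt b i }
  left i := Quot.mk _ (Sum.inl (α.left i))
  right i := Quot.mk _ (Sum.inr (β.right i))
  lab_left := α.lab_left
  lab_right := β.lab_right

section
variable (α : Cospan X Y) (β : Cospan Y Z)

/-- The wire of the composite given by a wire of the first cospan. -/
def wl (w : α.G.W) : (comp α β).G.W := Quot.mk _ (Sum.inl w)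

/-- The wire of the composite given by a wire of the second cospan. -/
def wr (w : β.G.W) : (comp α β).G.W := Quot.mk _ (Sum.inr w)

theorem glue (i : Fin Y.n) : wl α β (α.right i) = wr α β (β.left i) := Quot.sound ⟨i⟩

variable {α β}

/-- Every wire of a composite is a wire of the first cospan or an output of a box of the second,
but not both. -/
noncomputable def split (hβ : β.IsStringDiagram) : (comp α β).G.W → α.G.W ⊕ (b : β.G.Box) × Fin b.2.1 :=
  Quot.lift (Sum.elim Sum.inl fun w =>
      Sum.map α.right id ((Equiv.ofBijective _ hβ.bij).symm w)) <| by
    rintro _ _ ⟨i⟩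
    have : (Equiv.ofBijective _ hβ.bij).symm (β.left i) = Sum.inl i :=
      (Equiv.symm_apply_eq _).2 rfl
    simp [this]

@[simp] theorem split_wl (hβ : β.IsStringDiagram) (w : α.G.W) : split hβ (wl α β w) = Sum.inl w := rfl

theorem split_wr_start (hβ : β.IsStringDiagram) (s : β.Start) :
    split hβ (wr α β (β.start s)) = Sum.map α.right id s := by
  have : (Equiv.ofBijective _ hβ.bij).symm (β.start s) = s :=
    (Equiv.symm_apply_eq _).2 rfl
  show Sum.map α.right id _ = _
  rw [this]

@[simp] theorem split_wr_left (hβ : β.IsStringDiagram) (i : Fin Y.n) :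
    split hβ (wr α β (β.left i)) = Sum.inl (α.right i) := split_wr_start hβ (Sum.inl i)

theorem split_wr_tgt (hβ : β.IsStringDiagram) (b : β.G.Box) (j : Fin b.2.1) :
    split hβ (wr α β (β.G.tgt b.2.2 j)) = Sum.inr ⟨b, j⟩ := split_wr_start hβ (Sum.inr ⟨b, j⟩)

theorem wl_injective (hβ : β.IsStringDiagram) : (wl α β).Injective := fun w w' e => by
  simpa using congrArg (split hβ) e

theorem glue_of_eq (hβ : β.IsStringDiagram) {w : α.G.W} {w' : β.G.W} (e : wl α β w = wr α β w') :
    ∃ i, α.right i = w ∧ β.left i = w' := by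
  obtain ⟨s, rfl⟩ := hβ.bij.2 w'
  have := congrArg (split hβ) e
  rw [split_wl, split_wr_start] at this
  rcases s with i | s
  · exact ⟨i, (Sum.inl.inj this).symm, rfl⟩
  · cases this

theorem eq_of_wr_eq (hβ : β.IsStringDiagram) {w : β.G.W} {b : β.G.Box} {j : Fin b.2.1}
    (e : wr α β w = wr α β (β.G.tgt b.2.2 j)) : w = β.G.tgt b.2.2 j := by
  obtain ⟨s, rfl⟩ := hβ.bij.2 w
  have := congrArg (split hβ) e
  rw [split_wr_tgt, split_wr_start] at this
  rcases s with i | s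
  · cases this
  · obtain rfl := Sum.inr.inj this
    rfl

theorem comp_start_bijective (hβ : β.IsStringDiagram) (hα : α.IsStringDiagram) : (comp α β).start.Bijective := by
  let τ : α.G.W ⊕ (b : β.G.Box) × Fin b.2.1 → (comp α β).Start :=
    Sum.elim (fun w => Sum.map id (fun s => ⟨⟨s.1.1, s.1.2.1, Sum.inl s.1.2.2⟩, s.2⟩)
        ((Equiv.ofBijective _ hα.bij).symm w))
      (fun s => Sum.inr ⟨⟨s.1.1, s.1.2.1, Sum.inr s.1.2.2⟩, s.2⟩)
  have hs : ∀ s, (Equiv.ofBijective _ hα.bij).symm (α.start s) = s :=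
    fun s => (Equiv.symm_apply_eq _).2 rfl
  constructor
  · refine Function.LeftInverse.injective (g := fun w => τ (split hβ w)) ?_
    rintro (i | ⟨⟨k, l, b | b⟩, j⟩)
    · show Sum.map _ _ ((Equiv.ofBijective _ hα.bij).symm (α.start (Sum.inl i))) = _
      rw [hs]; rfl
    · show Sum.map _ _ ((Equiv.ofBijective _ hα.bij).symm (α.start (Sum.inr ⟨⟨k, l, b⟩, j⟩))) = _
      rw [hs]; rfl
    · show τ (split hβ (wr α β (β.G.tgt b j))) = _
      rw [split_wr_tgt hβ ⟨k, l, b⟩ j]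
      rfl
  · have hl : ∀ w, ∃ s, (comp α β).start s = wl α β w := by
      intro w
      obtain ⟨i | ⟨⟨k, l, b⟩, j⟩, rfl⟩ := hα.bij.2 w
      · exact ⟨Sum.inl i, rfl⟩
      · exact ⟨Sum.inr ⟨⟨k, l, Sum.inl b⟩, j⟩, rfl⟩
    rintro ⟨w | w⟩
    · exact hl w
    · obtain ⟨i | ⟨⟨k, l, b⟩, j⟩, rfl⟩ := hβ.bij.2 w
      · obtain ⟨s, hs⟩ := hl (α.right i)
        exact ⟨s, hs.trans (glue α β i)⟩
      · exact ⟨Sum.inr ⟨⟨k, l, Sum.inr b⟩, j⟩, rfl⟩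

theorem comp_acyclic (hβ : β.IsStringDiagram) (hα : α.IsStringDiagram) : (comp α β).G.Acyclic := by
  let T : α.G.W ⊕ ((b : β.G.Box) × Fin b.2.1) → α.G.W ⊕ ((b : β.G.Box) × Fin b.2.1) → Prop :=
    fun x y => match x, y with
      | Sum.inl w, Sum.inl w' => Relation.TransGen α.G.Step w w'
      | Sum.inl _, Sum.inr _ => True
      | Sum.inr _, Sum.inl _ => False
      | Sum.inr s, Sum.inr s' =>
          Relation.TransGen β.G.Step (β.start (Sum.inr s)) (β.start (Sum.inr s'))
  have hT : ∀ x y z, T x y → T y z → T x z := by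
    rintro (x | x) (y | y) (z | z) h h' <;>
      first | trivial | exact h.elim | exact h'.elim | exact Relation.TransGen.trans h h'
  have hstep : ∀ w w', (comp α β).G.Step w w' → T (split hβ w) (split hβ w') := by
    intro w w' h
    rw [Hypergraph.step_iff] at h
    obtain ⟨⟨k, l, b | b⟩, ⟨i, rfl⟩, ⟨j, rfl⟩⟩ := h
    · exact .single (Hypergraph.step_iff.2 ⟨⟨k, l, b⟩, ⟨i, rfl⟩, ⟨j, rfl⟩⟩)
    · show T (split hβ (wr α β (β.G.src b i))) (split hβ (wr α β (β.G.tgt b j)))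
      rw [split_wr_tgt hβ ⟨k, l, b⟩ j]
      obtain ⟨s, hs⟩ := hβ.bij.2 (β.G.src b i)
      rw [← hs, split_wr_start]
      rcases s with s | s
      · trivial
      · exact .single (Hypergraph.step_iff.2 ⟨⟨k, l, b⟩, ⟨i, hs.symm⟩, ⟨j, rfl⟩⟩)
  intro w hw
  have : T (split hβ w) (split hβ w) := by
    have key : ∀ w', Relation.TransGen (comp α β).G.Step w w' → T (split hβ w) (split hβ w') := by
      intro w' h
      induction h with
      | single h => exact hstep _ _ h
      | tail _ h ih => exact hT _ _ _ ih (hstep _ _ h)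
    exact key w hw
  rcases h : split hβ w with x | x
  · rw [h] at this
    exact hα.acyclic _ this
  · rw [h] at this
    exact hβ.acyclic _ this

theorem comp_isStringDiagram (hβ : β.IsStringDiagram) (hα : α.IsStringDiagram) : (comp α β).IsStringDiagram :=
  ⟨comp_acyclic hβ hα, leftMonogamous_iff.2 (comp_start_bijective hβ hα)⟩

theorem Removed.comp_inl (hβ : β.IsStringDiagram) {b : α.G.Box} (hb : α.Removed b) :
    (comp α β).Removed ⟨b.1, b.2.1, Sum.inl b.2.2⟩ := by
  refine Removed.rec' (P := fun b => (comp α β).Removed ⟨b.1, b.2.1, Sum.inl b.2.2⟩)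
    (fun b h ih => ?_) hb
  · refine .mk _ (fun j i e => ?_) ?_
    · obtain ⟨i', h', -⟩ := glue_of_eq hβ (w := α.G.tgt b.2.2 j) (w' := β.right i) e.symm
      exact h _ _ h'
    · rintro ⟨k, l, b' | b'⟩ i j e
      · exact ih ⟨k, l, b'⟩ i j (wl_injective hβ e)
      · obtain ⟨i', h', -⟩ := glue_of_eq hβ (w := α.G.tgt b.2.2 j) (w' := β.G.src b' i) e.symm
        exact absurd h' (h _ _)

theorem Removed.comp_inr (hβ : β.IsStringDiagram) {b : β.G.Box} (hb : β.Removed b) :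
    (comp α β).Removed ⟨b.1, b.2.1, Sum.inr b.2.2⟩ := by
  refine Removed.rec' (P := fun b => (comp α β).Removed ⟨b.1, b.2.1, Sum.inr b.2.2⟩)
    (fun b h ih => ?_) hb
  · refine .mk _ (fun j i e => ?_) ?_
    · exact h j i (eq_of_wr_eq hβ e)
    · rintro ⟨k, l, b' | b'⟩ i j e
      · obtain ⟨i', -, h'⟩ := glue_of_eq hβ (w := α.G.src b' i) (w' := β.G.tgt b.2.2 j) e
        exact absurd h' (hβ.left_ne_tgt i' b.2.2 j)
      · exact ih ⟨k, l, b'⟩ i j (eq_of_wr_eq hβ e)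

end

/-- Composition of cospans is functorial in maps of cospans. -/
def Map.comp {α α' : Cospan X Y} {β β' : Cospan Y Z} (φ : Map α α') (ψ : Map β β') :
    Map (α.comp β) (α'.comp β') where
  wire := Quot.map (Sum.map φ.wire ψ.wire) <| by
    rintro _ _ ⟨i⟩
    have := Glue.mk (α := α') (β := β') i
    rwa [← φ.map_right, ← ψ.map_left] at this
  box := Sum.map φ.box ψ.box
  wire_src := by
    rintro k l (b | b) i
    · exact congrArg (wl α' β') (φ.wire_src b i)
    · exact congrArg (wr α' β') (ψ.wire_src b i)
  wire_tgt := by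
    rintro k l (b | b) i
    · exact congrArg (wl α' β') (φ.wire_tgt b i)
    · exact congrArg (wr α' β') (ψ.wire_tgt b i)
  lab_wire := by
    rintro ⟨w | w⟩
    · exact φ.lab_wire w
    · exact ψ.lab_wire w
  lab_box := by
    rintro k l (b | b)
    · exact φ.lab_box b
    · exact ψ.lab_box b
  map_left i := congrArg (wl α' β') (φ.map_left i)
  map_right i := congrArg (wr α' β') (ψ.map_right i)

end Cospan

/-! ### Tensor product -/

namespace FreeMarkov

/-- Tensor product of objects: concatenation of the labellings. -/
abbrev tensor (X Y : FreeMarkov S) : FreeMarkov S := ⟨X.n + Y.n, Fin.append X.label Y.label⟩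

theorem tensor_label_castAdd (X Y : FreeMarkov S) (i : Fin X.n) :
    (X.tensor Y).label (Fin.castAdd Y.n i) = X.label i := Fin.append_left X.label Y.label i

theorem tensor_label_natAdd (X Y : FreeMarkov S) (i : Fin Y.n) :
    (X.tensor Y).label (Fin.natAdd X.n i) = Y.label i := Fin.append_right X.label Y.label i

/-- The unit object. -/
abbrev unit (S : Hypergraph.{u, v}) : FreeMarkov S := ⟨0, Fin.elim0⟩

end FreeMarkov

namespace Cospan

variable {X Y Z X' Y' Z' : FreeMarkov S}

/-- Tensor product of cospans: disjoint union. -/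
def tensor (α : Cospan X Y) (β : Cospan X' Y') : Cospan (X.tensor X') (Y.tensor Y') where
  G :=
    { W := α.G.W ⊕ β.G.W
      B := fun k l => α.G.B k l ⊕ β.G.B k l
      src := fun b i => Sum.elim (fun b => Sum.inl (α.G.src b i))
        (fun b => Sum.inr (β.G.src b i)) b
      tgt := fun b j => Sum.elim (fun b => Sum.inl (α.G.tgt b j))
        (fun b => Sum.inr (β.G.tgt b j)) b }
  finite_wires := inferInstance
  finite_boxes := Finite.of_surjective (α := α.G.Box ⊕ β.G.Box)
    (Sum.elim (fun b => ⟨b.1, b.2.1, Sum.inl b.2.2⟩) (fun b => ⟨b.1, b.2.1, Sum.inr b.2.2⟩)) <| by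
      rintro ⟨k, l, b | b⟩
      · exact ⟨Sum.inl ⟨k, l, b⟩, rfl⟩
      · exact ⟨Sum.inr ⟨k, l, b⟩, rfl⟩
  lab :=
    { wire := Sum.elim α.lab.wire β.lab.wire
      box := fun b => Sum.elim α.lab.box β.lab.box b
      wire_src := by
        rintro k l (b | b) i
        · exact α.lab.wire_src b i
        · exact β.lab.wire_src b i
      wire_tgt := by
        rintro k l (b | b) i
        · exact α.lab.wire_tgt b i
        · exact β.lab.wire_tgt b i }
  left := Fin.append (fun i => Sum.inl (α.left i)) (fun i => Sum.inr (β.left i))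
  right := Fin.append (fun i => Sum.inl (α.right i)) (fun i => Sum.inr (β.right i))
  lab_left := Fin.addCases
    (fun i => by simpa [FreeMarkov.tensor] using α.lab_left i)
    (fun i => by simpa [FreeMarkov.tensor] using β.lab_left i)
  lab_right := Fin.addCases
    (fun i => by simpa [FreeMarkov.tensor] using α.lab_right i)
    (fun i => by simpa [FreeMarkov.tensor] using β.lab_right i)

theorem tensor_left_castAdd (α : Cospan X Y) (β : Cospan X' Y') (i : Fin X.n) :
    (tensor α β).left (Fin.castAdd X'.n i) = Sum.inl (α.left i) :=
  Fin.append_left (fun i => Sum.inl (α.left i)) (fun i => Sum.inr (β.left i)) i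

theorem tensor_left_natAdd (α : Cospan X Y) (β : Cospan X' Y') (i : Fin X'.n) :
    (tensor α β).left (Fin.natAdd X.n i) = Sum.inr (β.left i) :=
  Fin.append_right (fun i => Sum.inl (α.left i)) (fun i => Sum.inr (β.left i)) i

theorem tensor_right_castAdd (α : Cospan X Y) (β : Cospan X' Y') (i : Fin Y.n) :
    (tensor α β).right (Fin.castAdd Y'.n i) = Sum.inl (α.right i) :=
  Fin.append_left (fun i => Sum.inl (α.right i)) (fun i => Sum.inr (β.right i)) i

theorem tensor_right_natAdd (α : Cospan X Y) (β : Cospan X' Y') (i : Fin Y'.n) :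
    (tensor α β).right (Fin.natAdd Y.n i) = Sum.inr (β.right i) :=
  Fin.append_right (fun i => Sum.inl (α.right i)) (fun i => Sum.inr (β.right i)) i

section
variable {α : Cospan X Y} {β : Cospan X' Y'}

theorem tensor_isStringDiagram (hα : α.IsStringDiagram) (hβ : β.IsStringDiagram) :
    (tensor α β).IsStringDiagram := by
  refine ⟨?_, leftMonogamous_iff.2 ⟨?_, ?_⟩⟩
  · let T : α.G.W ⊕ β.G.W → α.G.W ⊕ β.G.W → Prop :=
      Sum.LiftRel (Relation.TransGen α.G.Step) (Relation.TransGen β.G.Step)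
    have hstep : ∀ w w', (tensor α β).G.Step w w' → T w w' := by
      intro w w' h
      rw [Hypergraph.step_iff] at h
      obtain ⟨⟨k, l, b | b⟩, ⟨i, rfl⟩, ⟨j, rfl⟩⟩ := h
      · exact .inl (.single (Hypergraph.step_iff.2 ⟨⟨k, l, b⟩, ⟨i, rfl⟩, ⟨j, rfl⟩⟩))
      · exact .inr (.single (Hypergraph.step_iff.2 ⟨⟨k, l, b⟩, ⟨i, rfl⟩, ⟨j, rfl⟩⟩))
    intro w hw
    have key : ∀ w', Relation.TransGen (tensor α β).G.Step w w' → T w w' := by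
      intro w' h
      induction h with
      | single h => exact hstep _ _ h
      | tail _ h ih =>
        rcases ih with ⟨ih⟩ | ⟨ih⟩ <;> rcases hstep _ _ h with ⟨h'⟩ | ⟨h'⟩
        · exact .inl (ih.trans h')
        · exact .inr (ih.trans h')
    rcases key w hw with ⟨h⟩ | ⟨h⟩
    · exact hα.acyclic _ h
    · exact hβ.acyclic _ h
  · let τ : (tensor α β).G.W → (tensor α β).Start := Sum.elim
      (fun w => Sum.map (Fin.castAdd X'.n) (fun s => ⟨⟨s.1.1, s.1.2.1, Sum.inl s.1.2.2⟩, s.2⟩)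
        ((Equiv.ofBijective _ hα.bij).symm w))
      (fun w => Sum.map (Fin.natAdd X.n) (fun s => ⟨⟨s.1.1, s.1.2.1, Sum.inr s.1.2.2⟩, s.2⟩)
        ((Equiv.ofBijective _ hβ.bij).symm w))
    have hs : ∀ s, (Equiv.ofBijective _ hα.bij).symm (α.start s) = s :=
      fun s => (Equiv.symm_apply_eq _).2 rfl
    have hs' : ∀ s, (Equiv.ofBijective _ hβ.bij).symm (β.start s) = s :=
      fun s => (Equiv.symm_apply_eq _).2 rfl
    refine Function.LeftInverse.injective (g := τ) ?_
    rintro (i | ⟨⟨k, l, b | b⟩, j⟩)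
    · refine Fin.addCases (fun i => ?_) (fun i => ?_) i
      · show τ ((tensor α β).left (Fin.castAdd _ i)) = _
        rw [tensor_left_castAdd]
        show Sum.map _ _ ((Equiv.ofBijective _ hα.bij).symm (α.start (Sum.inl i))) = _
        rw [hs]; rfl
      · show τ ((tensor α β).left (Fin.natAdd _ i)) = _
        rw [tensor_left_natAdd]
        show Sum.map _ _ ((Equiv.ofBijective _ hβ.bij).symm (β.start (Sum.inl i))) = _
        rw [hs']; rfl
    · show Sum.map _ _ ((Equiv.ofBijective _ hα.bij).symm (α.start (Sum.inr ⟨⟨k, l, b⟩, j⟩))) = _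
      rw [hs]; rfl
    · show Sum.map _ _ ((Equiv.ofBijective _ hβ.bij).symm (β.start (Sum.inr ⟨⟨k, l, b⟩, j⟩))) = _
      rw [hs']; rfl
  · rintro (w | w)
    · obtain ⟨i | ⟨⟨k, l, b⟩, j⟩, rfl⟩ := hα.bij.2 w
      · exact ⟨Sum.inl (Fin.castAdd _ i), tensor_left_castAdd _ _ i⟩
      · exact ⟨Sum.inr ⟨⟨k, l, Sum.inl b⟩, j⟩, rfl⟩
    · obtain ⟨i | ⟨⟨k, l, b⟩, j⟩, rfl⟩ := hβ.bij.2 w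
      · exact ⟨Sum.inl (Fin.natAdd _ i), tensor_left_natAdd _ _ i⟩
      · exact ⟨Sum.inr ⟨⟨k, l, Sum.inr b⟩, j⟩, rfl⟩

theorem Removed.tensor_inl {b : α.G.Box} (hb : α.Removed b) :
    (tensor α β).Removed ⟨b.1, b.2.1, Sum.inl b.2.2⟩ := by
  refine Removed.rec' (P := fun b => (tensor α β).Removed ⟨b.1, b.2.1, Sum.inl b.2.2⟩)
    (fun b h ih => ?_) hb
  · refine .mk _ (fun j i => ?_) ?_
    · refine Fin.addCases (fun i => ?_) (fun i => ?_) i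
      · simpa [tensor] using h j i
      · simp [tensor]
    · rintro ⟨k, l, b' | b'⟩ i j e
      · exact ih ⟨k, l, b'⟩ i j (Sum.inl.inj e)
      · cases e

theorem Removed.tensor_inr {b : β.G.Box} (hb : β.Removed b) :
    (tensor α β).Removed ⟨b.1, b.2.1, Sum.inr b.2.2⟩ := by
  refine Removed.rec' (P := fun b => (tensor α β).Removed ⟨b.1, b.2.1, Sum.inr b.2.2⟩)
    (fun b h ih => ?_) hb
  · refine .mk _ (fun j i => ?_) ?_
    · refine Fin.addCases (fun i => ?_) (fun i => ?_) i
      · simp [tensor]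
      · simpa [tensor] using h j i
    · rintro ⟨k, l, b' | b'⟩ i j e
      · cases e
      · exact ih ⟨k, l, b'⟩ i j (Sum.inr.inj e)

end

/-- The tensor product of cospans is functorial in maps of cospans. -/
def Map.tensor {α α' : Cospan X Y} {β β' : Cospan X' Y'} (φ : Map α α') (ψ : Map β β') :
    Map (α.tensor β) (α'.tensor β') where
  wire := Sum.map φ.wire ψ.wire
  box := Sum.map φ.box ψ.box
  wire_src := by
    rintro k l (b | b) i
    · exact congrArg Sum.inl (φ.wire_src b i)
    · exact congrArg Sum.inr (ψ.wire_src b i)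
  wire_tgt := by
    rintro k l (b | b) i
    · exact congrArg Sum.inl (φ.wire_tgt b i)
    · exact congrArg Sum.inr (ψ.wire_tgt b i)
  lab_wire := by
    rintro (w | w)
    · exact φ.lab_wire w
    · exact ψ.lab_wire w
  lab_box := by
    rintro k l (b | b)
    · exact φ.lab_box b
    · exact ψ.lab_box b
  map_left := Fin.addCases (fun i => by simp [Cospan.tensor, φ.map_left])
    (fun i => by simp [Cospan.tensor, ψ.map_left])
  map_right := Fin.addCases (fun i => by simp [Cospan.tensor, φ.map_right])
    (fun i => by simp [Cospan.tensor, ψ.map_right])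

theorem Normalized.tensor {α : Cospan X Y} {β : Cospan X' Y'} (hα : α.Normalized)
    (hβ : β.Normalized) : (tensor α β).Normalized := by
  rintro ⟨k, l, b | b⟩ h
  · refine hα ⟨k, l, b⟩ fun w hw => ?_
    obtain ⟨j, rfl⟩ := Hypergraph.outCount_pos.1 hw
    obtain ⟨h₁, h₂⟩ := h (Sum.inl (α.G.tgt b j)) (Hypergraph.outCount_pos.2 ⟨j, rfl⟩)
    refine ⟨fun i e => h₁ (Fin.castAdd _ i) (by rw [tensor_right_castAdd, e]), fun b' => ?_⟩
    have := h₂ ⟨b'.1, b'.2.1, Sum.inl b'.2.2⟩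
    by_contra hb'
    obtain ⟨i, hi⟩ := Hypergraph.inCount_pos.1 (Nat.pos_of_ne_zero hb')
    have hp : 0 < (Cospan.tensor α β).G.inCount ⟨b'.1, b'.2.1, Sum.inl b'.2.2⟩ (Sum.inl (α.G.tgt b j)) :=
      Hypergraph.inCount_pos.2 ⟨i, congrArg Sum.inl hi⟩
    exact hp.ne' this
  · refine hβ ⟨k, l, b⟩ fun w hw => ?_
    obtain ⟨j, rfl⟩ := Hypergraph.outCount_pos.1 hw
    obtain ⟨h₁, h₂⟩ := h (Sum.inr (β.G.tgt b j)) (Hypergraph.outCount_pos.2 ⟨j, rfl⟩)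
    refine ⟨fun i e => h₁ (Fin.natAdd _ i) (by rw [tensor_right_natAdd, e]), fun b' => ?_⟩
    have := h₂ ⟨b'.1, b'.2.1, Sum.inr b'.2.2⟩
    by_contra hb'
    obtain ⟨i, hi⟩ := Hypergraph.inCount_pos.1 (Nat.pos_of_ne_zero hb')
    have hp : 0 < (Cospan.tensor α β).G.inCount ⟨b'.1, b'.2.1, Sum.inr b'.2.2⟩ (Sum.inr (β.G.tgt b j)) :=
      Hypergraph.inCount_pos.2 ⟨i, congrArg Sum.inr hi⟩
    exact hp.ne' this

/-! ### Pure circuitry -/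

/-- The string diagram without boxes whose left leg is the identity and whose right leg is `f`. -/
def circuit (f : Fin Y.n → Fin X.n) (hf : ∀ i, X.label (f i) = Y.label i) : Cospan X Y where
  G :=
    { W := Fin X.n
      B := fun _ _ => Empty
      src := fun b => b.elim
      tgt := fun b => b.elim }
  finite_wires := inferInstance
  finite_boxes := Finite.of_injective (β := Empty) (fun b => b.2.2) fun b => b.2.2.elim
  lab :=
    { wire := X.label
      box := fun b => b.elim
      wire_src := fun b => b.elim
      wire_tgt := fun b => b.elim }
  left := id
  right := f
  lab_left _ := rfl
  lab_right := hf

instance (f : Fin Y.n → Fin X.n) (hf : ∀ i, X.label (f i) = Y.label i) (k l : ℕ) :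
    IsEmpty ((circuit f hf).G.B k l) := inferInstanceAs (IsEmpty Empty)

theorem circuit_isStringDiagram (f : Fin Y.n → Fin X.n) (hf : ∀ i, X.label (f i) = Y.label i) :
    (circuit f hf).IsStringDiagram := by
  refine ⟨fun w hw => ?_, leftMonogamous_iff.2 ⟨?_, fun w => ⟨Sum.inl w, rfl⟩⟩⟩
  · obtain ⟨w', h, -⟩ := Relation.TransGen.head'_iff.1 hw
    obtain ⟨b, -⟩ := h
    exact b.2.2.elim
  · rintro (i | b) (j | b')
    · exact congrArg Sum.inl
    · exact b'.1.2.2.elim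
    · exact b.1.2.2.elim
    · exact b.1.2.2.elim

theorem circuit_normalized (f : Fin Y.n → Fin X.n) (hf : ∀ i, X.label (f i) = Y.label i) :
    (circuit f hf).Normalized := fun b => b.2.2.elim

/-- Two normalized string diagrams are identified if they are isomorphic. -/
def setoid (X Y : FreeMarkov S) :
    Setoid {α : Cospan X Y // α.IsStringDiagram ∧ α.Normalized} where
  r α β := α.1.Isomorphic β.1
  iseqv := ⟨fun _ => .refl _, .symm, .trans⟩

end Cospan

/-! ### The free Markov category -/

namespace FreeMarkov

open Cospan

variable {X Y Z X' Y' Z' : FreeMarkov S}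

/-- Morphisms: isomorphism classes of normalized string diagrams. -/
def Hom (X Y : FreeMarkov S) : Type max 1 u v := Quotient (Cospan.setoid X Y)

/-- The morphism represented by the normalization of a string diagram. -/
def Hom.mk (α : Cospan X Y) (hα : α.IsStringDiagram) : Hom X Y :=
  Quotient.mk _ ⟨α.norm hα, norm_isStringDiagram α hα, norm_normalized α hα⟩

theorem Hom.mk_eq {β α : Cospan X Y} {hβ : β.IsStringDiagram} {hα : α.IsStringDiagram}
    (φ : Map β α) (hφ : ∀ k l, (φ.box (k := k) (l := l)).Injective)
    (hr : ∀ b : α.G.Box, (∀ b' : β.G.B b.1 b.2.1, φ.box b' ≠ b.2.2) → α.Removed b) :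
    Hom.mk β hβ = Hom.mk α hα :=
  Quotient.sound (norm_isomorphic hβ hα φ hφ hr)

theorem Hom.mk_eq' {β α : Cospan X Y} {hβ : β.IsStringDiagram} {hα : α.IsStringDiagram}
    (φ : Map β α) (hφ : ∀ k l, (φ.box (k := k) (l := l)).Bijective) :
    Hom.mk β hβ = Hom.mk α hα :=
  Hom.mk_eq φ (fun k l => (hφ k l).1) fun b h =>
    ((hφ b.1 b.2.1).2 b.2.2).elim fun b' hb' => (h b' hb').elim

theorem Hom.mk_of_normalized (α : Cospan X Y) (hα : α.IsStringDiagram) (h : α.Normalized) :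
    Hom.mk α hα = Quotient.mk _ ⟨α, hα, h⟩ := by
  refine Quotient.sound ?_
  have hb : ∀ k l, ((α.normIncl hα).box (k := k) (l := l)).Bijective := fun k l =>
    ⟨Subtype.val_injective, fun b => ⟨⟨b, not_removed_of_normalized h _⟩, rfl⟩⟩
  exact ⟨α.normIncl hα, ⟨Subtype.val_injective,
    (α.normIncl hα).wire_surjective hα fun k l => (hb k l).2⟩, hb⟩

theorem Hom.exists_mk (f : Hom X Y) : ∃ α hα, f = Hom.mk α hα := by
  obtain ⟨⟨α, hα, h⟩, rfl⟩ := Quotient.exists_rep f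
  exact ⟨α, hα, (Hom.mk_of_normalized α hα h).symm⟩

/-- The morphism represented by a string diagram without boxes. -/
def Hom.circ (f : Fin Y.n → Fin X.n) (hf : ∀ i, X.label (f i) = Y.label i) : Hom X Y :=
  Quotient.mk _ ⟨circuit f hf, circuit_isStringDiagram f hf, circuit_normalized f hf⟩

theorem Hom.circ_eq (f : Fin Y.n → Fin X.n) (hf : ∀ i, X.label (f i) = Y.label i) :
    Hom.circ f hf = Hom.mk _ (circuit_isStringDiagram f hf) :=
  (Hom.mk_of_normalized _ _ (circuit_normalized f hf)).symm

/-- Composition: pushout composition followed by normalization. -/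
def Hom.comp (f : Hom X Y) (g : Hom Y Z) : Hom X Z :=
  Quotient.map₂ (sa := Cospan.setoid X Y) (sb := Cospan.setoid Y Z) (sc := Cospan.setoid X Z)
    (fun α β => ⟨(α.1.comp β.1).norm (comp_isStringDiagram β.2.1 α.2.1),
      norm_isStringDiagram _ _, norm_normalized _ _⟩)
    (by
      rintro ⟨α, hα⟩ ⟨α', hα'⟩ ⟨φ, -, hφ⟩ ⟨β, hβ⟩ ⟨β', hβ'⟩ ⟨ψ, -, hψ⟩
      have hb : ∀ k l, ((φ.comp ψ).box (k := k) (l := l)).Bijective := fun k l =>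
        Sum.map_bijective.2 ⟨hφ k l, hψ k l⟩
      exact norm_isomorphic (comp_isStringDiagram hβ.1 hα.1) (comp_isStringDiagram hβ'.1 hα'.1)
        (φ.comp ψ) (fun k l => (hb k l).1)
        fun b h => ((hb b.1 b.2.1).2 b.2.2).elim fun b' hb' => (h b' hb').elim) f g

/-- Tensor product of morphisms: disjoint union. -/
def Hom.tensor (f : Hom X Y) (g : Hom X' Y') : Hom (X.tensor X') (Y.tensor Y') :=
  Quotient.map₂ (sa := Cospan.setoid X Y) (sb := Cospan.setoid X' Y')
    (sc := Cospan.setoid (X.tensor X') (Y.tensor Y'))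
    (fun α β => ⟨α.1.tensor β.1, tensor_isStringDiagram α.2.1 β.2.1, α.2.2.tensor β.2.2⟩)
    (by
      rintro ⟨α, hα⟩ ⟨α', hα'⟩ ⟨φ, hφ, hφ'⟩ ⟨β, hβ⟩ ⟨β', hβ'⟩ ⟨ψ, hψ, hψ'⟩
      exact ⟨φ.tensor ψ, Sum.map_bijective.2 ⟨hφ, hψ⟩,
        fun k l => Sum.map_bijective.2 ⟨hφ' k l, hψ' k l⟩⟩) f g

theorem Hom.mk_comp (α : Cospan X Y) (hα) (β : Cospan Y Z) (hβ) :
    (Hom.mk α hα).comp (Hom.mk β hβ) = Hom.mk (α.comp β) (comp_isStringDiagram hβ hα) := by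
  refine Hom.mk_eq (hβ := comp_isStringDiagram (norm_isStringDiagram _ _)
    (norm_isStringDiagram _ _)) ((α.normIncl hα).comp (β.normIncl hβ))
    (fun k l => Sum.map_injective.2 ⟨Subtype.val_injective, Subtype.val_injective⟩) ?_
  rintro ⟨k, l, b | b⟩ h
  · by_contra hb
    exact h (Sum.inl ⟨b, fun hb' => hb (hb'.comp_inl hβ)⟩) rfl
  · by_contra hb
    exact h (Sum.inr ⟨b, fun hb' => hb (hb'.comp_inr hβ)⟩) rfl

theorem Hom.mk_tensor (α : Cospan X Y) (hα) (β : Cospan X' Y') (hβ) :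
    (Hom.mk α hα).tensor (Hom.mk β hβ) = Hom.mk (α.tensor β) (tensor_isStringDiagram hα hβ) := by
  refine (Hom.mk_of_normalized _ (tensor_isStringDiagram (norm_isStringDiagram α hα)
    (norm_isStringDiagram β hβ))
    ((norm_normalized α hα).tensor (norm_normalized β hβ))).symm.trans ?_
  refine Hom.mk_eq ((α.normIncl hα).tensor (β.normIncl hβ))
    (fun k l => Sum.map_injective.2 ⟨Subtype.val_injective, Subtype.val_injective⟩) ?_
  rintro ⟨k, l, b | b⟩ h
  · by_contra hb
    exact h (Sum.inl ⟨b, fun hb' => hb hb'.tensor_inl⟩) rfl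
  · by_contra hb
    exact h (Sum.inr ⟨b, fun hb' => hb hb'.tensor_inr⟩) rfl

theorem Hom.comp_assoc (f : Hom X Y) (g : Hom Y Z) (h : Hom Z Z') :
    (f.comp g).comp h = f.comp (g.comp h) := by
  obtain ⟨α, hα, rfl⟩ := f.exists_mk
  obtain ⟨β, hβ, rfl⟩ := g.exists_mk
  obtain ⟨γ, hγ, rfl⟩ := h.exists_mk
  simp only [mk_comp]
  refine Hom.mk_eq'
    { wire := Quot.lift (Sum.elim
        (Quot.lift (Sum.elim (fun w => wl _ _ w) (fun w => wr α (β.comp γ) (wl β γ w))) <| by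
          rintro _ _ ⟨i⟩
          exact glue α (β.comp γ) i)
        (fun w => wr α (β.comp γ) (wr β γ w))) <| by
          rintro _ _ ⟨i⟩
          exact congrArg (wr α (β.comp γ)) (glue β γ i)
      box := Equiv.sumAssoc _ _ _
      wire_src := by rintro k l ((b | b) | b) i <;> rfl
      wire_tgt := by rintro k l ((b | b) | b) i <;> rfl
      lab_wire := by
        rintro ⟨⟨w⟩ | w⟩
        · induction w using Quot.ind with
          | mk w => cases w <;> rfl
        · rfl
      lab_box := by rintro k l ((b | b) | b) <;> rfl
      map_left := fun _ => rfl
      map_right := fun _ => rfl } fun _ _ => (Equiv.sumAssoc _ _ _).bijective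

theorem Hom.tensor_comp {X₁ Y₁ Z₁ X₂ Y₂ Z₂ : FreeMarkov S} (f₁ : Hom X₁ Y₁) (f₂ : Hom X₂ Y₂)
    (g₁ : Hom Y₁ Z₁) (g₂ : Hom Y₂ Z₂) :
    (f₁.tensor f₂).comp (g₁.tensor g₂) = (f₁.comp g₁).tensor (f₂.comp g₂) := by
  obtain ⟨α₁, hα₁, rfl⟩ := f₁.exists_mk
  obtain ⟨α₂, hα₂, rfl⟩ := f₂.exists_mk
  obtain ⟨β₁, hβ₁, rfl⟩ := g₁.exists_mk
  obtain ⟨β₂, hβ₂, rfl⟩ := g₂.exists_mk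
  simp only [mk_comp, mk_tensor]
  refine Hom.mk_eq'
    { wire := Quot.lift (Sum.elim (Sum.map (wl _ _) (wl _ _)) (Sum.map (wr _ _) (wr _ _))) <| by
          rintro _ _ ⟨i⟩
          refine Fin.addCases (fun i => ?_) (fun i => ?_) i
          · exact (congrArg (Sum.map _ _) (tensor_right_castAdd α₁ α₂ i)).trans
              ((congrArg Sum.inl (glue α₁ β₁ i)).trans
              (congrArg (Sum.map (wr _ _) (wr _ _)) (tensor_left_castAdd β₁ β₂ i).symm))
          · exact (congrArg (Sum.map _ _) (tensor_right_natAdd α₁ α₂ i)).trans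
              ((congrArg Sum.inr (glue α₂ β₂ i)).trans
              (congrArg (Sum.map (wr _ _) (wr _ _)) (tensor_left_natAdd β₁ β₂ i).symm))
      box := Equiv.sumSumSumComm _ _ _ _
      wire_src := by rintro k l ((b | b) | (b | b)) i <;> rfl
      wire_tgt := by rintro k l ((b | b) | (b | b)) i <;> rfl
      lab_wire := by rintro ⟨(w | w) | (w | w)⟩ <;> rfl
      lab_box := by rintro k l ((b | b) | (b | b)) <;> rfl
      map_left := Fin.addCases
        (fun i => (congrArg (Sum.map (wl α₁ β₁) (wl α₂ β₂)) (tensor_left_castAdd α₁ α₂ i)).trans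
          (tensor_left_castAdd (α₁.comp β₁) (α₂.comp β₂) i).symm)
        (fun i => (congrArg (Sum.map (wl α₁ β₁) (wl α₂ β₂)) (tensor_left_natAdd α₁ α₂ i)).trans
          (tensor_left_natAdd (α₁.comp β₁) (α₂.comp β₂) i).symm)
      map_right := Fin.addCases
        (fun i => (congrArg (Sum.map (wr α₁ β₁) (wr α₂ β₂)) (tensor_right_castAdd β₁ β₂ i)).trans
          (tensor_right_castAdd (α₁.comp β₁) (α₂.comp β₂) i).symm)
        (fun i => (congrArg (Sum.map (wr α₁ β₁) (wr α₂ β₂)) (tensor_right_natAdd β₁ β₂ i)).trans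
          (tensor_right_natAdd (α₁.comp β₁) (α₂.comp β₂) i).symm) }
    fun _ _ => (Equiv.sumSumSumComm _ _ _ _).bijective

/-- Reindexing the output interfaces of a string diagram. -/
def _root_.GSMon.Cospan.post (α : Cospan X Y) (f : Fin Z.n → Fin Y.n)
    (hf : ∀ i, Y.label (f i) = Z.label i) : Cospan X Z :=
  { α with right := fun i => α.right (f i), lab_right := fun i => (α.lab_right _).trans (hf i) }

theorem _root_.GSMon.Cospan.post_isStringDiagram {α : Cospan X Y} (hα : α.IsStringDiagram)
    (f : Fin Z.n → Fin Y.n) (hf : ∀ i, Y.label (f i) = Z.label i) :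
    (α.post f hf).IsStringDiagram := ⟨hα.1, hα.2⟩

/-- Reindexing the input interfaces of a string diagram. -/
def _root_.GSMon.Cospan.pre (e : Fin Y.n ≃ Fin X.n) (he : ∀ i, X.label (e i) = Y.label i)
    (α : Cospan Y Z) : Cospan X Z :=
  { α with
    left := fun i => α.left (e.symm i)
    lab_left := fun i => by rw [α.lab_left, ← he, e.apply_symm_apply] }

theorem _root_.GSMon.Cospan.pre_isStringDiagram (e : Fin Y.n ≃ Fin X.n)
    (he : ∀ i, X.label (e i) = Y.label i) {α : Cospan Y Z} (hα : α.IsStringDiagram) :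
    (α.pre e he).IsStringDiagram := by
  refine ⟨hα.1, leftMonogamous_iff.2 ?_⟩
  have : (α.pre e he).start = α.start ∘ (Equiv.sumCongr e.symm (Equiv.refl _)) := by
    funext s
    rcases s with s | s <;> rfl
  rw [this]
  exact hα.bij.comp (Equiv.bijective _)

theorem Hom.mk_comp_circ (α : Cospan X Y) (hα) (f : Fin Z.n → Fin Y.n)
    (hf : ∀ i, Y.label (f i) = Z.label i) :
    (Hom.mk α hα).comp (Hom.circ f hf) = Hom.mk (α.post f hf) (post_isStringDiagram hα f hf) := by
  rw [circ_eq, mk_comp]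
  refine Hom.mk_eq'
    { wire := Quot.lift (Sum.elim id α.right) (by rintro _ _ ⟨i⟩; rfl)
      box := Equiv.sumEmpty _ _
      wire_src := by rintro k l (b | b) i; exacts [rfl, b.elim]
      wire_tgt := by rintro k l (b | b) i; exacts [rfl, b.elim]
      lab_wire := by
        rintro ⟨w | w⟩
        · rfl
        · exact α.lab_right w
      lab_box := by rintro k l (b | b); exacts [rfl, b.elim]
      map_left := fun _ => rfl
      map_right := fun _ => rfl } fun _ _ => (Equiv.sumEmpty _ _).bijective

theorem Hom.circ_comp_mk (e : Fin Y.n ≃ Fin X.n) (he : ∀ i, X.label (e i) = Y.label i)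
    (α : Cospan Y Z) (hα) :
    (Hom.circ e he).comp (Hom.mk α hα) = Hom.mk (α.pre e he) (pre_isStringDiagram e he hα) := by
  rw [circ_eq, mk_comp]
  refine Hom.mk_eq'
    { wire := Quot.lift (Sum.elim (fun i => α.left (e.symm i)) id) (by
        rintro _ _ ⟨i⟩
        exact congrArg α.left (e.symm_apply_apply i))
      box := Equiv.emptySum _ _
      wire_src := by rintro k l (b | b) i; exacts [b.elim, rfl]
      wire_tgt := by rintro k l (b | b) i; exacts [b.elim, rfl]
      lab_wire := by
        rintro ⟨w | w⟩
        · exact (α.pre e he).lab_left w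
        · rfl
      lab_box := by rintro k l (b | b); exacts [b.elim, rfl]
      map_left := fun _ => rfl
      map_right := fun _ => rfl } fun _ _ => (Equiv.emptySum _ _).bijective

theorem Hom.circ_comp (f : Fin Y.n → Fin X.n) (hf : ∀ i, X.label (f i) = Y.label i)
    (g : Fin Z.n → Fin Y.n) (hg : ∀ i, Y.label (g i) = Z.label i) :
    (Hom.circ f hf).comp (Hom.circ g hg) =
      Hom.circ (fun i => f (g i)) (fun i => (hf _).trans (hg i)) := by
  rw [circ_eq f, mk_comp_circ, circ_eq]
  rfl

/-- The function that describes the tensor product of two circuits. -/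
def tmap {x y x' y' : ℕ} (f : Fin y → Fin x) (g : Fin y' → Fin x') : Fin (y + y') → Fin (x + x') :=
  Fin.append (fun i => Fin.castAdd x' (f i)) (fun i => Fin.natAdd x (g i))

@[simp] theorem tmap_castAdd {x y x' y' : ℕ} (f : Fin y → Fin x) (g : Fin y' → Fin x') (i) :
    tmap f g (Fin.castAdd y' i) = Fin.castAdd x' (f i) := Fin.append_left ..

@[simp] theorem tmap_natAdd {x y x' y' : ℕ} (f : Fin y → Fin x) (g : Fin y' → Fin x') (i) :
    tmap f g (Fin.natAdd y i) = Fin.natAdd x (g i) := Fin.append_right ..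

theorem Hom.circ_tensor (f : Fin Y.n → Fin X.n) (hf : ∀ i, X.label (f i) = Y.label i)
    (g : Fin Y'.n → Fin X'.n) (hg : ∀ i, X'.label (g i) = Y'.label i) :
    (Hom.circ f hf).tensor (Hom.circ g hg) =
      Hom.circ (X := X.tensor X') (Y := Y.tensor Y') (tmap f g)
        (Fin.addCases (fun i => by simpa using hf i) (fun i => by simpa using hg i)) := by
  rw [circ_eq f, circ_eq g, mk_tensor]
  refine Eq.trans ?_ (circ_eq (X := X.tensor X') (Y := Y.tensor Y') (tmap f g) _).symm
  refine Hom.mk_eq'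
    { wire := Sum.elim (Fin.castAdd _) (Fin.natAdd _)
      box := Equiv.sumEmpty _ _
      wire_src := by rintro k l (b | b) <;> exact b.elim
      wire_tgt := by rintro k l (b | b) <;> exact b.elim
      lab_wire := by
        rintro (w | w)
        · exact Fin.append_left ..
        · exact Fin.append_right ..
      lab_box := by rintro k l (b | b) <;> exact b.elim
      map_left := Fin.addCases
        (fun i => congrArg (Sum.elim _ _) (tensor_left_castAdd (circuit f hf) (circuit g hg) i))
        (fun i => congrArg (Sum.elim _ _) (tensor_left_natAdd (circuit f hf) (circuit g hg) i))
      map_right := Fin.addCases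
        (fun i => (congrArg (Sum.elim (Fin.castAdd _) (Fin.natAdd _))
          (tensor_right_castAdd (circuit f hf) (circuit g hg) i)).trans (tmap_castAdd f g i).symm)
        (fun i => (congrArg (Sum.elim (Fin.castAdd _) (Fin.natAdd _))
          (tensor_right_natAdd (circuit f hf) (circuit g hg) i)).trans (tmap_natAdd f g i).symm) }
    fun _ _ => (Equiv.sumEmpty _ _).bijective

theorem Hom.circ_congr {f g : Fin Y.n → Fin X.n} {hf : ∀ i, X.label (f i) = Y.label i}
    {hg : ∀ i, X.label (g i) = Y.label i} (h : ∀ i, f i = g i) :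
    Hom.circ f hf = Hom.circ g hg := by
  obtain rfl : f = g := funext h
  rfl

instance : Category (FreeMarkov S) where
  Hom := Hom
  id X := Hom.circ id fun _ => rfl
  comp := Hom.comp
  id_comp {X Y} f := by
    obtain ⟨α, hα, rfl⟩ := Hom.exists_mk f
    exact Hom.circ_comp_mk (Equiv.refl _) (fun _ => rfl) α hα
  comp_id {X Y} f := by
    obtain ⟨α, hα, rfl⟩ := Hom.exists_mk f
    exact Hom.mk_comp_circ α hα id fun _ => rfl
  assoc := Hom.comp_assoc

theorem comp_def (f : X ⟶ Y) (g : Y ⟶ Z) : f ≫ g = Hom.comp f g := rfl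

theorem id_def (X : FreeMarkov S) : 𝟙 X = Hom.circ id fun _ => rfl := rfl

/-- The isomorphism given by a bijective reindexing of interfaces. -/
def circIso (e : Fin Y.n ≃ Fin X.n) (he : ∀ i, X.label (e i) = Y.label i) : X ≅ Y where
  hom := Hom.circ e he
  inv := Hom.circ e.symm fun i => by rw [← he, e.apply_symm_apply]
  hom_inv_id := (Hom.circ_comp ..).trans (Hom.circ_congr fun i => e.apply_symm_apply i)
  inv_hom_id := (Hom.circ_comp ..).trans (Hom.circ_congr fun i => e.symm_apply_apply i)

/-- Reassociation of interfaces. -/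
def assocE (x y z : ℕ) : Fin (x + (y + z)) ≃ Fin (x + y + z) := finCongr (Nat.add_assoc x y z).symm

section
variable {x y z : ℕ}

@[simp] theorem assocE_castAdd (i : Fin x) :
    assocE x y z (Fin.castAdd _ i) = Fin.castAdd _ (Fin.castAdd _ i) := rfl
@[simp] theorem assocE_natAdd_castAdd (i : Fin y) :
    assocE x y z (Fin.natAdd _ (Fin.castAdd _ i)) = Fin.castAdd _ (Fin.natAdd _ i) := rfl
@[simp] theorem assocE_natAdd_natAdd (i : Fin z) :
    assocE x y z (Fin.natAdd _ (Fin.natAdd _ i)) = Fin.natAdd _ i :=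
  Fin.ext (Nat.add_assoc x y i).symm
@[simp] theorem assocE_symm_castAdd_castAdd (i : Fin x) :
    (assocE x y z).symm (Fin.castAdd _ (Fin.castAdd _ i)) = Fin.castAdd _ i := rfl
@[simp] theorem assocE_symm_castAdd_natAdd (i : Fin y) :
    (assocE x y z).symm (Fin.castAdd _ (Fin.natAdd _ i)) = Fin.natAdd _ (Fin.castAdd _ i) := rfl
@[simp] theorem assocE_symm_natAdd (i : Fin z) :
    (assocE x y z).symm (Fin.natAdd _ i) = Fin.natAdd _ (Fin.natAdd _ i) :=
  Fin.ext (Nat.add_assoc x y i)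

end

/-- Removal of an empty list of interfaces on the left. -/
def lunitE (x : ℕ) : Fin x ≃ Fin (0 + x) := finCongr (Nat.zero_add x).symm

@[simp] theorem lunitE_apply {x : ℕ} (i : Fin x) : lunitE x i = Fin.natAdd 0 i :=
  Fin.ext (Nat.zero_add _).symm
@[simp] theorem lunitE_symm {x : ℕ} (i : Fin x) : (lunitE x).symm (Fin.natAdd 0 i) = i :=
  Fin.ext (Nat.zero_add _)

/-- Removal of an empty list of interfaces on the right. -/
def runitE (x : ℕ) : Fin x ≃ Fin (x + 0) := Equiv.refl _

@[simp] theorem runitE_apply {x : ℕ} (i : Fin x) : runitE x i = Fin.castAdd 0 i := rfl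
@[simp] theorem runitE_symm {x : ℕ} (i : Fin x) : (runitE x).symm (Fin.castAdd 0 i) = i := rfl

/-- Swapping two lists of interfaces. -/
def swapE (x y : ℕ) : Fin (y + x) ≃ Fin (x + y) := finAddFlip

@[simp] theorem swapE_castAdd {x y : ℕ} (i : Fin y) :
    swapE x y (Fin.castAdd x i) = Fin.natAdd x i := finAddFlip_apply_castAdd ..
@[simp] theorem swapE_natAdd {x y : ℕ} (i : Fin x) :
    swapE x y (Fin.natAdd y i) = Fin.castAdd y i := finAddFlip_apply_natAdd ..
@[simp] theorem swapE_symm {x y : ℕ} : (swapE x y).symm = swapE y x := rfl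

/-- Doubling a list of interfaces. -/
def dbl (x : ℕ) : Fin (x + x) → Fin x := Fin.append id id

@[simp] theorem dbl_castAdd {x : ℕ} (i : Fin x) : dbl x (Fin.castAdd x i) = i :=
  Fin.append_left id id i
@[simp] theorem dbl_natAdd {x : ℕ} (i : Fin x) : dbl x (Fin.natAdd x i) = i :=
  Fin.append_right id id i

theorem assocE_label (X Y Z : FreeMarkov S) (i : Fin (X.n + (Y.n + Z.n))) :
    (tensor (tensor X Y) Z).label (assocE X.n Y.n Z.n i) = (tensor X (tensor Y Z)).label i := by
  refine Fin.addCases (fun i => ?_) (fun i => Fin.addCases (fun i => ?_) (fun i => ?_) i) i <;>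
    simp

theorem lunitE_label (X : FreeMarkov S) (i : Fin X.n) :
    (tensor (unit S) X).label (lunitE X.n i) = X.label i := by
  simp

theorem runitE_label (X : FreeMarkov S) (i : Fin X.n) :
    (tensor X (unit S)).label (runitE X.n i) = X.label i :=
  tensor_label_castAdd X (unit S) i

theorem swapE_label (X Y : FreeMarkov S) (i : Fin (Y.n + X.n)) :
    (tensor X Y).label (swapE X.n Y.n i) = (tensor Y X).label i := by
  refine Fin.addCases (fun i => ?_) (fun i => ?_) i <;> simp

theorem dbl_label (X : FreeMarkov S) (i : Fin (X.n + X.n)) :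
    X.label (dbl X.n i) = (tensor X X).label i := by
  refine Fin.addCases (fun i => ?_) (fun i => ?_) i <;> simp [-Fin.natAdd_eq_addNat]

instance : MonoidalCategoryStruct (FreeMarkov S) where
  tensorObj := tensor
  tensorUnit := unit S
  tensorHom := Hom.tensor
  whiskerLeft X _ _ f := Hom.tensor (𝟙 X) f
  whiskerRight f Y := Hom.tensor f (𝟙 Y)
  associator X Y Z := circIso (assocE X.n Y.n Z.n) (assocE_label X Y Z)
  leftUnitor X := circIso (lunitE X.n) (lunitE_label X)
  rightUnitor X := circIso (runitE X.n) (runitE_label X)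

theorem tensorHom_def' (f : X ⟶ Y) (g : X' ⟶ Y') : f ⊗ₘ g = Hom.tensor f g := rfl

theorem Hom.assoc_naturality (f : Hom X X') (g : Hom Y Y') (h : Hom Z Z') :
    (Hom.tensor (Hom.tensor f g) h).comp (Hom.circ _ (assocE_label X' Y' Z')) =
      (Hom.circ _ (assocE_label X Y Z)).comp (Hom.tensor f (Hom.tensor g h)) := by
  obtain ⟨α, hα, rfl⟩ := f.exists_mk
  obtain ⟨β, hβ, rfl⟩ := g.exists_mk
  obtain ⟨γ, hγ, rfl⟩ := h.exists_mk
  simp only [mk_tensor]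
  refine (mk_comp_circ ..).trans (Eq.trans ?_ (circ_comp_mk _ (assocE_label X Y Z) _ _).symm)
  refine Hom.mk_eq'
    { wire := Equiv.sumAssoc _ _ _
      box := Equiv.sumAssoc _ _ _
      wire_src := by rintro k l ((b | b) | b) i <;> rfl
      wire_tgt := by rintro k l ((b | b) | b) i <;> rfl
      lab_wire := by rintro ((w | w) | w) <;> rfl
      lab_box := by rintro k l ((b | b) | b) <;> rfl
      map_left := ?_
      map_right := ?_ } fun _ _ => (Equiv.sumAssoc _ _ _).bijective
  · refine Fin.addCases (Fin.addCases (fun i => ?_) (fun i => ?_)) (fun i => ?_) <;>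
      simp [Cospan.tensor, Cospan.pre, Cospan.post]
  · refine Fin.addCases (fun i => ?_) (Fin.addCases (fun i => ?_) (fun i => ?_)) <;>
      simp [Cospan.tensor, Cospan.pre, Cospan.post]

theorem Hom.leftUnitor_naturality (f : Hom X Y) :
    (Hom.tensor (𝟙 (unit S) : Hom (unit S) (unit S)) f).comp (Hom.circ _ (lunitE_label Y)) =
      (Hom.circ _ (lunitE_label X)).comp f := by
  obtain ⟨α, hα, rfl⟩ := f.exists_mk
  rw [id_def, circ_eq, mk_tensor]
  refine (mk_comp_circ ..).trans (Eq.trans ?_ (circ_comp_mk _ (lunitE_label X) _ _).symm)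
  refine Hom.mk_eq'
    { wire := Sum.elim Fin.elim0 id
      box := Equiv.emptySum _ _
      wire_src := by rintro k l (b | b) i; exacts [isEmptyElim b, rfl]
      wire_tgt := by rintro k l (b | b) i; exacts [isEmptyElim b, rfl]
      lab_wire := by rintro (w | w); exacts [w.elim0, rfl]
      lab_box := by rintro k l (b | b); exacts [isEmptyElim b, rfl]
      map_left := ?_
      map_right := ?_ } fun _ _ => (Equiv.emptySum _ _).bijective
  · refine Fin.addCases (fun i => i.elim0) (fun i => ?_)
    simp [Cospan.tensor, Cospan.pre, Cospan.post, -Fin.natAdd_zero, -Fin.castAdd_zero, circuit]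
  · intro i
    simp [Cospan.tensor, Cospan.pre, Cospan.post, -Fin.natAdd_zero, -Fin.castAdd_zero, circuit]

theorem Hom.rightUnitor_naturality (f : Hom X Y) :
    (Hom.tensor f (𝟙 (unit S) : Hom (unit S) (unit S))).comp
        (Hom.circ _ (runitE_label Y)) =
      (Hom.circ _ (runitE_label X)).comp f := by
  obtain ⟨α, hα, rfl⟩ := f.exists_mk
  rw [id_def, circ_eq, mk_tensor]
  refine (mk_comp_circ ..).trans (Eq.trans ?_
    (circ_comp_mk _ (runitE_label X) _ _).symm)
  refine Hom.mk_eq'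
    { wire := Sum.elim id Fin.elim0
      box := Equiv.sumEmpty _ _
      wire_src := by rintro k l (b | b) i; exacts [rfl, isEmptyElim b]
      wire_tgt := by rintro k l (b | b) i; exacts [rfl, isEmptyElim b]
      lab_wire := by rintro (w | w); exacts [rfl, w.elim0]
      lab_box := by rintro k l (b | b); exacts [rfl, isEmptyElim b]
      map_left := ?_
      map_right := ?_ } fun _ _ => (Equiv.sumEmpty _ _).bijective
  · refine Fin.addCases (fun i => ?_) (fun i => i.elim0)
    simp [Cospan.tensor, Cospan.pre, Cospan.post, -Fin.natAdd_zero, -Fin.castAdd_zero, circuit]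
  · intro i
    simp [Cospan.tensor, Cospan.pre, Cospan.post, -Fin.natAdd_zero, -Fin.castAdd_zero, circuit]

theorem Hom.braiding_naturality (f : Hom X X') (g : Hom Y Y') :
    (Hom.tensor f g).comp (Hom.circ _ (swapE_label X' Y')) =
      (Hom.circ _ (swapE_label X Y)).comp (Hom.tensor g f) := by
  obtain ⟨α, hα, rfl⟩ := f.exists_mk
  obtain ⟨β, hβ, rfl⟩ := g.exists_mk
  simp only [mk_tensor]
  refine (mk_comp_circ ..).trans (Eq.trans ?_ (circ_comp_mk _ (swapE_label X Y) _ _).symm)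
  refine Hom.mk_eq'
    { wire := Equiv.sumComm _ _
      box := Equiv.sumComm _ _
      wire_src := by rintro k l (b | b) i <;> rfl
      wire_tgt := by rintro k l (b | b) i <;> rfl
      lab_wire := by rintro (w | w) <;> rfl
      lab_box := by rintro k l (b | b) <;> rfl
      map_left := ?_
      map_right := ?_ } fun _ _ => (Equiv.sumComm _ _).bijective
  · refine Fin.addCases (fun i => ?_) (fun i => ?_) <;> simp [Cospan.tensor, Cospan.pre, Cospan.post]
  · refine Fin.addCases (fun i => ?_) (fun i => ?_) <;> simp [Cospan.tensor, Cospan.pre, Cospan.post]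

theorem tmap_id_id (x y : ℕ) (i : Fin (x + y)) : tmap (id : Fin x → Fin x) (id : Fin y → _) i = i :=
  Fin.addCases (fun i => by simp) (fun i => by simp) i

section
variable (w x y z : ℕ)

theorem pentagon_aux (i : Fin (w + (x + (y + z)))) :
    tmap (assocE w x y) (id : Fin z → _) (assocE w (x + y) z (tmap id (assocE x y z) i)) =
      assocE (w + x) y z (assocE w x (y + z) i) := by
  refine Fin.addCases (fun i => ?_) (Fin.addCases (fun i => ?_)
    (Fin.addCases (fun i => ?_) (fun i => ?_))) i <;>
  · simp
    try rfl

theorem triangle_aux (i : Fin (x + y)) :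
    assocE x 0 y (tmap id (lunitE y) i) = tmap (runitE x) id i := by
  refine Fin.addCases (fun i => ?_) (fun i => ?_) i
  · rw [tmap_castAdd, tmap_castAdd]
    rfl
  · simp [-Fin.natAdd_zero]
    exact assocE_natAdd_natAdd i

theorem hexagon_aux (i : Fin (y + (z + x))) :
    assocE x y z (swapE x (y + z) (assocE y z x i)) =
      tmap (swapE x y) id (assocE y x z (tmap id (swapE x z) i)) := by
  refine Fin.addCases (fun i => ?_) (Fin.addCases (fun i => ?_) (fun i => ?_)) i <;> simp

theorem hexagon_aux' (i : Fin (z + x + y)) :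
    (assocE x y z).symm (swapE (x + y) z ((assocE z x y).symm i)) =
      tmap id (swapE y z) ((assocE x z y).symm (tmap (swapE x z) id i)) := by
  refine Fin.addCases (Fin.addCases (fun i => ?_) (fun i => ?_)) (fun i => ?_) i <;> simp

theorem counit_aux (i : Fin (0 + x)) : dbl x (tmap Fin.elim0 id i) = (lunitE x).symm i := by
  refine Fin.addCases (fun i => i.elim0) (fun i => ?_) i
  rw [tmap_natAdd, lunitE_symm, dbl_natAdd, id]

theorem counit_aux' (i : Fin (x + 0)) : dbl x (tmap id Fin.elim0 i) = (runitE x).symm i := by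
  refine Fin.addCases (fun i => ?_) (fun i => i.elim0) i
  rw [tmap_castAdd, runitE_symm, dbl_castAdd, id]

theorem dbl_tensor_aux (i : Fin (x + y + (x + y))) :
    dbl (x + y) i = tmap (dbl x) (dbl y) (assocE x x (y + y) (tmap id (assocE x y y).symm
      (tmap id (tmap (swapE x y) id) (tmap id (assocE y x y) ((assocE x y (x + y)).symm i))))) := by
  refine Fin.addCases (Fin.addCases (fun i => ?_) (fun i => ?_))
    (Fin.addCases (fun i => ?_) (fun i => ?_)) i <;> simp [-Fin.natAdd_eq_addNat]

theorem coassoc_aux (i : Fin (x + (x + x))) :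
    dbl x (tmap id (dbl x) i) = dbl x (tmap (dbl x) id (assocE x x x i)) := by
  refine Fin.addCases (fun i => ?_) (Fin.addCases (fun i => ?_) (fun i => ?_)) i <;>
    simp [-Fin.natAdd_eq_addNat]

theorem cocomm_aux (i : Fin (x + x)) : dbl x (swapE x x i) = dbl x i := by
  refine Fin.addCases (fun i => ?_) (fun i => ?_) i <;> simp [-Fin.natAdd_eq_addNat]

end

instance : MonoidalCategory (FreeMarkov S) := MonoidalCategory.ofTensorHom
  (id_tensorHom_id := fun _ _ => (Hom.circ_tensor ..).trans (Hom.circ_congr fun _ => tmap_id_id ..))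
  (id_tensorHom := fun _ _ _ _ => rfl)
  (tensorHom_id := fun _ _ => rfl)
  (tensorHom_comp_tensorHom := Hom.tensor_comp)
  (associator_naturality := Hom.assoc_naturality)
  (leftUnitor_naturality := Hom.leftUnitor_naturality)
  (rightUnitor_naturality := Hom.rightUnitor_naturality)
  (pentagon := fun W X Y Z => by
    show (Hom.tensor (Hom.circ _ _) (Hom.circ _ _)).comp ((Hom.circ _ _).comp
      (Hom.tensor (Hom.circ _ _) (Hom.circ _ _))) = (Hom.circ _ _).comp (Hom.circ _ _)
    simp only [Hom.circ_tensor, Hom.circ_comp]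
    exact Hom.circ_congr fun i => pentagon_aux W.n X.n Y.n Z.n i)
  (triangle := fun X Y => by
    show (Hom.circ _ _).comp (Hom.tensor (Hom.circ _ _) (Hom.circ _ _)) =
      Hom.tensor (Hom.circ _ _) (Hom.circ _ _)
    simp only [Hom.circ_tensor, Hom.circ_comp]
    exact Hom.circ_congr fun i => triangle_aux X.n Y.n i)

instance : SymmetricCategory (FreeMarkov S) where
  braiding X Y := circIso (swapE X.n Y.n) (swapE_label X Y)
  braiding_naturality_right X _ _ f := Hom.braiding_naturality (𝟙 X) f
  braiding_naturality_left f Z := Hom.braiding_naturality f (𝟙 Z)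
  hexagon_forward X Y Z := by
    show (Hom.circ _ _).comp ((Hom.circ _ _).comp (Hom.circ _ _)) =
      (Hom.tensor (Hom.circ _ _) (Hom.circ _ _)).comp ((Hom.circ _ _).comp
      (Hom.tensor (Hom.circ _ _) (Hom.circ _ _)))
    simp only [Hom.circ_tensor, Hom.circ_comp]
    exact Hom.circ_congr fun i => hexagon_aux X.n Y.n Z.n i
  hexagon_reverse X Y Z := by
    show (Hom.circ _ _).comp ((Hom.circ _ _).comp (Hom.circ _ _)) =
      (Hom.tensor (Hom.circ _ _) (Hom.circ _ _)).comp ((Hom.circ _ _).comp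
      (Hom.tensor (Hom.circ _ _) (Hom.circ _ _)))
    simp only [Hom.circ_tensor, Hom.circ_comp]
    exact Hom.circ_congr fun i => hexagon_aux' X.n Y.n Z.n i
  symmetry X Y :=
    (Hom.circ_comp ..).trans (Hom.circ_congr fun i => (swapE X.n Y.n).apply_symm_apply i)

/-- Discarding every interface. -/
def Hom.del (X : FreeMarkov S) : Hom X (unit S) := Hom.circ Fin.elim0 fun i => i.elim0

/-- Copying every interface. -/
def Hom.copy (X : FreeMarkov S) : Hom X (FreeMarkov.tensor X X) :=
  Hom.circ (dbl X.n) (dbl_label X)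

instance (X : FreeMarkov S) : ComonObj X where
  counit := Hom.del X
  comul := Hom.copy X
  counit_comul := by
    show (Hom.circ _ _).comp (Hom.tensor (Hom.circ _ _) (Hom.circ _ _)) = Hom.circ _ _
    simp only [Hom.circ_tensor, Hom.circ_comp]
    exact Hom.circ_congr fun i => counit_aux X.n i
  comul_counit := by
    show (Hom.circ _ _).comp (Hom.tensor (Hom.circ _ _) (Hom.circ _ _)) = Hom.circ _ _
    simp only [Hom.circ_tensor, Hom.circ_comp]
    exact Hom.circ_congr fun i => counit_aux' X.n i
  comul_assoc := by
    show (Hom.circ _ _).comp (Hom.tensor (Hom.circ _ _) (Hom.circ _ _)) =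
      (Hom.circ _ _).comp ((Hom.tensor (Hom.circ _ _) (Hom.circ _ _)).comp (Hom.circ _ _))
    simp only [Hom.circ_tensor, Hom.circ_comp]
    exact Hom.circ_congr fun i => coassoc_aux X.n i

instance (X : FreeMarkov S) : IsCommComonObj X where
  comul_comm := (Hom.circ_comp ..).trans (Hom.circ_congr fun i => cocomm_aux X.n i)

theorem Hom.comp_del (f : Hom X Y) : f.comp (Hom.del Y) = Hom.del X := by
  obtain ⟨α, hα, rfl⟩ := f.exists_mk
  refine (mk_comp_circ ..).trans ?_
  have key : ∀ w, ∀ b : α.G.Box, (∃ i, α.G.src b.2.2 i = w) → (α.post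
      (Z := unit S) Fin.elim0 (fun i => i.elim0)).Removed b := by
    have : IsTrans α.G.W (Function.swap (Relation.TransGen α.G.Step)) :=
      ⟨fun _ _ _ h h' => h'.trans h⟩
    have : Std.Irrefl (Function.swap (Relation.TransGen α.G.Step)) := ⟨hα.acyclic⟩
    have wf := Finite.wellFounded_of_trans_of_irrefl (Function.swap (Relation.TransGen α.G.Step))
    intro w
    induction w using wf.induction with
    | h w ih =>
      rintro b ⟨i, rfl⟩
      refine .mk _ (fun j i => i.elim0) fun b' i' j e => ih (α.G.tgt b.2.2 j) ?_ b' ⟨i', e⟩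
      exact .single (Hypergraph.step_iff.2 ⟨b, ⟨i, rfl⟩, ⟨j, rfl⟩⟩)
  let φ : Map (circuit (X := X) (Y := unit S) Fin.elim0 (fun i => i.elim0))
      (α.post (Z := unit S) Fin.elim0 (fun i => i.elim0)) :=
    { wire := α.left
      box := fun b => b.elim
      wire_src := fun b => b.elim
      wire_tgt := fun b => b.elim
      lab_wire := α.lab_left
      lab_box := fun b => b.elim
      map_left := fun _ => rfl
      map_right := fun i => i.elim0 }
  refine (Hom.mk_eq (hβ := circuit_isStringDiagram _ _) φ
    (fun _ _ b => b.elim) fun b _ => ?_).symm.trans (circ_eq _ _).symm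
  exact .mk _ (fun j i => i.elim0) fun b' i' j e => key _ b' ⟨i', rfl⟩

instance : MarkovCategory (FreeMarkov S) where
  copy_tensor X Y := by
    show Hom.circ (X := tensor X Y) (Y := tensor (tensor X Y) (tensor X Y)) (dbl _) _ =
      (Hom.tensor (Hom.circ _ _) (Hom.circ _ _)).comp ((Hom.circ _ _).comp
      ((Hom.tensor (Hom.circ _ _) (Hom.circ _ _)).comp ((Hom.tensor (Hom.circ _ _)
      (Hom.tensor (Hom.circ _ _) (Hom.circ _ _))).comp
      ((Hom.tensor (Hom.circ _ _) (Hom.circ _ _)).comp (Hom.circ _ _)))))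
    simp only [Hom.circ_tensor, Hom.circ_comp]
    exact Hom.circ_congr fun i => dbl_tensor_aux X.n Y.n i
  discard_tensor X Y := by
    show Hom.circ (X := tensor X Y) (Y := unit S) _ _ =
      (Hom.tensor (Hom.circ _ _) (Hom.circ _ _)).comp (Hom.circ _ _)
    simp only [Hom.circ_tensor, Hom.circ_comp]
    exact Hom.circ_congr fun i => i.elim0
  copy_unit := Hom.circ_congr (X := unit S) (Y := tensor (unit S) (unit S)) fun i => i.elim0
  discard_unit := Hom.circ_congr (X := unit S) (Y := unit S) fun i => i.elim0
  discard_natural f := Hom.comp_del f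

/-! ### Generators -/

/-- The object given by a single wire. -/
def wireObj (w : S.W) : FreeMarkov S := ⟨1, fun _ => w⟩

/-- The word over the set of wires of `S` that corresponds to an object. -/
def word (X : FreeMarkov S) : FreeMonoid S.W := FreeMonoid.ofList (List.ofFn X.label)

/-- The object given by the inputs of a box. -/
def dom {k l : ℕ} (b : S.B k l) : FreeMarkov S := ⟨k, S.src b⟩

/-- The object given by the outputs of a box. -/
def cod {k l : ℕ} (b : S.B k l) : FreeMarkov S := ⟨l, S.tgt b⟩

/-- The type that has exactly one element if `(k', l') = (k, l)`, and no element otherwise. -/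
inductive SingleBox (k l : ℕ) : ℕ → ℕ → Type
  | box : SingleBox k l k l

/-- The string diagram of a single box `b` whose input and output wires are all distinct. -/
def single {k l : ℕ} (b : S.B k l) : Cospan (dom b) (cod b) where
  G :=
    { W := Fin k ⊕ Fin l
      B := SingleBox k l
      src := fun c => match c with | .box => Sum.inl
      tgt := fun c => match c with | .box => Sum.inr }
  finite_wires := inferInstance
  finite_boxes := Finite.of_surjective (α := Unit) (fun _ => ⟨k, l, .box⟩) <| by
    rintro ⟨_, _, ⟨⟩⟩
    exact ⟨(), rfl⟩
  lab :=
    { wire := Sum.elim (S.src b) (S.tgt b)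
      box := fun c => match c with | .box => b
      wire_src := by rintro _ _ ⟨⟩ i; rfl
      wire_tgt := by rintro _ _ ⟨⟩ i; rfl }
  left := Sum.inl
  right := Sum.inr
  lab_left _ := rfl
  lab_right _ := rfl

theorem single_isStringDiagram {k l : ℕ} (b : S.B k l) : (single b).IsStringDiagram := by
  have hstep : ∀ w w', (single b).G.Step w w' → ∃ i j, w = Sum.inl i ∧ w' = Sum.inr j := by
    intro w w' h
    obtain ⟨⟨_, _, ⟨⟩⟩, ⟨i, rfl⟩, ⟨j, rfl⟩⟩ := Hypergraph.step_iff.1 h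
    exact ⟨i, j, rfl, rfl⟩
  refine ⟨fun w hw => ?_, leftMonogamous_iff.2 ⟨?_, ?_⟩⟩
  · obtain ⟨w', h, -⟩ := Relation.TransGen.head'_iff.1 hw
    obtain ⟨w'', -, h'⟩ := Relation.TransGen.tail'_iff.1 hw
    obtain ⟨i, -, rfl, -⟩ := hstep _ _ h
    obtain ⟨-, j, -, h''⟩ := hstep _ _ h'
    cases h''
  · rintro (i | ⟨⟨_, _, ⟨⟩⟩, j⟩) (i' | ⟨⟨_, _, ⟨⟩⟩, j'⟩) e
    · exact congrArg Sum.inl (Sum.inl.inj e)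
    · cases e
    · cases e
    · cases e
      rfl
  · rintro (i | j)
    · exact ⟨Sum.inl i, rfl⟩
    · exact ⟨Sum.inr ⟨⟨k, l, .box⟩, j⟩, rfl⟩

/-- The morphism represented by the normalization of the string diagram of a single box. -/
def gen {k l : ℕ} (b : S.B k l) : dom b ⟶ cod b := Hom.mk (single b) (single_isStringDiagram b)

theorem mk_eq_mk {m n : ℕ} (h : m = n) {f : Fin m → S.W} {g : Fin n → S.W}
    (hfg : ∀ i, f i = g (Fin.cast h i)) : (⟨m, f⟩ : FreeMarkov S) = ⟨n, g⟩ := by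
  subst h
  obtain rfl : f = g := funext hfg
  rfl

end FreeMarkov

/-! ### Strict gs-monoidal categories and functors -/

/-- A monoidal category is strict if its associators and unitors are identities. -/
class IsStrictMonoidal (C : Type u) [Category.{v} C] [MonoidalCategory C] : Prop where
  tensor_assoc : ∀ X Y Z : C, (X ⊗ Y) ⊗ Z = X ⊗ (Y ⊗ Z)
  unit_tensor : ∀ X : C, 𝟙_ C ⊗ X = X
  tensor_unit : ∀ X : C, X ⊗ 𝟙_ C = X
  associator_hom : ∀ X Y Z : C, (α_ X Y Z).hom = eqToHom (tensor_assoc X Y Z)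
  leftUnitor_hom : ∀ X : C, (λ_ X).hom = eqToHom (unit_tensor X)
  rightUnitor_hom : ∀ X : C, (ρ_ X).hom = eqToHom (tensor_unit X)

theorem FreeMarkov.eqToHom_eq {X Y : FreeMarkov S} (h : X = Y) (e : Fin Y.n → Fin X.n)
    (he : ∀ i, X.label (e i) = Y.label i) (hv : ∀ i, (e i : ℕ) = i) :
    Hom.circ e he = eqToHom h := by
  subst h
  exact Hom.circ_congr fun i => Fin.ext (hv i)

instance : IsStrictMonoidal (FreeMarkov S) where
  tensor_assoc X Y Z := (FreeMarkov.mk_eq_mk (Nat.add_assoc X.n Y.n Z.n).symm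
    fun i => (FreeMarkov.assocE_label X Y Z i).symm).symm
  unit_tensor X := (FreeMarkov.mk_eq_mk (Nat.zero_add X.n).symm
    fun i => (FreeMarkov.lunitE_label X i).symm).symm
  tensor_unit X := (FreeMarkov.mk_eq_mk (Nat.add_zero X.n).symm
    fun i => (FreeMarkov.runitE_label X i).symm).symm
  associator_hom _ _ _ := FreeMarkov.eqToHom_eq _ _ _ fun _ => rfl
  leftUnitor_hom _ := FreeMarkov.eqToHom_eq _ _ _ fun _ => rfl
  rightUnitor_hom _ := FreeMarkov.eqToHom_eq _ _ _ fun _ => rfl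

section

variable (C : Type u₁) [Category.{v₁} C] [MonoidalCategory C] [CopyDiscardCategory C]
variable (D : Type u₂) [Category.{v₂} D] [MonoidalCategory D] [CopyDiscardCategory D]

open scoped ComonObj

/-- A strict gs-monoidal functor between (strict) gs-monoidal categories: a functor that preserves
the tensor product and the unit, the symmetry, and the copy and discard morphisms on the nose. -/
structure StrictGSFunctor extends C ⥤ D where
  obj_unit : obj (𝟙_ C) = 𝟙_ D
  obj_tensor : ∀ X Y : C, obj (X ⊗ Y) = obj X ⊗ obj Y
  map_tensor : ∀ {X Y X' Y' : C} (f : X ⟶ Y) (g : X' ⟶ Y'),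
    map (f ⊗ₘ g) =
      eqToHom (obj_tensor X X') ≫ (map f ⊗ₘ map g) ≫ eqToHom (obj_tensor Y Y').symm
  map_braiding : ∀ X Y : C,
    map (β_ X Y).hom =
      eqToHom (obj_tensor X Y) ≫ (β_ (obj X) (obj Y)).hom ≫ eqToHom (obj_tensor Y X).symm
  map_copy : ∀ X : C, map Δ[X] = Δ[obj X] ≫ eqToHom (obj_tensor X X).symm
  map_del : ∀ X : C, map ε[X] = ε[obj X] ≫ eqToHom obj_unit.symm

variable {C}

/-- The tensor product `A₁ ⊗ (A₂ ⊗ ⋯ (Aₖ ⊗ I))`. In a strict monoidal category, the bracketing and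
the final unit do not matter. -/
def tensorPow : {k : ℕ} → (Fin k → C) → C
  | 0, _ => 𝟙_ C
  | _ + 1, A => A 0 ⊗ tensorPow fun i => A i.succ

variable (C)

/-- The underlying hypergraph of a monoidal category: wires are objects, and boxes of arity
`(k, l)` are morphisms from a `k`-fold to an `l`-fold tensor product of objects. -/
def hyp : Hypergraph.{u₁, max u₁ v₁} where
  W := C
  B k l := (A : Fin k → C) × (A' : Fin l → C) × (tensorPow A ⟶ tensorPow A')
  src b := b.1
  tgt b := b.2.1

variable {C D}

theorem StrictGSFunctor.obj_tensorPow (F : StrictGSFunctor C D) :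
    ∀ {k : ℕ} (A : Fin k → C), F.obj (tensorPow A) = tensorPow fun i => F.obj (A i)
  | 0, _ => F.obj_unit
  | _ + 1, A => (F.obj_tensor _ _).trans (congrArg _ (F.obj_tensorPow fun i => A i.succ))

/-- The action of a strict gs-monoidal functor on underlying hypergraphs. -/
def hypMap (F : StrictGSFunctor C D) : Hypergraph.Hom (hyp C) (hyp D) where
  wire := F.obj
  box b := ⟨fun i => F.obj (b.1 i), fun j => F.obj (b.2.1 j),
    eqToHom (F.obj_tensorPow b.1).symm ≫ F.map b.2.2 ≫ eqToHom (F.obj_tensorPow b.2.1)⟩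
  wire_src _ _ := rfl
  wire_tgt _ _ := rfl

/-- The monoid of objects of a strict monoidal category `D` is the free monoid generated by `W`:
an isomorphism of monoids from the free monoid on `W` to the objects of `D` under `⊗`. -/
structure FreeOnObjects (W : Type u) (D : Type u₂) [Category.{v₂} D] [MonoidalCategory D] where
  equiv : FreeMonoid W ≃ D
  map_one : equiv 1 = 𝟙_ D
  map_mul : ∀ a b, equiv (a * b) = equiv a ⊗ equiv b

end

theorem FreeMarkov.tensorPow_wireObj :
    ∀ {k : ℕ} (w : Fin k → S.W), tensorPow (fun i => wireObj (w i)) = (⟨k, w⟩ : FreeMarkov S)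
  | 0, w => mk_eq_mk rfl fun i => i.elim0
  | k + 1, w => by
    rw [tensorPow, tensorPow_wireObj fun i => w i.succ]
    refine mk_eq_mk (m := 1 + k) (Nat.add_comm 1 k) (Fin.addCases (fun i => ?_) (fun i => ?_))
    · refine (Fin.append_left ..).trans (congrArg w (Fin.ext ?_))
      simp
    · refine (Fin.append_right ..).trans (congrArg w (Fin.ext ?_))
      simp

/-- The canonical hypergraph morphism from the signature to the underlying hypergraph of the free
Markov category: it sends a wire to itself and a box to its normalized string diagram. -/
def FreeMarkov.incl (S : Hypergraph.{u, v}) : Hypergraph.Hom S (hyp (FreeMarkov S)) where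
  wire := wireObj
  box b := ⟨fun i => wireObj (S.src b i), fun j => wireObj (S.tgt b j),
    eqToHom (tensorPow_wireObj _) ≫ gen b ≫ eqToHom (tensorPow_wireObj _).symm⟩
  wire_src _ _ := rfl
  wire_tgt _ _ := rfl

/-- Restriction of a strict gs-monoidal functor along the canonical hypergraph morphism. -/
def FreeMarkov.restrict {D : Type u₂} [Category.{v₂} D] [MonoidalCategory D]
    [CopyDiscardCategory D] (F : StrictGSFunctor (FreeMarkov S) D) : Hypergraph.Hom S (hyp D) :=
  (incl S).comp (hypMap F)

end GSMon

/-! A hypergraph morphism `f : Σ → hyp(C)` assigns objects of `C` to wires and morphisms of `C` to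
boxes. Surjectivity requires a value in `C` for every string diagram. Slicing a diagram into layers
would give one, but its independence of the slicing would have to be proved. Here the value is
characterized without slicing, in the way a Bayesian network determines a joint distribution.

A state of a diagram (`Cospan.IsState`) assigns to every finite tuple `c` of wires, with repetitions
and omissions allowed, a joint morphism `J c` from a fixed object `Z` to the tensor product of the
objects that interpret the wires of `c`. Two conditions are imposed. `Natural`: copying, permuting
and discarding wires of a tuple corresponds to copying, permuting and discarding in `C`.
`Cospan.MarkovAt`: if no wire of `c` can be reached from the outputs of a box `b`, then the joint
morphism of `c` and the outputs of `b` arises from that of `c` and the inputs of `b` by applying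
`b`. A state is determined by its value on the left interface (`IsState.ext`), and every value there
is attained (`exists_state`). The diagram is interpreted by the value on the right interface of the
state that starts with the identity.

States refer only to boxes and reachability, so they pull back along suitable hypergraph morphisms
(`IsState.pullback`). Together with uniqueness this gives invariance under isomorphism and
normalization (`eval_map`) and compatibility with composition (`eval_comp`). For tensor products
(`eval_tensor`), each factor is traversed while an interface of the other is carried along as a
spectator (`IsState.ext_spectator`).

The structural computations rest on deterministic morphisms, those that commute with copying.
Projections and all morphisms `circ` that copy, permute and discard factors are deterministic, and
deterministic morphisms into a tensor product are determined by their components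
(`det_tensorPow_ext`), as in a cartesian category. Up to this point `C` need not be strict.
Strictness turns the comparison between the interpretation of a concatenation and the tensor product
of the interpretations into an equality (`exists_join_eq_eqToHom`), so that the functor `lift f` is
strict; it restricts to `f` by `restrict_lift`.

Injectivity holds because the free category is generated, under composition and tensor product, by
copying, discarding, equalities of objects and single boxes (`hom_induction`). The statement about
identity-on-objects functors follows because every object is a tensor product of single wires
(`obj_eq_iff`). -/

namespace GSMon

/-! ### Deterministic morphisms in Markov categories -/

section Deterministic

open scoped ComonObj
open CopyDiscardCategory

variable {C : Type u₁} [Category.{v₁} C] [MonoidalCategory C] [MarkovCategory C]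

/-- A morphism is deterministic if it commutes with copying. -/
class Det {X Y : C} (f : X ⟶ Y) : Prop where
  copy : f ≫ Δ[Y] = Δ[X] ≫ (f ⊗ₘ f)

/-- Copying, followed by the application of a morphism to each copy. -/
def pair {Z X Y : C} (f : Z ⟶ X) (g : Z ⟶ Y) : Z ⟶ X ⊗ Y := Δ[Z] ≫ (f ⊗ₘ g)

/-- The first projection, i.e. discarding the second factor. -/
def pfst (X Y : C) : X ⊗ Y ⟶ X := X ◁ ε[Y] ≫ (ρ_ X).hom

/-- The second projection, i.e. discarding the first factor. -/
def psnd (X Y : C) : X ⊗ Y ⟶ Y := ε[X] ▷ Y ≫ (λ_ Y).hom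

variable {Z Z' X Y X' Y' : C}

@[simp]
theorem pair_tensor (f : Z ⟶ X) (g : Z ⟶ Y) (f' : X ⟶ X') (g' : Y ⟶ Y') :
    pair f g ≫ (f' ⊗ₘ g') = pair (f ≫ f') (g ≫ g') := by
  simp [pair]

@[simp]
theorem pair_whiskerLeft (f : Z ⟶ X) (g : Z ⟶ Y) (g' : Y ⟶ Y') :
    pair f g ≫ X ◁ g' = pair f (g ≫ g') := by
  rw [← id_tensorHom, pair_tensor, Category.comp_id]

@[simp]
theorem pair_whiskerLeft_assoc (f : Z ⟶ X) (g : Z ⟶ Y) (g' : Y ⟶ Y') {T : C} (t : X ⊗ Y' ⟶ T) :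
    pair f g ≫ X ◁ g' ≫ t = pair f (g ≫ g') ≫ t := by
  rw [← Category.assoc, pair_whiskerLeft]

@[simp]
theorem pair_whiskerRight (f : Z ⟶ X) (g : Z ⟶ Y) (f' : X ⟶ X') :
    pair f g ≫ f' ▷ Y = pair (f ≫ f') g := by
  rw [← tensorHom_id, pair_tensor, Category.comp_id]

@[simp]
theorem pair_whiskerRight_assoc (f : Z ⟶ X) (g : Z ⟶ Y) (f' : X ⟶ X') {T : C} (t : X' ⊗ Y ⟶ T) :
    pair f g ≫ f' ▷ Y ≫ t = pair (f ≫ f') g ≫ t := by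
  rw [← Category.assoc, pair_whiskerRight]

/-- This is where determinism matters: precomposition with `h` distributes over a pairing because
`h` commutes with copying. -/
theorem comp_pair (h : Z' ⟶ Z) [Det h] (f : Z ⟶ X) (g : Z ⟶ Y) :
    h ≫ pair f g = pair (h ≫ f) (h ≫ g) := by
  rw [pair, ← Category.assoc, Det.copy, pair]
  simp

-- Naturality of discarding deletes `g`, and the counit law does the rest. Neither `f` nor `g` has
-- to be deterministic.
@[simp]
theorem pair_fst (f : Z ⟶ X) (g : Z ⟶ Y) : pair f g ≫ pfst X Y = f := by
  rw [pfst, pair_whiskerLeft_assoc, MarkovCategory.discard_natural, pair,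
    Category.assoc, ComonObj.comul_counit_hom_assoc]
  simp

@[simp]
theorem pair_fst_assoc (f : Z ⟶ X) (g : Z ⟶ Y) {T : C} (t : X ⟶ T) :
    pair f g ≫ pfst X Y ≫ t = f ≫ t := by
  rw [← Category.assoc, pair_fst]

@[simp]
theorem pair_snd (f : Z ⟶ X) (g : Z ⟶ Y) : pair f g ≫ psnd X Y = g := by
  rw [psnd, pair_whiskerRight_assoc, MarkovCategory.discard_natural, pair,
    Category.assoc, ComonObj.counit_comul_hom_assoc]
  simp

@[simp]
theorem pair_snd_assoc (f : Z ⟶ X) (g : Z ⟶ Y) {T : C} (t : Y ⟶ T) :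
    pair f g ≫ psnd X Y ≫ t = g ≫ t := by
  rw [← Category.assoc, pair_snd]

theorem tensor_fst (f : X ⟶ X') (g : Y ⟶ Y') : (f ⊗ₘ g) ≫ pfst X' Y' = pfst X Y ≫ f := by
  rw [pfst, pfst, MonoidalCategory.tensorHom_def, Category.assoc, ← whiskerLeft_comp_assoc,
    MarkovCategory.discard_natural, ← whisker_exchange_assoc]
  simp

theorem tensor_snd (f : X ⟶ X') (g : Y ⟶ Y') : (f ⊗ₘ g) ≫ psnd X' Y' = psnd X Y ≫ g := by
  rw [psnd, psnd, MonoidalCategory.tensorHom_def', Category.assoc, ← comp_whiskerRight_assoc,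
    MarkovCategory.discard_natural, whisker_exchange_assoc]
  simp

/-- The only braiding inside this `tensorμ` is that of the unit with itself, which is the identity;
what remains is coherence. -/
theorem tensorμ_units (X Y : C) :
    ((ρ_ X).inv ⊗ₘ (λ_ Y).inv) ≫ tensorμ X (𝟙_ C) (𝟙_ C) Y ≫ ((ρ_ X).hom ⊗ₘ (λ_ Y).hom) =
      𝟙 (X ⊗ Y) := by
  have h : (β_ (𝟙_ C) (𝟙_ C)).hom = 𝟙 _ := by
    simp [unitors_inv_equal]
  rw [tensorμ, h]
  monoidal

/-- Copying `X ⊗ Y` copies both factors and exchanges the middle two of the four results. The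
projections discard exactly these two, so the counit laws apply on each side. -/
theorem pair_fst_snd : pair (pfst X Y) (psnd X Y) = 𝟙 (X ⊗ Y) := by
  have h : ((𝟙 X ⊗ₘ ε[X]) ⊗ₘ (ε[Y] ⊗ₘ 𝟙 Y)) ≫ ((ρ_ X).hom ⊗ₘ (λ_ Y).hom) =
      (X ◁ ε[X] ≫ (ρ_ X).hom) ⊗ₘ (ε[Y] ▷ Y ≫ (λ_ Y).hom) := by
    simp
  have h' : (pfst X Y ⊗ₘ psnd X Y) = ((𝟙 X ⊗ₘ ε[Y]) ⊗ₘ (ε[X] ⊗ₘ 𝟙 Y)) ≫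
      ((ρ_ X).hom ⊗ₘ (λ_ Y).hom) := by
    simp [pfst, psnd]
  rw [pair, copy_tensor, h', Category.assoc, ← tensorμ_natural_assoc,
    tensorHom_comp_tensorHom_assoc, id_tensorHom, tensorHom_id, ComonObj.counit_comul,
    ComonObj.comul_counit, tensorμ_units]

instance : Det (𝟙 X) := ⟨by simp⟩

instance det_comp (f : X ⟶ Y) (g : Y ⟶ Z) [Det f] [Det g] : Det (f ≫ g) :=
  ⟨by rw [Category.assoc, Det.copy, ← Category.assoc, Det.copy]; simp⟩

/-- Both sides end in `𝟙_ C ⊗ 𝟙_ C`, which is isomorphic to the terminal object `𝟙_ C`. -/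
instance (f : X ⟶ 𝟙_ C) : Det f := ⟨by
  have : Mono (λ_ (𝟙_ C)).hom := inferInstance
  exact (cancel_mono (λ_ (𝟙_ C)).hom).1 (Subsingleton.elim _ _)⟩

instance det_eqToHom (h : X = Y) : Det (eqToHom h) := by
  subst h
  exact inferInstanceAs (Det (𝟙 X))

theorem det_inv (f : X ⟶ Y) [IsIso f] [Det f] : Det (inv f) :=
  ⟨by rw [IsIso.inv_comp_eq, ← Category.assoc, Det.copy]; simp⟩

/-- By coassociativity both sides are fourfold copies; the exchange of the two middle copies in
`copy_tensor` is absorbed by cocommutativity. -/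
instance det_copy : Det (Δ[X]) := ⟨by
  have h : Δ[X] ≫ (Δ[X] ⊗ₘ Δ[X]) ≫ (α_ X X (X ⊗ X)).hom ≫ X ◁ (α_ X X X).inv =
      Δ[X] ≫ X ◁ (Δ[X] ≫ Δ[X] ▷ X) := by
    rw [MonoidalCategory.tensorHom_def, Category.assoc, associator_naturality_right_assoc,
      ComonObj.comul_assoc_flip, ← ComonObj.comul_assoc_assoc]
    simp only [MonoidalCategory.whiskerLeft_comp]
  have h' : Δ[X] ≫ Δ[X] ▷ X ≫ (β_ X X).hom ▷ X = Δ[X] ≫ Δ[X] ▷ X := by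
    rw [← comp_whiskerRight, IsCommComonObj.comul_comm]
  rw [copy_tensor, tensorμ, reassoc_of% h, ← whiskerLeft_comp_assoc, Category.assoc, h',
    ← reassoc_of% h]
  simp⟩

instance det_tensor (f : X ⟶ X') (g : Y ⟶ Y') [Det f] [Det g] : Det (f ⊗ₘ g) := ⟨by
  rw [copy_tensor, copy_tensor, tensorHom_comp_tensorHom_assoc, Det.copy, Det.copy,
    ← tensorHom_comp_tensorHom_assoc, tensorμ_natural, Category.assoc]⟩

instance det_pair (f : Z ⟶ X) (g : Z ⟶ Y) [Det f] [Det g] : Det (pair f g) :=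
  inferInstanceAs (Det (_ ≫ _))

/-- The inverse is a pairing of deterministic morphisms, and the inverse of a deterministic
isomorphism is deterministic. -/
theorem det_rightUnitor : Det (ρ_ X).hom := by
  have h : (ρ_ X).inv = pair (𝟙 X) ε[X] := by simp [pair]
  have : Det (ρ_ X).inv := by rw [h]; infer_instance
  simpa using det_inv (ρ_ X).inv

theorem det_leftUnitor : Det (λ_ X).hom := by
  have h : (λ_ X).inv = pair ε[X] (𝟙 X) := by simp [pair]
  have : Det (λ_ X).inv := by rw [h]; infer_instance
  simpa using det_inv (λ_ X).inv

instance det_fst : Det (pfst X Y) := by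
  have := det_rightUnitor (X := X)
  rw [pfst, ← id_tensorHom]
  infer_instance

instance det_snd : Det (psnd X Y) := by
  have := det_leftUnitor (X := Y)
  rw [psnd, ← tensorHom_id]
  infer_instance

/-- The explicit hypothesis serves the case in which the target becomes a binary tensor product only
after unfolding `tensorPow`. -/
theorem det_comp_snd {f : Z ⟶ X ⊗ Y} (_ : Det f) : Det (f ≫ psnd X Y) := inferInstance

/-- This is the uniqueness half of the universal property of a product: a deterministic morphism is
the pairing of its two components. -/
theorem det_hom_ext {f g : Z ⟶ X ⊗ Y} [Det f] [Det g] (h₁ : f ≫ pfst X Y = g ≫ pfst X Y)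
    (h₂ : f ≫ psnd X Y = g ≫ psnd X Y) : f = g := by
  rw [← Category.comp_id f, ← Category.comp_id g, ← pair_fst_snd, comp_pair, comp_pair, h₁, h₂]

/-- Cocommutativity suffices here, and coassociativity in `pair_associator`; the components may be
arbitrary morphisms. -/
theorem pair_braiding (f : Z ⟶ X) (g : Z ⟶ Y) : pair f g ≫ (β_ X Y).hom = pair g f := by
  rw [pair, Category.assoc, BraidedCategory.braiding_naturality, IsCommComonObj.comul_comm_assoc,
    pair]

theorem pair_associator (f : Z ⟶ X) (g : Z ⟶ Y) (h : Z ⟶ X') :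
    pair (pair f g) h ≫ (α_ X Y X').hom = pair f (pair g h) := by
  have h₁ : pair (pair f g) h = Δ[Z] ≫ Δ[Z] ▷ Z ≫ ((f ⊗ₘ g) ⊗ₘ h) := by
    simp [pair, MonoidalCategory.tensorHom_def]
  have h₂ : pair f (pair g h) = Δ[Z] ≫ Z ◁ Δ[Z] ≫ (f ⊗ₘ (g ⊗ₘ h)) := by
    simp [pair, MonoidalCategory.tensorHom_def']
  rw [h₁, h₂, Category.assoc, Category.assoc, associator_naturality, ComonObj.comul_assoc_assoc]

theorem pair_associator_assoc (f : Z ⟶ X) (g : Z ⟶ Y) (h : Z ⟶ X') {T : C}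
    (t : X ⊗ Y ⊗ X' ⟶ T) :
    pair (pair f g) h ≫ (α_ X Y X').hom ≫ t = pair f (pair g h) ≫ t := by
  rw [← Category.assoc, pair_associator]

/-- Exchange of the second and the third factor of a threefold tensor product. -/
def swapRight (X Y Z : C) : (X ⊗ Y) ⊗ Z ⟶ (X ⊗ Z) ⊗ Y :=
  (α_ X Y Z).hom ≫ X ◁ (β_ Y Z).hom ≫ (α_ X Z Y).inv

theorem pair_swapRight (f : Z ⟶ X) (g : Z ⟶ Y) (h : Z ⟶ X') :
    pair (pair f g) h ≫ swapRight X Y X' = pair (pair f h) g := by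
  rw [swapRight, pair_associator_assoc, pair_whiskerLeft_assoc, pair_braiding, ← pair_associator]
  simp

theorem whiskerLeft_swapRight (f : Z ⟶ Z') :
    (X ⊗ Y) ◁ f ≫ swapRight X Y Z' = swapRight X Y Z ≫ (X ◁ f) ▷ Y := by
  have : Y ◁ f ≫ (β_ Y Z').hom = (β_ Y Z).hom ≫ f ▷ Y := by simp
  have h := congrArg (fun f => X ◁ f) this
  simp only [MonoidalCategory.whiskerLeft_comp] at h
  simp [swapRight, reassoc_of% h]

theorem whiskerRight_swapRight (f : Y ⟶ Y') :
    (X ◁ f) ▷ Z ≫ swapRight X Y' Z = swapRight X Y Z ≫ (X ⊗ Z) ◁ f := by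
  have : f ▷ Z ≫ (β_ Y' Z).hom = (β_ Y Z).hom ≫ Z ◁ f := by simp
  have h := congrArg (fun f => X ◁ f) this
  simp only [MonoidalCategory.whiskerLeft_comp] at h
  simp [swapRight, reassoc_of% h]

theorem whiskerRight_swapRight_assoc (f : Y ⟶ Y') {T : C} (t : (X ⊗ Z) ⊗ Y' ⟶ T) :
    (X ◁ f) ▷ Z ≫ swapRight X Y' Z ≫ t = swapRight X Y Z ≫ (X ⊗ Z) ◁ f ≫ t := by
  rw [← Category.assoc, whiskerRight_swapRight, Category.assoc]

@[simp]
theorem swapRight_swapRight : swapRight X Y Z ≫ swapRight X Z Y = 𝟙 _ := by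
  simp only [swapRight, Category.assoc, Iso.inv_hom_id_assoc, ← whiskerLeft_comp_assoc,
    SymmetricCategory.symmetry]
  simp

@[simp]
theorem swapRight_swapRight_assoc {T : C} (t : (X ⊗ Y) ⊗ Z ⟶ T) :
    swapRight X Y Z ≫ swapRight X Z Y ≫ t = t := by
  rw [← Category.assoc, swapRight_swapRight, Category.id_comp]

/-! ### Tuples of deterministic morphisms -/

/-- The projection from an iterated tensor product to one of its factors. -/
def proj : {k : ℕ} → (A : Fin k → C) → (i : Fin k) → (tensorPow A ⟶ A i)
  | 0, _, i => i.elim0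
  | _ + 1, A, i => Fin.cases (motive := fun i => tensorPow A ⟶ A i) (pfst (A 0) _)
      (fun i => psnd (A 0) _ ≫ proj (fun i => A i.succ) i) i

/-- The morphism to an iterated tensor product with given components. -/
def tuple : {k : ℕ} → {A : Fin k → C} → (∀ i, Z ⟶ A i) → (Z ⟶ tensorPow A)
  | 0, _, _ => ε[Z]
  | _ + 1, _, f => pair (f 0) (tuple fun i => f i.succ)

variable {k l m : ℕ} {A : Fin k → C} {A' : Fin l → C} {A'' : Fin m → C}

instance det_proj : ∀ {k : ℕ} (A : Fin k → C) (i : Fin k), Det (proj A i)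
  | 0, _, i => i.elim0
  | k + 1, A, i => by
    have := det_proj (fun i : Fin k => A i.succ)
    refine Fin.cases (motive := fun i => Det (proj A i)) ?_ (fun i => ?_) i
    · exact det_fst
    · exact det_comp (psnd (A 0) _) (proj (fun i => A i.succ) i)

instance det_tuple : ∀ {k : ℕ} {A : Fin k → C} (f : ∀ i, Z ⟶ A i) [∀ i, Det (f i)], Det (tuple f)
  | 0, A, f, _ => inferInstanceAs (Det (Y := 𝟙_ C) ε[Z])
  | k + 1, A, f, _ => by
    have := det_tuple fun i : Fin k => f i.succ
    exact det_pair (f 0) _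

@[simp]
theorem tuple_proj : ∀ {k : ℕ} {A : Fin k → C} (f : ∀ i, Z ⟶ A i) (i : Fin k),
    tuple f ≫ proj A i = f i
  | 0, _, _, i => i.elim0
  | k + 1, A, f, i => by
    refine Fin.cases (motive := fun i => tuple f ≫ proj A i = f i) ?_ (fun i => ?_) i
    · exact pair_fst ..
    · exact (pair_snd_assoc _ _ _).trans (tuple_proj (fun i => f i.succ) i)

/-- Iterates `det_hom_ext`, starting from the terminal object for the empty product. It reduces
equations between structural morphisms to identities of index functions. -/
theorem det_tensorPow_ext : ∀ {k : ℕ} {A : Fin k → C} {f g : Z ⟶ tensorPow A} [Det f] [Det g],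
    (∀ i, f ≫ proj A i = g ≫ proj A i) → f = g
  | 0, _, f, g, _, _, _ => Subsingleton.elim (α := Z ⟶ 𝟙_ C) f g
  | k + 1, A, f, g, hf, hg, h => by
    refine @det_hom_ext C _ _ _ Z (A 0) (tensorPow fun i => A i.succ) f g hf hg (h 0) ?_
    have := det_comp_snd (X := A 0) (Y := tensorPow fun i => A i.succ) hf
    have := det_comp_snd (X := A 0) (Y := tensorPow fun i => A i.succ) hg
    refine det_tensorPow_ext fun i => ?_
    exact (Category.assoc ..).trans ((h i.succ).trans (Category.assoc ..).symm)

/-- The morphism between iterated tensor products that copies, permutes and discards factors. -/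
def circ (g : Fin l → Fin k) (h : ∀ i, A (g i) = A' i) : tensorPow A ⟶ tensorPow A' :=
  tuple fun i => proj A (g i) ≫ eqToHom (h i)

instance det_circ (g : Fin l → Fin k) (h : ∀ i, A (g i) = A' i) : Det (circ g h) :=
  inferInstanceAs (Det (tuple _))

@[simp]
theorem circ_proj (g : Fin l → Fin k) (h : ∀ i, A (g i) = A' i) (i : Fin l) :
    circ g h ≫ proj A' i = proj A (g i) ≫ eqToHom (h i) := tuple_proj _ i

@[simp]
theorem circ_proj_assoc (g : Fin l → Fin k) (h : ∀ i, A (g i) = A' i) (i : Fin l) {T : C}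
    (t : A' i ⟶ T) :
    circ g h ≫ proj A' i ≫ t = proj A (g i) ≫ eqToHom (h i) ≫ t := by
  rw [← Category.assoc, circ_proj, Category.assoc]

theorem proj_congr {i j : Fin k} (e : i = j) {X : C} (h : A i = X) :
    proj A i ≫ eqToHom h = proj A j ≫ eqToHom (e ▸ h) := by
  subst e
  rfl

theorem circ_comp (g : Fin l → Fin k) (h : ∀ i, A (g i) = A' i) (g' : Fin m → Fin l)
    (h' : ∀ i, A' (g' i) = A'' i) :
    circ g h ≫ circ g' h' = circ (fun i => g (g' i)) (fun i => (h _).trans (h' i)) :=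
  det_tensorPow_ext fun i => by simp

theorem circ_comp_assoc (g : Fin l → Fin k) (h : ∀ i, A (g i) = A' i) (g' : Fin m → Fin l)
    (h' : ∀ i, A' (g' i) = A'' i) {T : C} (t : tensorPow A'' ⟶ T) :
    circ g h ≫ circ g' h' ≫ t =
      circ (fun i => g (g' i)) (fun i => (h _).trans (h' i)) ≫ t := by
  rw [← Category.assoc, circ_comp]

theorem circ_id (h : ∀ i, A (id i) = A i) : circ id h = 𝟙 (tensorPow A) :=
  det_tensorPow_ext fun i => by simp

theorem circ_congr {g g' : Fin l → Fin k} {h : ∀ i, A (g i) = A' i} (e : ∀ i, g i = g' i) :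
    circ g h = circ g' fun i => e i ▸ h i := by
  obtain rfl : g = g' := funext e
  rfl

theorem circ_eqToHom {A B : Fin k → C} (h : A = B) :
    circ id (congrFun h) = eqToHom (congrArg tensorPow h) := by
  subst h
  exact circ_id _

/-! ### Concatenation of tuples of objects -/

/-- The iterated tensor product of a concatenation is the tensor product of the iterated tensor
products; `D` is the concatenation of `A` and `A'`. -/
def join {D : Fin (k + l) → C} (h : ∀ i, D (Fin.castAdd l i) = A i)
    (h' : ∀ i, D (Fin.natAdd k i) = A' i) : tensorPow A ⊗ tensorPow A' ⟶ tensorPow D :=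
  tuple (Fin.addCases (fun i => pfst _ _ ≫ proj A i ≫ eqToHom (h i).symm)
    (fun i => psnd _ _ ≫ proj A' i ≫ eqToHom (h' i).symm))

section
variable {D : Fin (k + l) → C} (h : ∀ i, D (Fin.castAdd l i) = A i)
    (h' : ∀ i, D (Fin.natAdd k i) = A' i)

instance det_join : Det (join h h') := by
  have : ∀ i, Det (Fin.addCases (motive := fun i => tensorPow A ⊗ tensorPow A' ⟶ D i)
    (fun i => pfst _ _ ≫ proj A i ≫ eqToHom (h i).symm)
    (fun i => psnd _ _ ≫ proj A' i ≫ eqToHom (h' i).symm) i) := by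
    refine Fin.addCases (fun i => ?_) (fun i => ?_)
    · rw [Fin.addCases_left]
      infer_instance
    · rw [Fin.addCases_right]
      infer_instance
  exact det_tuple _

theorem join_proj_castAdd (i : Fin k) :
    join h h' ≫ proj D (Fin.castAdd l i) = pfst _ _ ≫ proj A i ≫ eqToHom (h i).symm := by
  rw [join, tuple_proj, Fin.addCases_left]

theorem join_proj_castAdd_assoc (i : Fin k) {T : C} (t : D (Fin.castAdd l i) ⟶ T) :
    join h h' ≫ proj D (Fin.castAdd l i) ≫ t =
      pfst _ _ ≫ proj A i ≫ eqToHom (h i).symm ≫ t := by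
  rw [← Category.assoc, join_proj_castAdd, Category.assoc, Category.assoc]

theorem join_proj_natAdd (i : Fin l) :
    join h h' ≫ proj D (Fin.natAdd k i) = psnd _ _ ≫ proj A' i ≫ eqToHom (h' i).symm := by
  rw [join, tuple_proj, Fin.addCases_right]

theorem join_proj_natAdd_assoc (i : Fin l) {T : C} (t : D (Fin.natAdd k i) ⟶ T) :
    join h h' ≫ proj D (Fin.natAdd k i) ≫ t =
      psnd _ _ ≫ proj A' i ≫ eqToHom (h' i).symm ≫ t := by
  rw [← Category.assoc, join_proj_natAdd, Category.assoc, Category.assoc]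

@[simp]
theorem join_castAdd : join h h' ≫ circ (Fin.castAdd l) h = pfst _ _ :=
  det_tensorPow_ext fun i => by simp [join_proj_castAdd_assoc]

@[simp]
theorem join_natAdd : join h h' ≫ circ (Fin.natAdd k) h' = psnd _ _ :=
  det_tensorPow_ext fun i => by simp [join_proj_natAdd_assoc]

-- With `split_join`, this makes `join` an isomorphism in every Markov category; strictness is
-- needed only to recognize it as an `eqToHom`.
@[simp]
theorem join_split : join h h' ≫ pair (circ (Fin.castAdd l) h) (circ (Fin.natAdd k) h') = 𝟙 _ := by
  rw [comp_pair, join_castAdd, join_natAdd, pair_fst_snd]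

@[simp]
theorem split_join : pair (circ (Fin.castAdd l) h) (circ (Fin.natAdd k) h') ≫ join h h' = 𝟙 _ := by
  refine det_tensorPow_ext (Fin.addCases (fun i => ?_) (fun i => ?_))
  · simp [join_proj_castAdd]
  · simp [join_proj_natAdd]

end

end Deterministic


variable {S : Hypergraph.{u, v}}

namespace Cospan

variable {X Y Z : FreeMarkov S}

/-! ### Induction along a string diagram -/

/-- A wire can be reached from another one by traversing boxes from inputs to outputs. -/
def Reach (α : Cospan X Y) (w w' : α.G.W) : Prop := Relation.ReflTransGen α.G.Step w w'

theorem step_of {α : Cospan X Y} {k l : ℕ} (b : α.G.B k l) (i : Fin k) (j : Fin l) :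
    α.G.Step (α.G.src b i) (α.G.tgt b j) :=
  Hypergraph.step_iff.2 ⟨⟨k, l, b⟩, ⟨i, rfl⟩, ⟨j, rfl⟩⟩

/-- The number of wires from which an input of a given box can be reached. -/
noncomputable def rank (α : Cospan X Y) (b : α.G.Box) : ℕ :=
  Set.ncard {w | ∃ i, α.Reach w (α.G.src b.2.2 i)}

/-- Every wire that leads to an input of `b` also leads, through `b`, to the input `i` of `b'`. The
output `j` of `b` is a further such wire for `b'`, and by acyclicity it leads to no input of `b`.
Hence `rank` orders the boxes topologically. -/
theorem rank_lt_rank {α : Cospan X Y} (hα : α.IsStringDiagram) {b b' : α.G.Box} {i j}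
    (e : α.G.src b'.2.2 i = α.G.tgt b.2.2 j) : α.rank b < α.rank b' := by
  refine Set.ncard_lt_ncard (Set.ssubset_iff_exists.2 ⟨?_, α.G.tgt b.2.2 j, ?_, ?_⟩)
    (Set.toFinite _)
  · rintro w ⟨i', h⟩
    exact ⟨i, h.trans (.single (e ▸ step_of b.2.2 i' j))⟩
  · exact ⟨i, e ▸ .refl⟩
  · rintro ⟨i', h⟩
    exact hα.acyclic _ (.tail' h (step_of b.2.2 i' j))

/-- A set of wires is closed if, together with an output of a box, it contains all the inputs and
outputs of that box. -/
def Closed (α : Cospan X Y) (D : Set α.G.W) : Prop :=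
  ∀ {k l : ℕ} (b : α.G.B k l) (j : Fin l), α.G.tgt b j ∈ D →
    (∀ i, α.G.src b i ∈ D) ∧ ∀ j', α.G.tgt b j' ∈ D

theorem Closed.mem_of_reach {α : Cospan X Y} {D : Set α.G.W} (hD : α.Closed D) {w w' : α.G.W}
    (h : α.Reach w w') (h' : w' ∈ D) : w ∈ D := by
  induction h using Relation.ReflTransGen.head_induction_on with
  | refl => exact h'
  | head h _ ih =>
    obtain ⟨b, ⟨i, rfl⟩, ⟨j, rfl⟩⟩ := Hypergraph.step_iff.1 h
    exact (hD b.2.2 j ih).1 i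

theorem IsStringDiagram.tgt_inj {α : Cospan X Y} (hα : α.IsStringDiagram) {b b' : α.G.Box} {j j'}
    (e : α.G.tgt b.2.2 j = α.G.tgt b'.2.2 j') : b = b' := by
  have := hα.bij.1 (a₁ := Sum.inr ⟨b, j⟩) (a₂ := Sum.inr ⟨b', j'⟩) e
  cases this
  rfl

/-- The wires that cannot be reached from the outputs of a given box form a closed set. -/
theorem closed_not_reach {α : Cospan X Y} (hα : α.IsStringDiagram) (b : α.G.Box) :
    α.Closed {w | ∀ j, ¬ α.Reach (α.G.tgt b.2.2 j) w} := by
  intro k l b' j h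
  have h₁ : ∀ i, ∀ j, ¬ α.Reach (α.G.tgt b.2.2 j) (α.G.src b' i) :=
    fun i j' h' => h j' (h'.tail (step_of b' i j))
  refine ⟨h₁, fun j' j'' h' => ?_⟩
  -- A path from `b` to an output of `b'` is trivial, and then `b' = b`, or it ends with a step
  -- through `b'` itself, since a wire is an output of at most one box.
  obtain e | ⟨w, h', hw⟩ := h'.cases_tail
  · obtain rfl := hα.tgt_inj (b := ⟨k, l, b'⟩) (b' := b) e
    exact h j .refl
  · obtain ⟨b'', ⟨i, rfl⟩, ⟨j₁, e⟩⟩ := Hypergraph.step_iff.1 hw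
    obtain rfl := hα.tgt_inj (b' := ⟨k, l, b'⟩) e
    exact h₁ i j'' h'

/-- Induction on the size of a closed set `E` that contains the tuple. If no box has an output in
`E`, the tuple is a reindexing of the left interface. Otherwise the outputs of a last box are
removed from `E`. The remaining wires, followed by the inputs of that box, form a tuple in the
smaller closed set. The case `box` replaces the inputs by the outputs, and every tuple in `E` is a
reindexing of the result. The side conditions of `box` are those under which `MarkovAt` applies; `0
< l` records that the box does have an output in the set. -/
theorem tuple_induction {α : Cospan X Y} (hα : α.IsStringDiagram) (D : Set α.G.W)
    (hD : α.Closed D) (Q : ∀ {n : ℕ}, (Fin n → α.G.W) → Prop)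
    (left : Q α.left)
    (comp : ∀ {m n : ℕ} (c : Fin m → α.G.W) (g : Fin n → Fin m), Q c → Q fun i => c (g i))
    (box : ∀ {k l n : ℕ} (b : α.G.B k l) (c : Fin n → α.G.W), (∀ i, c i ∈ D) →
      (∀ i, α.G.src b i ∈ D) → (∀ j, α.G.tgt b j ∈ D) → 0 < l →
      (∀ i j, ¬ α.Reach (α.G.tgt b j) (c i)) → Q (Fin.append c (α.G.src b)) →
      Q (Fin.append c (α.G.tgt b)))
    {n : ℕ} (c : Fin n → α.G.W) (hc : ∀ i, c i ∈ D) : Q c := by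
  suffices H : ∀ (N : ℕ) (E : Set α.G.W), E.ncard = N → E ⊆ D → α.Closed E →
      ∀ {n : ℕ} (c : Fin n → α.G.W), (∀ i, c i ∈ E) → Q c from
    H _ D rfl subset_rfl hD c hc
  intro N
  induction N using Nat.strong_induction_on with
  | _ N ih =>
    rintro E rfl hED hE n c hc
    let B : Set α.G.Box := {b | ∃ j, α.G.tgt b.2.2 j ∈ E}
    rcases B.eq_empty_or_nonempty with hB | hB
    · have : ∀ i, ∃ x, α.left x = c i := fun i => by
        obtain ⟨x | ⟨b, j⟩, h⟩ := hα.bij.2 (c i)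
        · exact ⟨x, h⟩
        · have : b ∈ B := ⟨j, (show α.G.tgt b.2.2 j = c i from h) ▸ hc i⟩
          simp [hB] at this
      choose g hg using this
      rw [← funext hg]
      exact comp _ g left
    -- By maximality of the rank, no box with an output in `E` takes an output of `b` as an input.
    -- This keeps `E` closed when the outputs of `b` are taken out.
    · obtain ⟨⟨k, l, b⟩, ⟨j, hj⟩, hmax⟩ := B.exists_max_image α.rank (Set.toFinite _) hB
      have hsrc : ∀ {k' l'} (b' : α.G.B k' l') (i j' j''), α.G.tgt b' j' ∈ E →
          α.G.src b' i ≠ α.G.tgt b j'' := fun b' i j' j'' h e =>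
        (hmax ⟨_, _, b'⟩ ⟨j', h⟩).not_gt (rank_lt_rank hα (b := ⟨k, l, b⟩) (b' := ⟨_, _, b'⟩) e)
      let E' : Set α.G.W := E \ Set.range (α.G.tgt b)
      have hE' : α.Closed E' := by
        rintro k' l' b' j' ⟨h, h'⟩
        refine ⟨fun i => ⟨(hE b' j' h).1 i, ?_⟩, fun j'' => ⟨(hE b' j' h).2 j'', ?_⟩⟩
        · rintro ⟨j'', e⟩
          exact hsrc b' i j' j'' h e.symm
        · rintro ⟨j₁, e⟩
          have := hα.tgt_inj (b := ⟨k, l, b⟩) (b' := ⟨k', l', b'⟩) e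
          cases this
          exact h' ⟨j', rfl⟩
      have hlt : E'.ncard < E.ncard := Set.ncard_lt_ncard
        ⟨Set.sdiff_subset, fun h => (h hj).2 ⟨j, rfl⟩⟩ (Set.toFinite _)
      -- The tuple `c'` lists all of `E'`, so `c'` followed by the outputs of `b` lists all of `E`.
      let e := (Finite.equivFin E').symm
      let c' : Fin (Nat.card E') → α.G.W := fun i => (e i).1
      have hc' : ∀ i, c' i ∈ E' := fun i => (e i).2
      have hQ : Q (Fin.append c' (α.G.tgt b)) := by
        refine box b c' (fun i => hED (hc' i).1) (fun i => hED ((hE b j hj).1 i))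
          (fun j' => hED ((hE b j hj).2 j')) j.pos ?_ ?_
        · exact fun i j' h => (hE'.mem_of_reach h (hc' i)).2 ⟨j', rfl⟩
        · refine ih _ hlt E' rfl (Set.sdiff_subset.trans hED) hE' _ (Fin.addCases ?_ ?_)
          · intro i
            rw [Fin.append_left]
            exact hc' i
          · intro i
            rw [Fin.append_right]
            refine ⟨(hE b j hj).1 i, ?_⟩
            rintro ⟨j', e⟩
            exact hsrc b i j j' hj e.symm
      have : ∀ i, ∃ x, Fin.append c' (α.G.tgt b) x = c i := fun i => by
        by_cases h : c i ∈ Set.range (α.G.tgt b)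
        · obtain ⟨j', h⟩ := h
          exact ⟨Fin.natAdd _ j', (Fin.append_right ..).trans h⟩
        · refine ⟨Fin.castAdd _ (e.symm ⟨c i, hc i, h⟩), (Fin.append_left ..).trans ?_⟩
          exact congrArg Subtype.val (e.apply_symm_apply _)
      choose g hg using this
      rw [← funext hg]
      exact comp _ g hQ

end Cospan


/-! ### Families of joint morphisms -/

section Joint

theorem append_castAdd_label {W : Type} {C : Type u₁} {A : W → C} {m n : ℕ}
    (c : Fin m → W) (d : Fin n → W) (i : Fin m) :
    A (Fin.append c d (Fin.castAdd n i)) = A (c i) := congrArg A (Fin.append_left ..)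

theorem append_natAdd_label {W : Type} {C : Type u₁} {A : W → C} {m n : ℕ}
    (c : Fin m → W) (d : Fin n → W) (i : Fin n) :
    A (Fin.append c d (Fin.natAdd m i)) = A (d i) := congrArg A (Fin.append_right ..)

variable {C : Type u₁} [Category.{v₁} C] [MonoidalCategory C] [MarkovCategory C]
variable {W : Type} {A : W → C} {Z : C}

/-- A family of morphisms from `Z` to the iterated tensor products given by the tuples of wires is
natural if it is compatible with copying, permuting and discarding wires. -/
def Natural (A : W → C) (J : ∀ ⦃n : ℕ⦄ (c : Fin n → W), Z ⟶ tensorPow fun i => A (c i)) : Prop :=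
  ∀ ⦃m n : ℕ⦄ (c : Fin m → W) (c' : Fin n → W) (g : Fin n → Fin m) (_ : ∀ i, c (g i) = c' i)
    (h : ∀ i, A (c (g i)) = A (c' i)), J c ≫ circ g h = J c'

variable (J : ∀ ⦃n : ℕ⦄ (c : Fin n → W), Z ⟶ tensorPow fun i => A (c i))

/-- The joint morphism of two tuples of wires. -/
def both {m n : ℕ} (c : Fin m → W) (d : Fin n → W) :
    Z ⟶ (tensorPow fun i => A (c i)) ⊗ tensorPow fun i => A (d i) :=
  J (Fin.append c d) ≫
    pair (circ (Fin.castAdd n) (append_castAdd_label c d))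
      (circ (Fin.natAdd m) (append_natAdd_label c d))

/-- The joint morphism of three tuples of wires. -/
def triple {l m n : ℕ} (c : Fin l → W) (d : Fin m → W) (e : Fin n → W) :
    Z ⟶ ((tensorPow fun i => A (c i)) ⊗ tensorPow fun i => A (d i)) ⊗ tensorPow fun i => A (e i) :=
  both J (Fin.append c d) e ≫
    pair (circ (Fin.castAdd m) (append_castAdd_label c d))
      (circ (Fin.natAdd l) (append_natAdd_label c d)) ▷ _

variable {J} {l m n p : ℕ}

theorem both_join (c : Fin m → W) (d : Fin n → W) :
    both J c d ≫ join (append_castAdd_label c d) (append_natAdd_label c d) =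
      J (Fin.append c d) := by
  rw [both, Category.assoc, split_join, Category.comp_id]

theorem triple_join (c : Fin l → W) (d : Fin m → W) (e : Fin n → W) :
    triple J c d e ≫ join (append_castAdd_label c d) (append_natAdd_label c d) ▷ _ =
      both J (Fin.append c d) e := by
  rw [triple, Category.assoc, ← comp_whiskerRight, split_join, id_whiskerRight, Category.comp_id]

/-- Reindexing `x` along `g` followed by `g'` yields the concatenation of `c` and `d`. Thus the
joint morphism of two tuples can be read off any longer tuple that contains both, and it does not
matter where they sit in it. -/
theorem Natural.comp_pair (hJ : Natural A J) {x : Fin p → W} {c : Fin m → W} {d : Fin n → W}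
    {g : Fin m → Fin p} {g' : Fin n → Fin p} (e : ∀ i, x (g i) = c i) (e' : ∀ i, x (g' i) = d i)
    (h : ∀ i, A (x (g i)) = A (c i)) (h' : ∀ i, A (x (g' i)) = A (d i)) :
    J x ≫ pair (circ g h) (circ g' h') = both J c d := by
  have hx : ∀ i, x (Fin.append g g' i) = Fin.append c d i :=
    Fin.addCases (fun i => by simpa using e i) (fun i => by simpa using e' i)
  rw [both, ← hJ x (Fin.append c d) (Fin.append g g') hx fun i => congrArg A (hx i),
    Category.assoc, GSMon.comp_pair (circ _ _), circ_comp, circ_comp]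
  congr 2
  · exact circ_congr fun i => (Fin.append_left ..).symm
  · exact circ_congr fun i => (Fin.append_right ..).symm

theorem Natural.both_map (hJ : Natural A J) {m' n' : ℕ} {c : Fin m → W} {d : Fin n → W}
    {c' : Fin m' → W} {d' : Fin n' → W}
    {g : Fin m' → Fin m} {g' : Fin n' → Fin n} (e : ∀ i, c (g i) = c' i) (e' : ∀ i, d (g' i) = d' i)
    (h : ∀ i, A (c (g i)) = A (c' i)) (h' : ∀ i, A (d (g' i)) = A (d' i)) :
    both J c d ≫ (circ g h ⊗ₘ circ g' h') = both J c' d' := by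
  rw [both, Category.assoc, pair_tensor, circ_comp, circ_comp]
  exact hJ.comp_pair (fun i => by simpa using e i) (fun i => by simpa using e' i) _ _

theorem Natural.both_map_left (hJ : Natural A J) {m' : ℕ} {c : Fin m → W} {d : Fin n → W}
    {c' : Fin m' → W} {g : Fin m' → Fin m} (e : ∀ i, c (g i) = c' i)
    (h : ∀ i, A (c (g i)) = A (c' i)) :
    both J c d ≫ circ g h ▷ _ = both J c' d := by
  have := hJ.both_map (d := d) (d' := d) (g' := id) e (fun _ => rfl) h fun _ => rfl
  rwa [circ_id, tensorHom_id] at this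

theorem Natural.both_map_right (hJ : Natural A J) {n' : ℕ} {c : Fin m → W} {d : Fin n → W}
    {d' : Fin n' → W} {g : Fin n' → Fin n} (e : ∀ i, d (g i) = d' i)
    (h : ∀ i, A (d (g i)) = A (d' i)) :
    both J c d ≫ _ ◁ circ g h = both J c d' := by
  have := hJ.both_map (c := c) (c' := c) (g := id) (fun _ => rfl) e (fun _ => rfl) h
  rwa [circ_id, id_tensorHom] at this

theorem Natural.comp_triple (hJ : Natural A J) {x : Fin p → W} {c : Fin l → W} {d : Fin m → W}
    {y : Fin n → W} {g : Fin l → Fin p} {g' : Fin m → Fin p} {g'' : Fin n → Fin p}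
    (e : ∀ i, x (g i) = c i) (e' : ∀ i, x (g' i) = d i) (e'' : ∀ i, x (g'' i) = y i)
    (h : ∀ i, A (x (g i)) = A (c i)) (h' : ∀ i, A (x (g' i)) = A (d i))
    (h'' : ∀ i, A (x (g'' i)) = A (y i)) :
    J x ≫ pair (pair (circ g h) (circ g' h')) (circ g'' h'') = triple J c d y := by
  have hx : ∀ i, x (Fin.append g g' i) = Fin.append c d i :=
    Fin.addCases (fun i => by simpa using e i) (fun i => by simpa using e' i)
  rw [triple, ← hJ.comp_pair hx e'' (fun i => congrArg A (hx i)) h'', Category.assoc,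
    pair_whiskerRight, GSMon.comp_pair (circ _ _), circ_comp, circ_comp]
  congr 3
  · exact circ_congr fun i => (Fin.append_left ..).symm
  · exact circ_congr fun i => (Fin.append_right ..).symm

theorem Natural.triple_swap (hJ : Natural A J) (c : Fin l → W) (d : Fin m → W) (e : Fin n → W) :
    triple J c d e ≫ swapRight _ _ _ = triple J c e d := by
  rw [triple, both, Category.assoc, Category.assoc, pair_whiskerRight_assoc,
    GSMon.comp_pair (circ _ _), pair_swapRight, circ_comp, circ_comp]
  exact hJ.comp_triple (by simp) (by simp) (by simp) _ _ _

end Joint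

/-! ### States: joint interpretations of the wires of a string diagram -/

section State

variable {C : Type u₁} [Category.{v₁} C] [MonoidalCategory C]
variable {S : Hypergraph.{u, v}} {X Y : FreeMarkov S}

/-- The object of `C` that interprets a wire of the signature. -/
abbrev Hypergraph.Hom.obj (f : Hypergraph.Hom S (hyp C)) (w : S.W) : C := f.wire w

/-- The object of `C` that interprets a wire of a string diagram. -/
abbrev Cospan.wireObj (f : Hypergraph.Hom S (hyp C)) (α : Cospan X Y) (w : α.G.W) : C :=
  f.obj (α.lab.wire w)

variable [MarkovCategory C] (f : Hypergraph.Hom S (hyp C)) {Z : C}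

/-- The morphism of `C` given by a box of the underlying hypergraph of `C`. -/
def hypMor {k l : ℕ} (b : (hyp C).B k l) : @tensorPow C _ _ k b.1 ⟶ @tensorPow C _ _ l b.2.1 :=
  b.2.2

/-- The morphism of `C` that interprets a box of the signature. -/
def boxMor {k l : ℕ} (b : S.B k l) :
    (tensorPow fun i => f.obj (S.src b i)) ⟶ tensorPow fun j => f.obj (S.tgt b j) :=
  circ (A := fun i => f.obj (S.src b i)) (A' := (f.box b).1) id (f.wire_src b) ≫
    hypMor (f.box b) ≫
    circ (A := (f.box b).2.1) (A' := fun j => f.obj (S.tgt b j)) id fun j => (f.wire_tgt b j).symm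

/-- The morphism of `C` that interprets a box of a string diagram. -/
def Cospan.boxMor (α : Cospan X Y) {k l : ℕ} (b : α.G.B k l) :
    (tensorPow fun i => α.wireObj f (α.G.src b i)) ⟶ tensorPow fun j => α.wireObj f (α.G.tgt b j) :=
  circ (A := fun i => α.wireObj f (α.G.src b i)) id
      (fun i => congrArg f.obj (α.lab.wire_src b i)) ≫ GSMon.boxMor f (α.lab.box b) ≫
    circ (A' := fun j => α.wireObj f (α.G.tgt b j)) id
      fun j => congrArg f.obj (α.lab.wire_tgt b j).symm

/-- The outputs of a box `b` are generated from its inputs, independently of any wires that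
cannot be reached from `b`. -/
def Cospan.MarkovAt (α : Cospan X Y)
    (J : ∀ ⦃n : ℕ⦄ (c : Fin n → α.G.W), Z ⟶ tensorPow fun i => α.wireObj f (c i))
    {k l : ℕ} (b : α.G.B k l) : Prop :=
  ∀ ⦃n : ℕ⦄ (c : Fin n → α.G.W), (∀ i j, ¬ α.Reach (α.G.tgt b j) (c i)) →
    both J c (α.G.tgt b) = both J c (α.G.src b) ≫ _ ◁ α.boxMor f b

/-- A joint interpretation of all wires of a string diagram. -/
structure Cospan.IsState (α : Cospan X Y)
    (J : ∀ ⦃n : ℕ⦄ (c : Fin n → α.G.W), Z ⟶ tensorPow fun i => α.wireObj f (c i)) : Prop where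
  natural : Natural (α.wireObj f) J
  markov : ∀ ⦃k l : ℕ⦄ (b : α.G.B k l), α.MarkovAt f J b

namespace Cospan

variable {f} {α : Cospan X Y}

section
variable {J : ∀ ⦃n : ℕ⦄ (c : Fin n → α.G.W), Z ⟶ tensorPow fun i => α.wireObj f (c i)}

/-- Naturality carries the equality along reindexings, and the Markov property carries it from the
inputs of a box to its outputs; these are the two steps of `tuple_induction`. -/
theorem IsState.ext {J' : ∀ ⦃n : ℕ⦄ (c : Fin n → α.G.W), Z ⟶ tensorPow fun i => α.wireObj f (c i)}
    (hα : α.IsStringDiagram) (hJ : α.IsState f J) (hJ' : α.IsState f J')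
    (h : J α.left = J' α.left) {n : ℕ} (c : Fin n → α.G.W) : J c = J' c := by
  refine tuple_induction hα Set.univ (fun b j _ => ⟨fun _ => trivial, fun _ => trivial⟩)
    (Q := fun c => J c = J' c) h ?_ ?_ c fun _ => trivial
  · intro m n c g h
    rw [← hJ.natural c _ g (fun _ => rfl) fun _ => rfl, h,
      hJ'.natural c _ g (fun _ => rfl) fun _ => rfl]
  · intro k l n b c _ _ _ _ hc h
    rw [← both_join (J := J), ← both_join (J := J'), hJ.markov b c hc, hJ'.markov b c hc,
      both, both, h]

/-- Both conditions on a state concern only what is applied after `J`, so `s` may be any morphism.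
-/
theorem IsState.comp (hJ : α.IsState f J) {Z' : C} (s : Z' ⟶ Z) :
    α.IsState f fun _ c => s ≫ J c where
  natural m n c c' g e h := by rw [Category.assoc, hJ.natural c c' g e h]
  markov k l b n c hc := by
    have := hJ.markov b c hc
    simp only [both, Category.assoc] at this ⊢
    rw [this]

theorem MarkovAt.triple {k l : ℕ} {b : α.G.B k l} (hb : α.MarkovAt f J b) {m n : ℕ}
    (c : Fin m → α.G.W) (d : Fin n → α.G.W) (hc : ∀ i j, ¬ α.Reach (α.G.tgt b j) (c i))
    (hd : ∀ i j, ¬ α.Reach (α.G.tgt b j) (d i)) :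
    triple J c d (α.G.tgt b) = triple J c d (α.G.src b) ≫ _ ◁ α.boxMor f b := by
  rw [GSMon.triple, hb, GSMon.triple, Category.assoc, Category.assoc, whisker_exchange]
  refine Fin.addCases (fun i => ?_) (fun i => ?_)
  · rw [Fin.append_left]
    exact hc i
  · rw [Fin.append_right]
    exact hd i

theorem IsStringDiagram.not_step_left (hα : α.IsStringDiagram) {w : α.G.W} {i : Fin X.n} :
    ¬ α.G.Step w (α.left i) := fun h => by
  obtain ⟨b, -, ⟨j, e⟩⟩ := Hypergraph.step_iff.1 h
  exact hα.left_ne_tgt i b.2.2 j e.symm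

theorem IsStringDiagram.eq_of_reach_left (hα : α.IsStringDiagram) {w : α.G.W} {i : Fin X.n}
    (h : α.Reach w (α.left i)) : α.left i = w := by
  obtain h | ⟨w', -, h⟩ := h.cases_tail
  · exact h
  · exact (hα.not_step_left h).elim

/-- For an initial box `b`, the Markov property has to be checked only with the left interface as
spectator. `tuple_induction` over the wires not reachable from `b` extends it to all admissible
spectators. In its box case, the box `b'` that is added and `b` are causally independent: no output
of either leads to an input or output of the other. Hence they can be applied in either order, by
the interchange law. -/
theorem markovAt_of_others (hα : α.IsStringDiagram) (hJ : Natural (α.wireObj f) J) {k l : ℕ}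
    (b : α.G.B k l) (hb : ∀ i, α.G.src b i ∈ Set.range α.left)
    (hJ' : ∀ ⦃k' l' : ℕ⦄ (b' : α.G.B k' l'), (⟨k', l', b'⟩ : α.G.Box) ≠ ⟨k, l, b⟩ →
      α.MarkovAt f J b')
    (h : both J α.left (α.G.tgt b) = both J α.left (α.G.src b) ≫ _ ◁ α.boxMor f b) :
    α.MarkovAt f J b := by
  intro n c hc
  refine tuple_induction hα _ (closed_not_reach hα ⟨k, l, b⟩)
    (Q := fun c => both J c (α.G.tgt b) = both J c (α.G.src b) ≫ _ ◁ α.boxMor f b) h ?_ ?_ c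
    fun i j => hc i j
  · intro m n c g h
    rw [← hJ.both_map_left (g := g) (c := c) (fun _ => rfl) fun _ => rfl, h,
      ← hJ.both_map_left (g := g) (c := c) (fun _ => rfl) fun _ => rfl, Category.assoc,
      Category.assoc, whisker_exchange]
  · intro k' l' n b' c hc hs ht hl hu ih
    -- Here `0 < l'` is essential: `b'` has an output, and that output cannot be reached from `b`.
    have hne : (⟨k', l', b'⟩ : α.G.Box) ≠ ⟨k, l, b⟩ := by
      intro e
      cases e
      exact ht ⟨0, hl⟩ ⟨0, hl⟩ .refl
    have hb' := hJ' b' hne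
    have hsrc : ∀ i j, ¬ α.Reach (α.G.tgt b' j) (α.G.src b i) := by
      intro i j h
      obtain ⟨x, hx⟩ := hb i
      rw [← hx] at h
      exact hα.left_ne_tgt x b' j (hα.eq_of_reach_left h)
    have htgt : ∀ i j, ¬ α.Reach (α.G.tgt b' j) (α.G.tgt b i) := by
      intro i j h
      obtain e | ⟨w, h, hw⟩ := h.cases_tail
      · exact hne (hα.tgt_inj (b := ⟨k, l, b⟩) (b' := ⟨k', l', b'⟩) e).symm
      · obtain ⟨b'', ⟨i', rfl⟩, ⟨j', e⟩⟩ := Hypergraph.step_iff.1 hw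
        obtain rfl := hα.tgt_inj (b' := ⟨k, l, b⟩) e
        exact hsrc i' j h
    have ih' : triple J c (α.G.src b') (α.G.tgt b) =
        triple J c (α.G.src b') (α.G.src b) ≫ _ ◁ α.boxMor f b := by
      rw [triple, ih, triple, Category.assoc, Category.assoc, whisker_exchange]
    -- Apply `b'` with the outputs of `b` as spectators, then `b` with the inputs of `b'` as
    -- spectators (`ih'`), and finally recombine by applying `b'` first, with the inputs of `b` as
    -- spectators.
    have key : triple J c (α.G.tgt b') (α.G.tgt b) =
        triple J c (α.G.tgt b') (α.G.src b) ≫ _ ◁ α.boxMor f b := by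
      rw [← hJ.triple_swap c (α.G.tgt b) (α.G.tgt b'), hb'.triple _ _ hu htgt,
        ← hJ.triple_swap c (α.G.src b') (α.G.tgt b), ih',
        ← hJ.triple_swap c (α.G.src b) (α.G.src b')]
      rw [← hJ.triple_swap c (α.G.src b) (α.G.tgt b'), hb'.triple _ _ hu hsrc]
      simp only [Category.assoc, swapRight_swapRight_assoc, whiskerLeft_swapRight]
      rw [← whisker_exchange, ← whiskerRight_swapRight_assoc]
    rw [← triple_join, key, Category.assoc, whisker_exchange, ← triple_join, Category.assoc]

end

/-! ### Removing an initial box -/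

/-- The string diagram that remains when an initial box is removed. The outputs of that box are
turned into inputs of the string diagram. -/
def peel (α : Cospan X Y) {k l : ℕ} (b : α.G.B k l) :
    Cospan (X.tensor (FreeMarkov.cod (α.lab.box b))) Y where
  G :=
    { W := α.G.W
      B := fun k' l' => {b' : α.G.B k' l' // (⟨k', l', b'⟩ : α.G.Box) ≠ ⟨k, l, b⟩}
      src := fun b' => α.G.src b'.1
      tgt := fun b' => α.G.tgt b'.1 }
  finite_wires := α.finite_wires
  finite_boxes := Finite.of_injective (β := α.G.Box) (fun b => ⟨b.1, b.2.1, b.2.2.1⟩) <| by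
    rintro ⟨k, l, b, hb⟩ ⟨k', l', b', hb'⟩ e
    cases e
    rfl
  lab :=
    { wire := α.lab.wire
      box := fun b' => α.lab.box b'.1
      wire_src := fun b' => α.lab.wire_src b'.1
      wire_tgt := fun b' => α.lab.wire_tgt b'.1 }
  left := Fin.append α.left (α.G.tgt b)
  right := α.right
  lab_left := Fin.addCases
    (fun i => by simpa using α.lab_left i)
    (fun i => (congrArg α.lab.wire (Fin.append_right ..)).trans ((α.lab.wire_tgt b i).trans
      (FreeMarkov.tensor_label_natAdd X (FreeMarkov.cod (α.lab.box b)) i).symm))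
  lab_right := α.lab_right

/-- The inclusion of the string diagram that remains when a box is removed. -/
def peelIncl (α : Cospan X Y) {k l : ℕ} (b : α.G.B k l) : Hypergraph.Hom (α.peel b).G α.G where
  wire w := w
  box b' := b'.1
  wire_src _ _ := rfl
  wire_tgt _ _ := rfl

theorem peel_isStringDiagram (hα : α.IsStringDiagram) {k l : ℕ} (b : α.G.B k l) :
    (α.peel b).IsStringDiagram := by
  refine ⟨hα.acyclic.of_hom (α.peelIncl b), leftMonogamous_iff.2 ⟨?_, ?_⟩⟩
  · have hl : ∀ x, (α.peel b).left x = α.start (Fin.addCases (fun i => Sum.inl i)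
        (fun j => Sum.inr ⟨⟨k, l, b⟩, j⟩) x) := by
      refine Fin.addCases (fun i => ?_) (fun i => ?_)
      · rw [Fin.addCases_left]
        exact Fin.append_left ..
      · rw [Fin.addCases_right]
        exact Fin.append_right ..
    have hr : ∀ (b' : (α.peel b).G.Box) x (j : Fin b'.2.1),
        (α.peel b).left x ≠ α.G.tgt b'.2.2.1 j := by
      rintro ⟨k', l', b', hb'⟩ x j e
      rw [hl] at e
      have := hα.bij.1 (a₂ := Sum.inr ⟨⟨k', l', b'⟩, j⟩) e
      revert this
      refine Fin.addCases (fun i => ?_) (fun i => ?_) x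
      · rw [Fin.addCases_left]
        rintro ⟨⟩
      · rw [Fin.addCases_right]
        intro e
        cases e
        exact hb' rfl
    rintro (x | ⟨⟨k₁, l₁, b₁, h₁⟩, j₁⟩) (y | ⟨⟨k₂, l₂, b₂, h₂⟩, j₂⟩) e
    · have e : (α.peel b).left x = (α.peel b).left y := e
      rw [hl, hl] at e
      have := hα.bij.1 e
      revert this
      refine Fin.addCases (fun i => ?_) (fun i => ?_) x <;>
        refine Fin.addCases (fun i => ?_) (fun i => ?_) y <;>
          simp only [Fin.addCases_left, Fin.addCases_right] <;> intro e <;> cases e <;> rfl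
    · exact (hr ⟨k₂, l₂, b₂, h₂⟩ x j₂ e).elim
    · exact (hr ⟨k₁, l₁, b₁, h₁⟩ y j₁ e.symm).elim
    · have := hα.bij.1 (a₁ := Sum.inr ⟨⟨k₁, l₁, b₁⟩, j₁⟩) (a₂ := Sum.inr ⟨⟨k₂, l₂, b₂⟩, j₂⟩) e
      cases this
      rfl
  · intro w
    obtain ⟨x | ⟨⟨k', l', b'⟩, j⟩, rfl⟩ := hα.bij.2 w
    · exact ⟨Sum.inl (Fin.castAdd _ x), Fin.append_left ..⟩
    · by_cases h : (⟨k', l', b'⟩ : α.G.Box) = ⟨k, l, b⟩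
      · cases h
        exact ⟨Sum.inl (Fin.natAdd _ j), Fin.append_right ..⟩
      · exact ⟨Sum.inr ⟨⟨k', l', b', h⟩, j⟩, rfl⟩

theorem card_peel_lt (α : Cospan X Y) {k l : ℕ} (b : α.G.B k l) :
    Nat.card (α.peel b).G.Box < Nat.card α.G.Box := by
  have : Fintype α.G.Box := Fintype.ofFinite _
  have : Fintype (α.peel b).G.Box := Fintype.ofFinite _
  rw [Nat.card_eq_fintype_card, Nat.card_eq_fintype_card]
  refine Fintype.card_lt_of_injective_of_notMem
    (f := fun b' : (α.peel b).G.Box => (⟨b'.1, b'.2.1, b'.2.2.1⟩ : α.G.Box)) ?_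
    (b := ⟨k, l, b⟩) ?_
  · rintro ⟨k, l, b, hb⟩ ⟨k', l', b', hb'⟩ e
    cases e
    rfl
  · rintro ⟨⟨k', l', b', hb'⟩, e⟩
    exact hb' e

/-- A string diagram with at least one box has a box all of whose inputs are inputs of the string
diagram. -/
theorem exists_initial (hα : α.IsStringDiagram) [Nonempty α.G.Box] :
    ∃ (k l : ℕ) (b : α.G.B k l), ∀ i, α.G.src b i ∈ Set.range α.left := by
  -- An input of a box of minimal rank cannot be an output of a box, because that box would have
  -- smaller rank.
  obtain ⟨⟨k, l, b⟩, h⟩ := Finite.exists_min α.rank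
  refine ⟨k, l, b, fun i => ?_⟩
  obtain ⟨x | ⟨b', j⟩, e⟩ := hα.bij.2 (α.G.src b i)
  · exact ⟨x, e⟩
  · exact ((h b').not_gt (rank_lt_rank hα (b' := ⟨k, l, b⟩) (i := i) (j := j) e.symm)).elim

/-- Induction on the number of boxes. Without boxes every wire is an input, and a state is given by
`s` followed by reindexing. Otherwise an initial box `b` is removed. The remaining diagram has the
outputs of `b` as additional inputs, and it is started with `s` followed by copying the inputs of
`b` and applying `b` to the copies. Its state satisfies the Markov property at all other boxes, and
`markovAt_of_others` supplies it at `b`. The induction requires arbitrary `Z` and `s`. -/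
theorem exists_state (f : Hypergraph.Hom S (hyp C)) {Y : FreeMarkov S} :
    ∀ (N : ℕ) {X : FreeMarkov S} (α : Cospan X Y), α.IsStringDiagram → Nat.card α.G.Box = N →
    ∀ {Z : C} (s : Z ⟶ tensorPow fun i => α.wireObj f (α.left i)),
    ∃ J : ∀ ⦃n : ℕ⦄ (c : Fin n → α.G.W), Z ⟶ tensorPow fun i => α.wireObj f (c i),
      α.IsState f J ∧ J α.left = s := by
  intro N
  induction N using Nat.strong_induction_on with
  | _ N ih =>
    rintro X α hα rfl Z s
    rcases isEmpty_or_nonempty α.G.Box with hB | hB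
    · have : ∀ w, ∃ i, α.left i = w := fun w => by
        obtain ⟨x | ⟨b, j⟩, h⟩ := hα.bij.2 w
        · exact ⟨x, h⟩
        · exact hB.elim b
      choose e he using this
      refine ⟨fun n c => s ≫ circ (fun i => e (c i)) fun i => congrArg (α.wireObj f) (he (c i)),
        ⟨?_, fun k l b => hB.elim ⟨k, l, b⟩⟩, ?_⟩
      · intro m n c c' g h _
        rw [Category.assoc, circ_comp]
        exact congrArg _ (circ_congr fun i => congrArg e (h i))
      · have he' : ∀ i, e (α.left i) = i := fun i =>
          Sum.inl.inj (hα.bij.1 (a₁ := Sum.inl _) (a₂ := Sum.inl _) (he (α.left i)))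
        change s ≫ circ (fun i => e (α.left i)) _ = s
        rw [circ_congr (g' := id) he', circ_id, Category.comp_id]
    · obtain ⟨k, l, b, hb⟩ := exists_initial hα
      choose g hg using hb
      have hg' : ∀ i, α.wireObj f (α.left (g i)) = α.wireObj f (α.G.src b i) :=
        fun i => congrArg _ (hg i)
      obtain ⟨J, hn, hJ', hs⟩ : ∃ J : ∀ ⦃n : ℕ⦄ (c : Fin n → α.G.W),
          Z ⟶ tensorPow fun i => α.wireObj f (c i), Natural (α.wireObj f) J ∧
          (∀ ⦃k' l' : ℕ⦄ (b' : α.G.B k' l'), (⟨k', l', b'⟩ : α.G.Box) ≠ ⟨k, l, b⟩ →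
            α.MarkovAt f J b') ∧
          J (Fin.append α.left (α.G.tgt b)) = s ≫ pair (𝟙 _) (circ g hg') ≫ _ ◁ α.boxMor f b ≫
            join (append_castAdd_label α.left (α.G.tgt b))
              (append_natAdd_label α.left (α.G.tgt b)) := by
        obtain ⟨J, hJ, hs⟩ := ih _ (α.card_peel_lt b) (α.peel b) (peel_isStringDiagram hα b) rfl
          (s ≫ pair (𝟙 _) (circ g hg') ≫ _ ◁ α.boxMor f b ≫
            join (append_castAdd_label α.left (α.G.tgt b))
              (append_natAdd_label α.left (α.G.tgt b)))
        -- Removing `b` only removes paths, so spectators that are admissible in `α` remain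
        -- admissible.
        exact ⟨J, hJ.natural, fun k' l' b' hb' n c hc => hJ.markov ⟨b', hb'⟩ c fun i j h =>
          hc i j <| Relation.ReflTransGen.lift (α.peelIncl b).wire
            (fun _ _ => Hypergraph.Step.map (α.peelIncl b)) _ _ h, hs⟩
      -- Discarding the outputs of `b` undoes the extension of `s`; this is naturality of
      -- discarding, in the form of `pair_fst`.
      have hs' : J α.left = s := by
        rw [← hn (Fin.append α.left (α.G.tgt b)) α.left (Fin.castAdd l)
          (fun i => Fin.append_left ..) (append_castAdd_label α.left (α.G.tgt b)), hs]
        simp only [Category.assoc, join_castAdd, pair_whiskerLeft_assoc, pair_fst,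
          Category.comp_id]
      have hJb : α.MarkovAt f J b := by
        refine markovAt_of_others hα hn b (fun i => ⟨g i, hg i⟩) hJ' ?_
        have h₁ : both J α.left (α.G.src b) = s ≫ pair (𝟙 _) (circ g hg') := by
          have := hn.comp_pair (x := α.left) (c := α.left) (g := id) (fun _ => rfl) hg
            (fun _ => rfl) hg'
          rw [← this, hs', circ_id]
        have h₂ : both J α.left (α.G.tgt b) = s ≫ pair (𝟙 _) (circ g hg') ≫
            _ ◁ α.boxMor f b := by
          rw [both, hs]
          simp only [Category.assoc, join_split, Category.comp_id]
        rw [h₁, h₂, Category.assoc]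
      refine ⟨J, ⟨hn, fun k' l' b' => ?_⟩, hs'⟩
      by_cases h : (⟨k', l', b'⟩ : α.G.Box) = ⟨k, l, b⟩
      · cases h
        exact hJb
      · exact hJ' b' h

end Cospan

end State


section Eval

variable {C : Type u₁} [Category.{v₁} C] [MonoidalCategory C] [MarkovCategory C]
variable {S : Hypergraph.{u, v}} {X Y X' Y' Z : FreeMarkov S} {f : Hypergraph.Hom S (hyp C)} {V : C}

theorem boxMor_congr {k l : ℕ} {b b' : S.B k l} (e : b = b') {A : Fin k → C} {A' : Fin l → C}
    (h₁ : ∀ i, A i = f.obj (S.src b i)) (h₁' : ∀ i, A i = f.obj (S.src b' i))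
    (h₂ : ∀ i, f.obj (S.tgt b i) = A' i) (h₂' : ∀ i, f.obj (S.tgt b' i) = A' i) :
    circ (A := A) (A' := fun i => f.obj (S.src b i)) id h₁ ≫ boxMor f b ≫
        circ (A := fun i => f.obj (S.tgt b i)) (A' := A') id h₂ =
      circ (A := A) (A' := fun i => f.obj (S.src b' i)) id h₁' ≫ boxMor f b' ≫
        circ (A := fun i => f.obj (S.tgt b' i)) (A' := A') id h₂' := by
  subst e
  rfl

namespace Cospan

/-! ### Pulling back states along morphisms of hypergraphs -/

section Pullback

variable {α : Cospan X Y} {β : Cospan X' Y'}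

/-- Traces a path back from its end. It applies when every step into the image of `h` comes from
`β`, as for the inclusion of a normalization or of the first factor of a composite. -/
theorem reach_of_backward (h : β.G.W → α.G.W) (hi : h.Injective)
    (hs : ∀ x w', α.G.Step x (h w') → ∃ w, h w = x ∧ β.G.Step w w') {w w' : β.G.W}
    (hr : α.Reach (h w) (h w')) : β.Reach w w' := by
  suffices ∀ y, α.Reach (h w) y → ∀ w', h w' = y → β.Reach w w' from this _ hr _ rfl
  intro y hr
  induction hr with
  | refl =>
    intro w' e
    rw [hi e]
    exact .refl
  | tail _ hs' ih =>
    rintro w' rfl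
    obtain ⟨w'', rfl, h'⟩ := hs _ _ hs'
    exact (ih w'' rfl).tail h'

/-- Traces a path from its beginning. The invariant `P` serves the second factor of a composite,
whose input wires may also enter boxes of the first factor, whereas outputs of its boxes do not. -/
theorem reach_forward (h : β.G.W → α.G.W) (P : β.G.W → Prop)
    (hs : ∀ w x, P w → α.G.Step (h w) x → ∃ w', P w' ∧ h w' = x ∧ β.G.Step w w') {w : β.G.W}
    {x : α.G.W} (hw : P w) (hr : α.Reach (h w) x) : ∃ w', P w' ∧ h w' = x ∧ β.Reach w w' := by
  induction hr with
  | refl => exact ⟨w, hw, rfl, .refl⟩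
  | tail _ hs' ih =>
    obtain ⟨w', hw', rfl, hr⟩ := ih
    obtain ⟨w'', hw'', rfl, h'⟩ := hs _ _ hw' hs'
    exact ⟨w'', hw'', rfl, hr.tail h'⟩

theorem boxMor_map (h : Hypergraph.Hom β.G α.G)
    {k l : ℕ} (b : β.G.B k l)
    (hb : α.lab.box (h.box b) = β.lab.box b)
    (h₁ : ∀ i, α.wireObj f (α.G.src (h.box b) i) = β.wireObj f (β.G.src b i))
    (h₂ : ∀ i, α.wireObj f (α.G.tgt (h.box b) i) = β.wireObj f (β.G.tgt b i)) :
    α.boxMor f (h.box b) ≫ circ id h₂ = circ id h₁ ≫ β.boxMor f b := by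
  simp only [boxMor, Category.assoc, circ_comp]
  rw [circ_comp_assoc]
  exact boxMor_congr hb _ _ _ _

/-- Hypothesis `hr` says that `h` reflects reachability from outputs of boxes, so that admissible
spectators for a box of `β` are sent to admissible spectators for its image. The labels of
corresponding wires are only propositionally equal, whence the final `circ id`. -/
theorem IsState.pullback
    {J : ∀ ⦃n : ℕ⦄ (c : Fin n → α.G.W), V ⟶ tensorPow fun i => α.wireObj f (c i)}
    (hJ : α.IsState f J) (h : Hypergraph.Hom β.G α.G)
    (hw : ∀ w, α.lab.wire (h.wire w) = β.lab.wire w)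
    (hb : ∀ ⦃k l : ℕ⦄ (b : β.G.B k l), α.lab.box (h.box b) = β.lab.box b)
    (hr : ∀ ⦃k l : ℕ⦄ (b : β.G.B k l) (j : Fin l) (w : β.G.W),
      α.Reach (h.wire (β.G.tgt b j)) (h.wire w) → β.Reach (β.G.tgt b j) w) :
    β.IsState f fun _ c => J (fun i => h.wire (c i)) ≫
      circ (A' := fun i => β.wireObj f (c i)) id fun i => congrArg f.obj (hw (c i)) := by
  have hboth : ∀ {m n : ℕ} (c : Fin m → β.G.W) (d : Fin n → β.G.W),
      both (A := β.wireObj f) (fun _ c => J (fun i => h.wire (c i)) ≫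
        circ (A' := fun i => β.wireObj f (c i)) id fun i => congrArg f.obj (hw (c i))) c d =
      both J (fun i => h.wire (c i)) (fun i => h.wire (d i)) ≫
        (circ id (fun i => congrArg f.obj (hw (c i))) ⊗ₘ
          circ id (fun i => congrArg f.obj (hw (d i)))) := by
    intro m n c d
    rw [both, Category.assoc, GSMon.comp_pair, circ_comp, circ_comp,
      ← hJ.natural.comp_pair (x := fun i => h.wire (Fin.append c d i)) (g := Fin.castAdd n)
        (g' := Fin.natAdd m) (fun i => by simp) (fun i => by simp)
        (fun i => by simp) (fun i => by simp), Category.assoc, pair_tensor, circ_comp, circ_comp]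
    rfl
  refine ⟨?_, ?_⟩
  · intro m n c c' g e _
    change (J (fun i => h.wire (c i)) ≫ circ _ _) ≫ circ g _ = J (fun i => h.wire (c' i)) ≫ circ _ _
    rw [← hJ.natural (fun i => h.wire (c i)) (fun i => h.wire (c' i)) g
      (fun i => congrArg h.wire (e i)) (fun i => congrArg _ (congrArg h.wire (e i)))]
    simp only [Category.assoc, circ_comp]
    rfl
  · intro k l b n c hc
    have hm := hJ.markov (h.box b) (fun i => h.wire (c i)) fun i j hr' =>
      hc i j (hr b j _ (by rwa [h.wire_tgt]))
    have h₁ : ∀ i, α.wireObj f (α.G.src (h.box b) i) = β.wireObj f (β.G.src b i) := fun i => by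
      rw [← h.wire_src]; exact congrArg f.obj (hw _)
    have h₂ : ∀ i, α.wireObj f (α.G.tgt (h.box b) i) = β.wireObj f (β.G.tgt b i) := fun i => by
      rw [← h.wire_tgt]; exact congrArg f.obj (hw _)
    -- The codomain depends on the tuple, so the equality of tuples is substituted in a general form
    -- before it is used for `src` and `tgt`.
    have aux : ∀ {m : ℕ} (d d' : Fin m → α.G.W) (_ : d = d') {B : Fin m → C}
        (e : ∀ i, α.wireObj f (d i) = B i) (e' : ∀ i, α.wireObj f (d' i) = B i),
        both J (fun i => h.wire (c i)) d ≫
          (circ id (fun i => congrArg f.obj (hw (c i))) ⊗ₘ circ id e) =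
        both J (fun i => h.wire (c i)) d' ≫
          (circ id (fun i => congrArg f.obj (hw (c i))) ⊗ₘ circ id e') := by
      rintro m d _ rfl B e e'
      rfl
    have ht : both J (fun i => h.wire (c i)) (fun i => h.wire (β.G.tgt b i)) ≫
        (circ id (fun i => congrArg f.obj (hw (c i))) ⊗ₘ
          circ id (fun i => congrArg f.obj (hw (β.G.tgt b i)))) =
        both J (fun i => h.wire (c i)) (α.G.tgt (h.box b)) ≫
          (circ id (fun i => congrArg f.obj (hw (c i))) ⊗ₘ circ id h₂) :=
      aux _ _ (funext (h.wire_tgt b)) _ _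
    have hs : both J (fun i => h.wire (c i)) (fun i => h.wire (β.G.src b i)) ≫
        (circ id (fun i => congrArg f.obj (hw (c i))) ⊗ₘ
          circ id (fun i => congrArg f.obj (hw (β.G.src b i)))) =
        both J (fun i => h.wire (c i)) (α.G.src (h.box b)) ≫
          (circ id (fun i => congrArg f.obj (hw (c i))) ⊗ₘ circ id h₁) :=
      aux _ _ (funext (h.wire_src b)) _ _
    rw [hboth, hboth, ht, hs, hm, Category.assoc, Category.assoc, ← id_tensorHom,
      tensorHom_comp_tensorHom, ← id_tensorHom, tensorHom_comp_tensorHom, Category.id_comp,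
      Category.comp_id, boxMor_map h b (hb b)]

end Pullback

/-! ### Interpretation of string diagrams -/

/-- The Markov property with the empty tuple of spectators, followed by the projection away from it.
-/
theorem MarkovAt.single {α : Cospan X Y}
    {J : ∀ ⦃n : ℕ⦄ (c : Fin n → α.G.W), V ⟶ tensorPow fun i => α.wireObj f (c i)}
    (hJ : Natural (α.wireObj f) J) {k l : ℕ} {b : α.G.B k l} (hb : α.MarkovAt f J b) :
    J (α.G.tgt b) = J (α.G.src b) ≫ α.boxMor f b := by
  have h : ∀ {n} (d : Fin n → α.G.W), both J (Fin.elim0 : Fin 0 → α.G.W) d ≫ psnd _ _ = J d := by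
    intro n d
    rw [both, Category.assoc, pair_snd]
    exact hJ _ _ _ (fun i => Fin.append_right ..) _
  rw [← h, hb _ fun i => i.elim0, Category.assoc, ← id_tensorHom, tensor_snd, ← h, Category.assoc]

variable (f)

/-- The interpretation of an object of the free Markov category. -/
abbrev _root_.GSMon.FreeMarkov.evalObj (X : FreeMarkov S) : C :=
  tensorPow fun i => f.obj (X.label i)

/-- The identification of the interpretation of the source of a string diagram with that of its
left interface. -/
abbrev leftMor (α : Cospan X Y) : X.evalObj f ⟶ tensorPow fun i => α.wireObj f (α.left i) :=
  circ id fun i => congrArg f.obj (α.lab_left i).symm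

/-- The identification of the interpretation of the right interface of a string diagram with that
of its target. -/
abbrev rightMor (α : Cospan X Y) : (tensorPow fun i => α.wireObj f (α.right i)) ⟶ Y.evalObj f :=
  circ id fun i => congrArg f.obj (α.lab_right i)

theorem exists_canonical_state (α : Cospan X Y) (hα : α.IsStringDiagram) :
    ∃ J : ∀ ⦃n : ℕ⦄ (c : Fin n → α.G.W), X.evalObj f ⟶ tensorPow fun i => α.wireObj f (c i),
      α.IsState f J ∧ J α.left = α.leftMor f :=
  exists_state f _ α hα rfl _

/-- The interpretation of a string diagram as a morphism of a Markov category. -/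
noncomputable def eval (α : Cospan X Y) (hα : α.IsStringDiagram) : X.evalObj f ⟶ Y.evalObj f :=
  (exists_canonical_state f α hα).choose α.right ≫ α.rightMor f

variable {f}

/-- By uniqueness, `J` is the canonical state precomposed with `s`. The freedom in `s` is needed for
composition, where the state of the second factor has the source of the first as its domain. -/
theorem IsState.comp_eval {α : Cospan X Y} (hα : α.IsStringDiagram)
    {J : ∀ ⦃n : ℕ⦄ (c : Fin n → α.G.W), V ⟶ tensorPow fun i => α.wireObj f (c i)}
    (hJ : α.IsState f J) (s : V ⟶ X.evalObj f) (h : J α.left = s ≫ α.leftMor f) :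
    s ≫ α.eval f hα = J α.right ≫ α.rightMor f := by
  obtain ⟨hK, hs⟩ := (exists_canonical_state f α hα).choose_spec
  rw [eval, ← Category.assoc]
  congr 1
  refine (hK.comp s).ext hα hJ ?_ _
  rw [h, hs]

theorem IsState.eval_eq {α : Cospan X Y} (hα : α.IsStringDiagram)
    {J : ∀ ⦃n : ℕ⦄ (c : Fin n → α.G.W), X.evalObj f ⟶ tensorPow fun i => α.wireObj f (c i)}
    (hJ : α.IsState f J) (h : J α.left = α.leftMor f) :
    α.eval f hα = J α.right ≫ α.rightMor f := by
  rw [← hJ.comp_eval hα (𝟙 _) (by rw [h, Category.id_comp]), Category.id_comp]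

/-- Hypothesis `hr` says that each box with an output in the image of `φ` lies in the image. Paths
that end in the image can then be traced backwards, so the state of `α` pulls back to `β`. This
covers isomorphisms and the inclusion of a normalization. -/
theorem eval_map {α β : Cospan X Y} (hα : α.IsStringDiagram) (hβ : β.IsStringDiagram)
    (φ : Map β α) (hφ : ∀ k l, (φ.box (k := k) (l := l)).Injective)
    (hr : ∀ (b : α.G.Box) (j : Fin b.2.1) (w : β.G.W), α.G.tgt b.2.2 j = φ.wire w →
      ∃ b' : β.G.B b.1 b.2.1, φ.box b' = b.2.2) : β.eval f hβ = α.eval f hα := by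
  have hi := φ.wire_injective hβ hα hφ
  obtain ⟨J, hJ, hs⟩ := exists_canonical_state f α hα
  have hJ' := hJ.pullback φ.toHom φ.lab_wire (fun _ _ => φ.lab_box) fun k l b j w h => by
    refine reach_of_backward φ.wire hi (fun x w' h => ?_) h
    obtain ⟨b, ⟨i, rfl⟩, ⟨j, e⟩⟩ := Hypergraph.step_iff.1 h
    obtain ⟨k, l, b⟩ := b
    obtain ⟨b', hb'⟩ : ∃ b' : β.G.B k l, φ.box b' = b := hr ⟨k, l, b⟩ j w' e
    subst hb'
    refine ⟨β.G.src b' i, φ.wire_src b' i, ?_⟩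
    rw [← hi ((φ.wire_tgt b' j).trans e)]
    exact step_of b' i j
  rw [hJ'.eval_eq hβ, hJ.eval_eq hα hs, Category.assoc, circ_comp]
  · have : ∀ {n : ℕ} (c c' : Fin n → α.G.W) (e : c = c') (g : Fin n → C)
        (h₁ : ∀ i, α.wireObj f (c i) = g i) (h₂ : ∀ i, α.wireObj f (c' i) = g i),
        J c ≫ circ id h₁ = J c' ≫ circ id h₂ := by
      rintro n c c' rfl g h₁ h₂
      rfl
    exact this _ _ (funext φ.map_right) _ _ _
  · rw [← hJ.natural α.left _ id (fun i => (φ.map_left i).symm)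
      (fun i => congrArg _ (φ.map_left i).symm), hs, circ_comp, circ_comp]
    rfl

theorem eval_isomorphic {α β : Cospan X Y} (hα : α.IsStringDiagram) (hβ : β.IsStringDiagram)
    (h : β.Isomorphic α) : β.eval f hβ = α.eval f hα := by
  obtain ⟨φ, -, hφ⟩ := h
  exact eval_map hα hβ φ (fun k l => (hφ k l).1) fun b _ _ _ => (hφ b.1 b.2.1).2 b.2.2

/-- A kept wire is not an output of a removed box, which is what `eval_map` requires. Naturality of
discarding, on which normalization depends, is already built into the existence of states. -/
theorem eval_norm (α : Cospan X Y) (hα : α.IsStringDiagram) :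
    (α.norm hα).eval f (norm_isStringDiagram α hα) = α.eval f hα :=
  eval_map hα _ (α.normIncl hα) (fun _ _ => Subtype.val_injective) fun b j w e =>
    ⟨⟨b.2.2, fun hb => kept_iff.1 w.2 b hb j e⟩, rfl⟩

theorem eval_circuit (g : Fin Y.n → Fin X.n) (hg : ∀ i, X.label (g i) = Y.label i) :
    (circuit g hg).eval f (circuit_isStringDiagram g hg) =
      circ g fun i => congrArg f.obj (hg i) := by
  have hJ : (circuit g hg).IsState f fun _ c =>
      circ (A := fun i => f.obj (X.label i)) (A' := fun i => (circuit g hg).wireObj f (c i)) c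
        fun _ => rfl := by
    refine ⟨fun m n c c' g' e _ => ?_, fun _ _ b => b.elim⟩
    exact (circ_comp ..).trans (circ_congr e)
  exact (hJ.eval_eq _ rfl).trans (circ_comp ..)

theorem IsState.congr {α : Cospan X Y}
    {J J' : ∀ ⦃n : ℕ⦄ (c : Fin n → α.G.W), V ⟶ tensorPow fun i => α.wireObj f (c i)}
    (hJ : α.IsState f J) (h : ∀ ⦃n : ℕ⦄ (c : Fin n → α.G.W), J c = J' c) : α.IsState f J' := by
  obtain rfl : J = J' := by
    funext n c
    exact h c
  exact hJ

/-- Replaces the relabelled family of `IsState.pullback` by an equal one, for morphisms that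
preserve labels definitionally and make the relabelling an identity. -/
theorem IsState.pullback_of_lab_eq {α : Cospan X Y} {β : Cospan X' Y'}
    {J : ∀ ⦃n : ℕ⦄ (c : Fin n → α.G.W), V ⟶ tensorPow fun i => α.wireObj f (c i)}
    {J' : ∀ ⦃n : ℕ⦄ (c : Fin n → β.G.W), V ⟶ tensorPow fun i => β.wireObj f (c i)}
    (hJ : α.IsState f J) (h : Hypergraph.Hom β.G α.G)
    (hw : ∀ w, α.lab.wire (h.wire w) = β.lab.wire w)
    (hb : ∀ ⦃k l : ℕ⦄ (b : β.G.B k l), α.lab.box (h.box b) = β.lab.box b)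
    (hJ' : ∀ ⦃n : ℕ⦄ (c : Fin n → β.G.W), J (fun i => h.wire (c i)) ≫
      circ (A' := fun i => β.wireObj f (c i)) id (fun i => congrArg f.obj (hw (c i))) = J' c)
    (hr : ∀ ⦃k l : ℕ⦄ (b : β.G.B k l) (j : Fin l) (w : β.G.W),
      α.Reach (h.wire (β.G.tgt b j)) (h.wire w) → β.Reach (β.G.tgt b j) w) :
    β.IsState f J' :=
  (hJ.pullback h hw hb hr).congr hJ'

/-- The state of the composite restricts to states of both factors. The first restriction computes
`α.eval`. Along the glued wires the second one starts with the value of the first at its right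
interface, so `IsState.comp_eval` yields the composite. -/
theorem eval_comp {α : Cospan X Y} {β : Cospan Y Z} (hα : α.IsStringDiagram)
    (hβ : β.IsStringDiagram) :
    (α.comp β).eval f (comp_isStringDiagram hβ hα) = α.eval f hα ≫ β.eval f hβ := by
  obtain ⟨J, hJ, hs⟩ := exists_canonical_state f (α.comp β) (comp_isStringDiagram hβ hα)
  let hl : Hypergraph.Hom α.G (α.comp β).G :=
    { wire := wl α β
      box := Sum.inl
      wire_src := fun _ _ => rfl
      wire_tgt := fun _ _ => rfl }
  let hr : Hypergraph.Hom β.G (α.comp β).G :=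
    { wire := wr α β
      box := Sum.inr
      wire_src := fun _ _ => rfl
      wire_tgt := fun _ _ => rfl }
  have hJl := hJ.pullback_of_lab_eq (β := α) (J' := fun _ c => J fun i => wl α β (c i)) hl
      (fun _ => rfl) (fun _ _ _ => rfl)
      (fun _ _ => (congrArg _ (circ_id _)).trans (Category.comp_id _)) fun k l b j w h => by
    -- Outputs of boxes of `β` are not wires of `α`, so a path that ends in `α` stays in `α`.
    refine reach_of_backward (wl α β) (wl_injective hβ) (fun x w' h => ?_) h
    obtain ⟨⟨k, l, b | b⟩, ⟨i, rfl⟩, ⟨j, e⟩⟩ := Hypergraph.step_iff.1 h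
    · refine ⟨α.G.src b i, rfl, ?_⟩
      rw [← wl_injective hβ (a₁ := α.G.tgt b j) e]
      exact step_of b i j
    · obtain ⟨x, -, e'⟩ := glue_of_eq hβ (w' := β.G.tgt b j) e.symm
      exact (hβ.left_ne_tgt _ _ _ e').elim
  have hJr := hJ.pullback_of_lab_eq (β := β) (J' := fun _ c => J fun i => wr α β (c i)) hr
      (fun _ => rfl) (fun _ _ _ => rfl)
      (fun _ _ => (congrArg _ (circ_id _)).trans (Category.comp_id _)) fun k l b j w h => by
    -- A wire that is an output of a box of `β` enters only boxes of `β`, and the outputs of these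
    -- are again of this kind.
    have hs : ∀ w x, (∃ (b : β.G.Box) (j : Fin b.2.1), w = β.G.tgt b.2.2 j) →
        (α.comp β).G.Step (wr α β w) x →
        ∃ w', (∃ (b : β.G.Box) (j : Fin b.2.1), w' = β.G.tgt b.2.2 j) ∧
          wr α β w' = x ∧ β.G.Step w w' := by
      rintro _ x ⟨b, j, rfl⟩ h
      obtain ⟨⟨k', l', b' | b'⟩, ⟨i, e⟩, ⟨j', rfl⟩⟩ := Hypergraph.step_iff.1 h
      · obtain ⟨x, -, e'⟩ := glue_of_eq hβ (w := α.G.src b' i) (w' := β.G.tgt b.2.2 j) e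
        exact (hβ.left_ne_tgt _ _ _ e').elim
      · refine ⟨β.G.tgt b' j', ⟨⟨k', l', b'⟩, j', rfl⟩, rfl, ?_⟩
        rw [← eq_of_wr_eq hβ (w := β.G.src b' i) e]
        exact step_of b' i j'
    obtain ⟨_, ⟨b', j', rfl⟩, e, h'⟩ := reach_forward (wr α β) _ hs ⟨⟨k, l, b⟩, j, rfl⟩ h
    rwa [eq_of_wr_eq hβ (w := w) e.symm]
  have h₁ := hJl.eval_eq hα hs
  have h₂ := hJr.comp_eval hβ (α.eval f hα) (by
    rw [h₁]
    refine Eq.trans ?_ (Category.assoc ..).symm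
    refine Eq.trans ?_ (congrArg _ (circ_comp ..).symm)
    exact (hJ.natural _ _ id (glue α β) _).symm)
  exact (hJ.eval_eq _ hs).trans h₂.symm

end Cospan

end Eval


/-! ### Interpretation of tensor products of string diagrams -/

section Joint

variable {C : Type u₁} [Category.{v₁} C] [MonoidalCategory C] [MarkovCategory C]
variable {W : Type} {A : W → C} {Z : C}
variable {J : ∀ ⦃n : ℕ⦄ (c : Fin n → W), Z ⟶ tensorPow fun i => A (c i)} {l m n : ℕ}

theorem Natural.both_braiding (hJ : Natural A J) (c : Fin m → W) (d : Fin n → W) :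
    both J c d ≫ (β_ _ _).hom = both J d c := by
  rw [both, Category.assoc, pair_braiding]
  exact hJ.comp_pair (fun i => by simp) (fun i => by simp) _ _

theorem Natural.both_split (hJ : Natural A J) (c : Fin l → W) {x : Fin (m + n) → W}
    {d : Fin m → W} {e : Fin n → W} (h : ∀ i, x (Fin.castAdd n i) = d i)
    (h' : ∀ i, x (Fin.natAdd m i) = e i) (h₁ : ∀ i, A (x (Fin.castAdd n i)) = A (d i))
    (h₂ : ∀ i, A (x (Fin.natAdd m i)) = A (e i)) :
    both J c x ≫ _ ◁ pair (circ (Fin.castAdd n) h₁) (circ (Fin.natAdd m) h₂) =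
      triple J c d e ≫ (α_ _ _ _).hom := by
  have := hJ.comp_triple (x := Fin.append c x) (c := c) (d := d) (y := e) (g := Fin.castAdd _)
    (g' := fun i => Fin.natAdd l (Fin.castAdd n i)) (g'' := fun i => Fin.natAdd l (Fin.natAdd m i))
    (fun i => by simp) (fun i => (Fin.append_right ..).trans (h i))
    (fun i => (Fin.append_right ..).trans (h' i)) (fun i => by simp)
    (fun i => congrArg A ((Fin.append_right ..).trans (h i)))
    (fun i => congrArg A ((Fin.append_right ..).trans (h' i)))
  rw [← this, both, Category.assoc, Category.assoc, pair_whiskerLeft, GSMon.comp_pair (circ _ _),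
    circ_comp, circ_comp, pair_associator]

end Joint

section Tensor

variable {C : Type u₁} [Category.{v₁} C] [MonoidalCategory C] [MarkovCategory C]
variable {S : Hypergraph.{u, v}} {X Y X' Y' : FreeMarkov S} {f : Hypergraph.Hom S (hyp C)}
  {V V' T : C}

namespace Cospan

/-- Two joint interpretations agree, in the presence of a spectator `T`, if they agree on the left
interface. -/
theorem IsState.ext_spectator {α : Cospan X Y} (hα : α.IsStringDiagram)
    {K : ∀ ⦃n : ℕ⦄ (c : Fin n → α.G.W), V ⟶ tensorPow fun i => α.wireObj f (c i)}
    (hK : α.IsState f K)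
    {J : ∀ ⦃n : ℕ⦄ (c : Fin n → α.G.W), V' ⟶ T ⊗ tensorPow fun i => α.wireObj f (c i)}
    (hn : ∀ ⦃m n : ℕ⦄ (c : Fin m → α.G.W) (g : Fin n → Fin m),
      J c ≫ T ◁ circ g (fun _ => rfl) = J fun i => c (g i))
    (hm : ∀ ⦃k l n : ℕ⦄ (b : α.G.B k l) (c : Fin n → α.G.W),
      (∀ i j, ¬ α.Reach (α.G.tgt b j) (c i)) →
      J (Fin.append c (α.G.tgt b)) ≫ T ◁ pair
        (circ (Fin.castAdd l) (append_castAdd_label c _))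
        (circ (Fin.natAdd n) (append_natAdd_label c _)) =
      J (Fin.append c (α.G.src b)) ≫ T ◁ (pair
        (circ (Fin.castAdd k) (append_castAdd_label c _))
        (circ (Fin.natAdd n) (append_natAdd_label c _)) ≫ _ ◁ α.boxMor f b))
    (s : V' ⟶ T ⊗ V) (hs : J α.left = s ≫ T ◁ K α.left) {n : ℕ} (c : Fin n → α.G.W) :
    J c = s ≫ T ◁ K c := by
  refine tuple_induction hα Set.univ (fun b j _ => ⟨fun _ => trivial, fun _ => trivial⟩)
    (Q := fun c => J c = s ≫ T ◁ K c) hs ?_ ?_ c fun _ => trivial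
  · intro m n c g h
    rw [← hn, h, ← hK.natural c _ g (fun _ => rfl) fun _ => rfl, Category.assoc,
      whiskerLeft_comp]
  · intro k l n b c _ _ _ _ hc h
    have h₁ := congrArg (· ≫ T ◁ join (D := fun i => α.wireObj f (Fin.append c (α.G.tgt b) i))
      (append_castAdd_label c (α.G.tgt b)) (append_natAdd_label c (α.G.tgt b))) (hm b c hc)
    simp only [Category.assoc, ← whiskerLeft_comp, split_join] at h₁
    rw [whiskerLeft_id, Category.comp_id] at h₁
    have h₂ := hK.markov b c hc
    have h₃ := both_join (J := K) c (α.G.tgt b)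
    rw [h₁, h, ← h₃, h₂, Category.assoc, ← whiskerLeft_comp]
    simp only [both, Category.assoc]

/-- Brings the Markov property with two groups of spectators into the form required by
`IsState.ext_spectator`: the wires `c` make up the fixed factor `T`, while `d` varies. -/
theorem MarkovAt.both_split {α : Cospan X Y}
    {J : ∀ ⦃n : ℕ⦄ (c : Fin n → α.G.W), V ⟶ tensorPow fun i => α.wireObj f (c i)}
    (hJ : Natural (α.wireObj f) J) {k l m n : ℕ} {b : α.G.B k l} (hb : α.MarkovAt f J b)
    (c : Fin m → α.G.W) (d : Fin n → α.G.W) (hc : ∀ i j, ¬ α.Reach (α.G.tgt b j) (c i))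
    (hd : ∀ i j, ¬ α.Reach (α.G.tgt b j) (d i)) {x : Fin (n + l) → α.G.W} {y : Fin (n + k) → α.G.W}
    (h₁ : ∀ i, x (Fin.castAdd l i) = d i) (h₂ : ∀ i, x (Fin.natAdd n i) = α.G.tgt b i)
    (h₁' : ∀ i, y (Fin.castAdd k i) = d i) (h₂' : ∀ i, y (Fin.natAdd n i) = α.G.src b i) :
    both J c x ≫ _ ◁ pair
        (circ (Fin.castAdd l) fun i => congrArg (α.wireObj f) (h₁ i))
        (circ (Fin.natAdd n) fun i => congrArg (α.wireObj f) (h₂ i)) =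
      both J c y ≫ _ ◁ (pair
        (circ (Fin.castAdd k) fun i => congrArg (α.wireObj f) (h₁' i))
        (circ (Fin.natAdd n) fun i => congrArg (α.wireObj f) (h₂' i)) ≫ _ ◁ α.boxMor f b) := by
  rw [whiskerLeft_comp, ← Category.assoc, hJ.both_split c h₁ h₂, hJ.both_split c h₁' h₂',
    hb.triple c d hc hd]
  simp

/-- The identification of the interpretation of a tensor product with the tensor product of the
interpretations. -/
abbrev _root_.GSMon.FreeMarkov.split (f : Hypergraph.Hom S (hyp C)) (X Y : FreeMarkov S) :
    (X.tensor Y).evalObj f ⟶ X.evalObj f ⊗ Y.evalObj f :=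
  pair (circ (Fin.castAdd Y.n) fun i => congrArg f.obj (FreeMarkov.tensor_label_castAdd X Y i))
    (circ (Fin.natAdd X.n) fun i => congrArg f.obj (FreeMarkov.tensor_label_natAdd X Y i))

variable {α : Cospan X Y} {β : Cospan X' Y'}

theorem reach_tensor_inl {w : α.G.W} {x : (tensor α β).G.W}
    (h : (tensor α β).Reach (Sum.inl w) x) : ∃ w', Sum.inl w' = x ∧ α.Reach w w' := by
  obtain ⟨w', -, e, h⟩ := reach_forward (α := tensor α β) (β := α) Sum.inl (fun _ => True)
    (fun w x _ h => by
      obtain ⟨⟨k, l, b | b⟩, ⟨i, e⟩, ⟨j, rfl⟩⟩ := Hypergraph.step_iff.1 h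
      · refine ⟨α.G.tgt b j, trivial, rfl, ?_⟩
        rw [← (Sum.inl.inj e : α.G.src b i = w)]
        exact step_of b i j
      · cases e) trivial h
  exact ⟨w', e, h⟩

theorem reach_tensor_inr {w : β.G.W} {x : (tensor α β).G.W}
    (h : (tensor α β).Reach (Sum.inr w) x) : ∃ w', Sum.inr w' = x ∧ β.Reach w w' := by
  obtain ⟨w', -, e, h⟩ := reach_forward (α := tensor α β) (β := β) Sum.inr (fun _ => True)
    (fun w x _ h => by
      obtain ⟨⟨k, l, b | b⟩, ⟨i, e⟩, ⟨j, rfl⟩⟩ := Hypergraph.step_iff.1 h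
      · cases e
      · refine ⟨β.G.tgt b j, trivial, rfl, ?_⟩
        rw [← (Sum.inr.inj e : β.G.src b i = w)]
        exact step_of b i j) trivial h
  exact ⟨w', e, h⟩

/-- In a disjoint union no wire of one factor is reachable from the other, so any wires of one
factor are admissible spectators for the boxes of the other. The state of the union is computed from
left interfaces to right interfaces by traversing `α` first and `β` afterwards. Braidings put the
current spectators in first position. -/
theorem eval_tensor (hα : α.IsStringDiagram) (hβ : β.IsStringDiagram) :
    (α.tensor β).eval f (tensor_isStringDiagram hα hβ) ≫ FreeMarkov.split f Y Y' =
      FreeMarkov.split f X X' ≫ (α.eval f hα ⊗ₘ β.eval f hβ) := by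
  obtain ⟨J, hJ, hs⟩ := exists_canonical_state f (α.tensor β) (tensor_isStringDiagram hα hβ)
  obtain ⟨K, hK, hKs⟩ := exists_canonical_state f α hα
  obtain ⟨L, hL, hLs⟩ := exists_canonical_state f β hβ
  rw [hJ.eval_eq _ hs, hK.eval_eq _ hKs, hL.eval_eq _ hLs]
  have aux₁ : ∀ {T A A' B B' : C} (s : T ⟶ A ⊗ B) (a : A ⟶ A') (b : B ⟶ B'),
      (s ≫ (a ⊗ₘ b)) ≫ (β_ A' B').hom = (s ≫ (β_ A B).hom ≫ b ▷ A) ≫ B' ◁ a := by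
    intros
    simp [MonoidalCategory.tensorHom_def']
  have aux₂ : ∀ {T A A' B B' : C} (s : T ⟶ A ⊗ B) (a : A ⟶ A') (b : B ⟶ B'),
      ((s ≫ (β_ A B).hom ≫ b ▷ A) ≫ B' ◁ a) ≫ (β_ B' A').hom = (s ≫ a ▷ B) ≫ A' ◁ b := by
    intros
    simp [whisker_exchange]
  have aux₃ : ∀ {T A A' A'' B B' B'' : C} (s : T ⟶ A ⊗ B) (a : A ⟶ A') (b : B ⟶ B')
      (a' : A' ⟶ A'') (b' : B' ⟶ B''),
      ((s ≫ a ▷ B) ≫ A' ◁ b) ≫ (a' ⊗ₘ b') = s ≫ (a ≫ a' ⊗ₘ b ≫ b') := by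
    intro T A A' A'' B B' B'' s a b a' b'
    rw [← tensorHom_comp_tensorHom, MonoidalCategory.tensorHom_def a b]
    simp only [Category.assoc]
  let inl : α.G.W → (tensor α β).G.W := Sum.inl
  let inr : β.G.W → (tensor α β).G.W := Sum.inr
  have h₀ : both J (fun i => inl (α.left i)) (fun i => inr (β.left i)) =
      FreeMarkov.split f X X' ≫ (α.leftMor f ⊗ₘ β.leftMor f) := by
    rw [← hJ.natural.comp_pair (x := (tensor α β).left) (fun i => tensor_left_castAdd α β i)
      (fun i => tensor_left_natAdd α β i) (fun i => congrArg _ (tensor_left_castAdd α β i))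
      (fun i => congrArg _ (tensor_left_natAdd α β i)), hs, GSMon.comp_pair (circ _ _),
      circ_comp, circ_comp, pair_tensor, circ_comp, circ_comp]
    rfl
  -- Traverse `α`, with the left interface of `β` as spectator.
  have h₁ : ∀ {n : ℕ} (c : Fin n → α.G.W),
      both J (fun i => inr (β.left i)) (fun i => inl (c i)) =
        (FreeMarkov.split f X X' ≫ (β_ _ _).hom ≫ β.leftMor f ▷ _) ≫ _ ◁ K c := by
    intro n c
    refine hK.ext_spectator hα (J := fun _ c => both J (fun i => inr (β.left i))
      (fun i => inl (c i))) ?_ ?_ _ ?_ c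
    · intro m n c g
      exact hJ.natural.both_map_right (fun _ => rfl) _
    · intro k l n b c hc
      refine (hJ.markov (k := k) (l := l) (Sum.inl b)).both_split hJ.natural _
        (fun i => inl (c i)) ?_ ?_ ?_ ?_ ?_ ?_
      · intro i j h
        obtain ⟨_, ⟨⟩, -⟩ := reach_tensor_inl h
      · intro i j h
        obtain ⟨w, e, h⟩ := reach_tensor_inl h
        cases e
        exact hc i j h
      · exact fun i => congrArg inl (Fin.append_left ..)
      · exact fun i => congrArg inl (Fin.append_right ..)
      · exact fun i => congrArg inl (Fin.append_left ..)
      · exact fun i => congrArg inl (Fin.append_right ..)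
    · have := hJ.natural.both_braiding (fun i => inl (α.left i)) (fun i => inr (β.left i))
      refine this.symm.trans ?_
      rw [h₀, hKs]
      exact aux₁ ..
  -- Traverse `β`, with the right interface of `α` as spectator; the starting value is the case `c =
  -- α.right` of `h₁`.
  have h₂ : ∀ {n : ℕ} (c : Fin n → β.G.W),
      both J (fun i => inl (α.right i)) (fun i => inr (c i)) =
        (FreeMarkov.split f X X' ≫ K α.right ▷ _) ≫ _ ◁ L c := by
    intro n c
    refine hL.ext_spectator hβ (J := fun _ c => both J (fun i => inl (α.right i))
      (fun i => inr (c i))) ?_ ?_ _ ?_ c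
    · intro m n c g
      exact hJ.natural.both_map_right (fun _ => rfl) _
    · intro k l n b c hc
      refine (hJ.markov (k := k) (l := l) (Sum.inr b)).both_split hJ.natural _
        (fun i => inr (c i)) ?_ ?_ ?_ ?_ ?_ ?_
      · intro i j h
        obtain ⟨_, ⟨⟩, -⟩ := reach_tensor_inr h
      · intro i j h
        obtain ⟨w, e, h⟩ := reach_tensor_inr h
        cases e
        exact hc i j h
      · exact fun i => congrArg inr (Fin.append_left ..)
      · exact fun i => congrArg inr (Fin.append_right ..)
      · exact fun i => congrArg inr (Fin.append_left ..)
      · exact fun i => congrArg inr (Fin.append_right ..)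
    · have := hJ.natural.both_braiding (fun i => inr (β.left i)) (fun i => inl (α.right i))
      refine this.symm.trans ?_
      rw [h₁, hLs]
      exact aux₂ ..
  have h₃ : (J (tensor α β).right ≫ (tensor α β).rightMor f) ≫ FreeMarkov.split f Y Y' =
      both J (fun i => inl (α.right i)) (fun i => inr (β.right i)) ≫
        (α.rightMor f ⊗ₘ β.rightMor f) := by
    rw [← hJ.natural.comp_pair (x := (tensor α β).right) (fun i => tensor_right_castAdd α β i)
      (fun i => tensor_right_natAdd α β i) (fun i => congrArg _ (tensor_right_castAdd α β i))
      (fun i => congrArg _ (tensor_right_natAdd α β i)), Category.assoc, Category.assoc,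
      GSMon.comp_pair (circ _ _), circ_comp, circ_comp]
    refine congrArg _ (Eq.trans ?_ (pair_tensor ..).symm)
    refine Eq.trans ?_ (congrArg₂ pair (circ_comp ..) (circ_comp ..)).symm
    rfl
  rw [h₃, h₂]
  exact aux₃ ..

end Cospan

end Tensor


/-! ### Iterated tensor products in strict Markov categories -/

section Strict

open scoped ComonObj
open CopyDiscardCategory

variable {C : Type u₁} [Category.{v₁} C] [MonoidalCategory C]

theorem eqToHom_associator [IsStrictMonoidal C] (X : C) {Y Z T : C} (e : Y ⊗ Z = T) :
    eqToHom ((IsStrictMonoidal.tensor_assoc X Y Z).trans (congrArg (X ⊗ ·) e)) =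
      (α_ X Y Z).hom ≫ X ◁ eqToHom e := by
  subst e
  simp [IsStrictMonoidal.associator_hom]

variable [MarkovCategory C]

/-- Writing the identity as a nested pairing of projections turns the associator into a rebracketing
of that pairing. -/
theorem associator_fst (X Y Z : C) :
    (α_ X Y Z).hom ≫ pfst X (Y ⊗ Z) = pfst (X ⊗ Y) Z ≫ pfst X Y := by
  have h : 𝟙 ((X ⊗ Y) ⊗ Z) =
      pair (pair (pfst _ _ ≫ pfst _ _) (pfst _ _ ≫ psnd _ _)) (psnd _ _) := by
    rw [← comp_pair, pair_fst_snd, Category.comp_id, pair_fst_snd]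
  rw [← Category.id_comp (_ ≫ _), h, pair_associator_assoc, pair_fst]

theorem associator_snd (X Y Z : C) :
    (α_ X Y Z).hom ≫ psnd X (Y ⊗ Z) = psnd X Y ▷ Z := by
  have h : 𝟙 ((X ⊗ Y) ⊗ Z) =
      pair (pair (pfst _ _ ≫ pfst _ _) (pfst _ _ ≫ psnd _ _)) (psnd _ _) := by
    rw [← comp_pair, pair_fst_snd, Category.comp_id, pair_fst_snd]
  rw [← Category.id_comp (_ ≫ _), h, pair_associator_assoc, pair_snd,
    ← Category.id_comp (_ ▷ _), ← pair_fst_snd, pair_whiskerRight]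

theorem whiskerLeft_fst (X : C) {Y Z : C} (f : Y ⟶ Z) : X ◁ f ≫ pfst X Z = pfst X Y := by
  rw [← id_tensorHom, tensor_fst, Category.comp_id]

theorem whiskerLeft_snd (X : C) {Y Z : C} (f : Y ⟶ Z) : X ◁ f ≫ psnd X Z = psnd X Y ≫ f := by
  rw [← id_tensorHom, tensor_snd]

theorem whiskerRight_fst {X Y : C} (f : X ⟶ Y) (Z : C) : f ▷ Z ≫ pfst Y Z = pfst X Z ≫ f := by
  rw [← tensorHom_id, tensor_fst]

theorem whiskerRight_snd {X Y : C} (f : X ⟶ Y) (Z : C) : f ▷ Z ≫ psnd Y Z = psnd X Z := by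
  rw [← tensorHom_id, tensor_snd, Category.comp_id]

theorem unit_snd (X : C) : psnd (𝟙_ C) X = (λ_ X).hom := by
  rw [psnd, discard_unit, id_whiskerRight, Category.id_comp]

variable [IsStrictMonoidal C]

open IsStrictMonoidal

/-- In a strict category the associator is an `eqToHom`, so the equality for `k + 1` is an
associator followed by the whiskered equality for `k`, and its components can be computed. The
length is a variable `n` with `n = k + l`, since `k + 1 + l` is not a successor by definition. -/
theorem exists_tensorPow_append {l : ℕ} {A' : Fin l → C} :
    ∀ (k : ℕ) {n : ℕ} (hn : n = k + l) (D : Fin n → C)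
    (h' : ∀ i : Fin l, D ⟨k + i, by omega⟩ = A' i),
    ∃ e : tensorPow (fun i : Fin k => D ⟨i, by omega⟩) ⊗ tensorPow A' = tensorPow D,
      (∀ i : Fin k, eqToHom e ≫ proj D ⟨i, by omega⟩ =
        pfst _ _ ≫ proj (fun i : Fin k => D ⟨i, by omega⟩) i) ∧
      ∀ i : Fin l, eqToHom e ≫ proj D ⟨k + i, by omega⟩ ≫ eqToHom (h' i) = psnd _ _ ≫ proj A' i
  | 0, n, hn, D, h' => by
    obtain rfl : n = l := by omega
    obtain rfl : D = A' := funext fun i => by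
      rw [← h']
      congr 1
      exact Fin.ext (Nat.zero_add _).symm
    refine ⟨unit_tensor _, fun i => i.elim0, fun i => ?_⟩
    change eqToHom (unit_tensor (tensorPow D)) ≫ _ = psnd (𝟙_ C) (tensorPow D) ≫ _
    rw [← leftUnitor_hom, ← unit_snd, proj_congr (j := i) (Fin.ext (Nat.zero_add _)),
      eqToHom_refl, Category.comp_id]
  | k + 1, n, hn, D, h' => by
    obtain ⟨n, rfl⟩ : ∃ n', n = n' + 1 := ⟨k + l, by omega⟩
    obtain ⟨e, he, he'⟩ := exists_tensorPow_append k (n := n) (by omega) (fun i => D i.succ)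
      fun i => (congrArg D (Fin.ext (by simp; omega))).trans (h' i)
    have hE := eqToHom_associator (D 0) e
    refine ⟨(tensor_assoc _ _ _).trans (congrArg (D 0 ⊗ ·) e), fun i => ?_, fun i => ?_⟩
    · refine Fin.cases (motive := fun i => eqToHom _ ≫ proj D ⟨i, by omega⟩ = pfst _ _ ≫
        proj (fun i : Fin (k + 1) => D ⟨i, by omega⟩) i) ?_ (fun i => ?_) i
      · refine (congrArg (· ≫ pfst (D 0) (tensorPow fun i => D i.succ)) hE).trans ?_
        rw [Category.assoc, whiskerLeft_fst, associator_fst]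
        rfl
      · refine (congrArg (· ≫ psnd (D 0) (tensorPow fun i => D i.succ) ≫
          proj (fun i => D i.succ) ⟨i, _⟩) hE).trans ?_
        rw [Category.assoc, ← Category.assoc (_ ◁ _), whiskerLeft_snd, Category.assoc, he i,
          ← Category.assoc, associator_snd, ← Category.assoc, whiskerRight_fst, Category.assoc]
        rfl
    · have hi : (⟨k + 1 + i, by omega⟩ : Fin (n + 1)) = Fin.succ ⟨k + i, by omega⟩ :=
        Fin.ext (by simp; omega)
      rw [proj_congr hi]
      refine (congrArg (· ≫ (psnd (D 0) (tensorPow fun i => D i.succ) ≫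
          proj (fun i => D i.succ) ⟨k + i, _⟩) ≫ eqToHom _) hE).trans ?_
      rw [Category.assoc, Category.assoc, ← Category.assoc (_ ◁ _), whiskerLeft_snd, Category.assoc,
        he' i, ← Category.assoc, associator_snd, ← Category.assoc]
      exact congrArg (· ≫ _) (whiskerRight_snd _ _)

/-- Both `join` and `eqToHom` are deterministic, so it suffices that their components agree. -/
theorem exists_join_eq_eqToHom {k l : ℕ} {A : Fin k → C} {A' : Fin l → C} {D : Fin (k + l) → C}
    (h : ∀ i, D (Fin.castAdd l i) = A i) (h' : ∀ i, D (Fin.natAdd k i) = A' i) :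
    ∃ e : tensorPow A ⊗ tensorPow A' = tensorPow D, join h h' = eqToHom e := by
  obtain rfl : (fun i => D (Fin.castAdd l i)) = A := funext h
  obtain ⟨e, he, he'⟩ := exists_tensorPow_append k rfl D h'
  refine ⟨e, det_tensorPow_ext (Fin.addCases (fun i => ?_) (fun i => ?_))⟩
  · rw [join_proj_castAdd]
    exact (congrArg _ (Category.comp_id _)).trans (he i).symm
  · refine (join_proj_natAdd ..).trans ((Category.assoc ..).symm.trans
      ((congrArg (· ≫ _) (he' i).symm).trans ?_))
    simp
    rfl

end Strict


/-! ### The functor induced by a morphism of hypergraphs -/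

section Lift

open scoped ComonObj
open CopyDiscardCategory

variable {C : Type u₁} [Category.{v₁} C] [MonoidalCategory C] [MarkovCategory C]
variable {S : Hypergraph.{u, v}} (f : Hypergraph.Hom S (hyp C)) {X Y Z X' Y' : FreeMarkov S}

namespace FreeMarkov

/-- The interpretation of a morphism of the free Markov category. -/
noncomputable def evalMap (g : X ⟶ Y) : X.evalObj f ⟶ Y.evalObj f :=
  Quotient.lift (s := Cospan.setoid X Y) (fun α => α.1.eval f α.2.1)
    (fun α β h => Cospan.eval_isomorphic β.2.1 α.2.1 h) g

theorem evalMap_mk (α : Cospan X Y) (hα : α.IsStringDiagram) :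
    evalMap f (Hom.mk α hα) = α.eval f hα := Cospan.eval_norm α hα

theorem evalMap_circ (g : Fin Y.n → Fin X.n) (hg : ∀ i, X.label (g i) = Y.label i) :
    evalMap f (Hom.circ g hg) = circ g fun i => congrArg f.obj (hg i) := Cospan.eval_circuit g hg

theorem evalMap_id : evalMap f (𝟙 X) = 𝟙 _ := (evalMap_circ f id _).trans (circ_id _)

theorem evalMap_comp (g : X ⟶ Y) (h : Y ⟶ Z) :
    evalMap f (g ≫ h) = evalMap f g ≫ evalMap f h := by
  obtain ⟨α, hα, rfl⟩ := Hom.exists_mk g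
  obtain ⟨β, hβ, rfl⟩ := Hom.exists_mk h
  rw [comp_def, Hom.mk_comp, evalMap_mk, evalMap_mk, evalMap_mk, Cospan.eval_comp]

theorem evalMap_tensor (g : X ⟶ Y) (h : X' ⟶ Y') :
    evalMap f (g ⊗ₘ h) ≫ split f Y Y' = split f X X' ≫ (evalMap f g ⊗ₘ evalMap f h) := by
  obtain ⟨α, hα, rfl⟩ := Hom.exists_mk g
  obtain ⟨β, hβ, rfl⟩ := Hom.exists_mk h
  rw [tensorHom_def', Hom.mk_tensor, evalMap_mk, evalMap_mk, evalMap_mk]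
  exact Cospan.eval_tensor hα hβ

theorem evalMap_braiding (X Y : FreeMarkov S) :
    evalMap f (β_ X Y).hom ≫ split f Y X = split f X Y ≫ (β_ _ _).hom := by
  refine (congrArg (· ≫ _) (evalMap_circ (X := X.tensor Y) (Y := Y.tensor X) f _
    (swapE_label X Y))).trans ?_
  rw [pair_braiding, comp_pair, circ_comp, circ_comp]
  exact congrArg₂ pair (circ_congr fun i => swapE_castAdd i) (circ_congr fun i => swapE_natAdd i)

theorem evalMap_copy (X : FreeMarkov S) :
    evalMap f Δ[X] ≫ split f X X = Δ[X.evalObj f] := by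
  refine (congrArg (· ≫ _) (evalMap_circ (X := X) (Y := X.tensor X) f _ (dbl_label X))).trans ?_
  rw [comp_pair, circ_comp, circ_comp]
  have h : ∀ g : Fin X.n → Fin X.n, (∀ i, g i = i) → ∀ e : ∀ i, f.obj (X.label (g i)) =
      f.obj (X.label i), circ g e = 𝟙 (X.evalObj f) := by
    intro g hg e
    rw [circ_congr (g' := id) hg, circ_id]
  refine (congrArg₂ pair (h _ (fun i => dbl_castAdd i) _) (h _ (fun i => dbl_natAdd i) _)).trans ?_
  simp [pair]

variable [IsStrictMonoidal C]

theorem exists_split_eq_eqToHom (X Y : FreeMarkov S) :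
    ∃ e : (X.tensor Y).evalObj f = X.evalObj f ⊗ Y.evalObj f, split f X Y = eqToHom e := by
  obtain ⟨e, he⟩ := exists_join_eq_eqToHom (D := fun i => f.obj ((X.tensor Y).label i))
    (A := fun i => f.obj (X.label i)) (A' := fun i => f.obj (Y.label i))
    (fun i => congrArg f.obj (tensor_label_castAdd X Y i))
    fun i => congrArg f.obj (tensor_label_natAdd X Y i)
  refine ⟨e.symm, ?_⟩
  rw [← cancel_mono (eqToHom e), ← he, split_join, he]
  simp

/-- The strict gs-monoidal functor induced by a morphism of hypergraphs. -/
noncomputable def lift : StrictGSFunctor (FreeMarkov S) C where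
  obj X := X.evalObj f
  map g := evalMap f g
  map_id _ := evalMap_id f
  map_comp := evalMap_comp f
  obj_unit := rfl
  obj_tensor X Y := (exists_split_eq_eqToHom f X Y).1
  map_tensor {X Y X' Y'} g h := by
    rw [← (exists_split_eq_eqToHom f X X').2, ← Category.assoc, ← evalMap_tensor,
      (exists_split_eq_eqToHom f Y Y').2]
    simp
  map_braiding X Y := by
    rw [← (exists_split_eq_eqToHom f X Y).2, ← Category.assoc, ← evalMap_braiding,
      (exists_split_eq_eqToHom f Y X).2]
    simp
  map_copy X := by
    rw [← evalMap_copy, (exists_split_eq_eqToHom f X X).2]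
    simp
  map_del X := Subsingleton.elim (α := X.evalObj f ⟶ 𝟙_ C) _ _

end FreeMarkov

end Lift


/-! ### The induced functor restricts to the given hypergraph morphism -/

section Restrict

variable {C : Type u₁} [Category.{v₁} C] [MonoidalCategory C]

theorem hyp_box_ext {k l : ℕ} {A : Fin k → C} {A' : Fin l → C} {m : tensorPow A ⟶ tensorPow A'}
    {b : (hyp C).B k l} (h : A = b.1) (h' : A' = b.2.1)
    (hm : m = eqToHom (congrArg tensorPow h) ≫ hypMor b ≫ eqToHom (congrArg tensorPow h').symm) :
    (⟨A, A', m⟩ : (hyp C).B k l) = b := by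
  obtain ⟨B, B', m'⟩ := b
  obtain rfl : A = B := h
  obtain rfl : A' = B' := h'
  rw [hm]
  simp [hypMor]

namespace FreeMarkov

variable {S : Hypergraph.{u, v}}

theorem obj_src (f : Hypergraph.Hom S (hyp C)) {k l : ℕ} (b : S.B k l) :
    (fun i => f.obj (S.src b i)) = (show Fin k → C from (f.box b).1) := funext (f.wire_src b)

theorem obj_tgt (f : Hypergraph.Hom S (hyp C)) {k l : ℕ} (b : S.B k l) :
    (fun i => f.obj (S.tgt b i)) = (show Fin l → C from (f.box b).2.1) := funext (f.wire_tgt b)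

theorem restrict_box [CopyDiscardCategory C] (F : StrictGSFunctor (FreeMarkov S) C) {k l : ℕ}
    (b : S.B k l) :
    (restrict F).box b = (⟨fun i => F.obj (wireObj (S.src b i)),
      fun j => F.obj (wireObj (S.tgt b j)),
      eqToHom ((F.obj_tensorPow _).symm.trans (congrArg F.obj (tensorPow_wireObj _))) ≫
        F.map (gen b) ≫
        eqToHom ((congrArg F.obj (tensorPow_wireObj _).symm).trans (F.obj_tensorPow _))⟩ :
      (hyp C).B k l) := by
  refine congrArg (Sigma.mk _) (congrArg (Sigma.mk _) ?_)
  have h : ∀ {X Y X' Y' : FreeMarkov S} (hX : X' = X) (hY : Y = Y') (g : X ⟶ Y) {A A' : C}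
      (hA : A = F.obj X') (hA' : F.obj Y' = A'),
      eqToHom hA ≫ F.map (eqToHom hX ≫ g ≫ eqToHom hY) ≫ eqToHom hA' =
        eqToHom (hA.trans (congrArg F.obj hX)) ≫ F.map g ≫
          eqToHom ((congrArg F.obj hY).trans hA') := by
    rintro X Y _ _ rfl rfl g A A' hA hA'
    simp
  exact h ..

variable [MarkovCategory C] (f : Hypergraph.Hom S (hyp C))

/-- The state starts with the identity on the inputs of the only box, and the Markov property
without spectators gives its value on the outputs. -/
theorem eval_single {k l : ℕ} (b : S.B k l) :
    (single b).eval f (single_isStringDiagram b) = boxMor f b := by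
  obtain ⟨J, hJ, hs⟩ := Cospan.exists_canonical_state f (single b) (single_isStringDiagram b)
  rw [hJ.eval_eq _ hs]
  have h := (hJ.markov (SingleBox.box : (single b).G.B k l)).single hJ.natural
  have hs : J ((single b).G.src (SingleBox.box : (single b).G.B k l)) = 𝟙 _ := hs.trans (circ_id _)
  rw [hs] at h
  refine (congrArg₂ (· ≫ ·) h (circ_id _)).trans ((Category.comp_id _).trans
    ((Category.id_comp _).trans ?_))
  refine (congrArg₂ (fun x y => x ≫ boxMor f b ≫ y) (circ_id _) (circ_id _)).trans ?_
  exact (Category.id_comp _).trans (Category.comp_id _)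

theorem boxMor_eq {k l : ℕ} (b : S.B k l) :
    boxMor f b = eqToHom (congrArg tensorPow (obj_src f b)) ≫ hypMor (f.box b) ≫
      eqToHom (congrArg tensorPow (obj_tgt f b)).symm := by
  have h := circ_eqToHom (obj_src f b)
  have h' := circ_eqToHom (obj_tgt f b).symm
  rw [← h, ← h']
  rfl

variable [IsStrictMonoidal C]

theorem restrict_lift : restrict (lift f) = f := by
  -- A single wire is interpreted by `f.wire w ⊗ 𝟙_ C`; strictness removes the unit.
  have hw : ∀ w, (restrict (lift f)).wire w = f.wire w :=
    fun w => IsStrictMonoidal.tensor_unit (C := C) (f.wire w)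
  refine Hypergraph.Hom.ext (funext hw) ?_
  funext k l b
  rw [restrict_box]
  refine hyp_box_ext (funext fun i => (hw _).trans (f.wire_src b i))
    (funext fun i => (hw _).trans (f.wire_tgt b i)) ?_
  have hg : (lift f).map (gen b) = boxMor f b := (evalMap_mk f _ _).trans (eval_single f b)
  refine (congrArg (fun x => eqToHom _ ≫ x ≫ eqToHom _) (hg.trans (boxMor_eq f b))).trans ?_
  refine (congrArg (_ ≫ ·) ((Category.assoc ..).trans
    (congrArg (_ ≫ ·) (Category.assoc ..)))).trans ?_
  refine (eqToHom_trans_assoc ..).trans (congrArg (_ ≫ ·) (congrArg (_ ≫ ·) ?_))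
  exact eqToHom_trans ..

end FreeMarkov

end Restrict


/-! ### Generation of the free Markov category -/

section Generation

open scoped ComonObj

variable {S : Hypergraph.{u, v}} {X Y Z X' Y' : FreeMarkov S}

namespace Cospan

/-- The morphism from the disjoint union given by two morphisms of hypergraphs. -/
def tensorDesc {α : Cospan X Y} {β : Cospan X' Y'} {H : Hypergraph.{u₁, v₁}}
    (p : Hypergraph.Hom α.G H) (q : Hypergraph.Hom β.G H) :
    Hypergraph.Hom (α.tensor β).G H where
  wire := Sum.elim p.wire q.wire
  box := Sum.elim p.box q.box
  wire_src := by
    rintro k l (b | b) i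
    · exact p.wire_src b i
    · exact q.wire_src b i
  wire_tgt := by
    rintro k l (b | b) i
    · exact p.wire_tgt b i
    · exact q.wire_tgt b i

/-- The morphism from the pushout given by two compatible morphisms of hypergraphs. -/
def compDesc {α : Cospan X Y} {β : Cospan Y Z} {H : Hypergraph.{u₁, v₁}}
    (p : Hypergraph.Hom α.G H) (q : Hypergraph.Hom β.G H)
    (h : ∀ i, p.wire (α.right i) = q.wire (β.left i)) :
    Hypergraph.Hom (α.comp β).G H where
  wire := Quot.lift (Sum.elim p.wire q.wire) (by rintro _ _ ⟨i⟩; exact h i)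
  box := Sum.elim p.box q.box
  wire_src := by
    rintro k l (b | b) i
    · exact p.wire_src b i
    · exact q.wire_src b i
  wire_tgt := by
    rintro k l (b | b) i
    · exact p.wire_tgt b i
    · exact q.wire_tgt b i

/-- The morphism from the hypergraph of a string diagram without boxes. -/
def circuitDesc {g : Fin Y.n → Fin X.n} {hg : ∀ i, X.label (g i) = Y.label i}
    {H : Hypergraph.{u₁, v₁}} (p : Fin X.n → H.W) : Hypergraph.Hom (circuit g hg).G H where
  wire := p
  box b := b.elim
  wire_src b := b.elim
  wire_tgt b := b.elim

/-- The morphism from the hypergraph of a single box. -/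
def singleDesc {α : Cospan X Y} {k l : ℕ} (b : α.G.B k l) :
    Hypergraph.Hom (FreeMarkov.single (α.lab.box b)).G α.G where
  wire := Sum.elim (α.G.src b) (α.G.tgt b)
  box c := match c with | .box => b
  wire_src := by rintro _ _ ⟨⟩ i; rfl
  wire_tgt := by rintro _ _ ⟨⟩ i; rfl

end Cospan

namespace FreeMarkov

open Cospan

theorem mk_eq_circ {α : Cospan X Y} (hα : α.IsStringDiagram) [IsEmpty α.G.Box] :
    ∃ g hg, Hom.mk α hα = Hom.circ g hg := by
  have h : ∀ i, ∃ x, α.left x = α.right i := fun i => by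
    obtain ⟨x | ⟨b, j⟩, h⟩ := hα.bij.2 (α.right i)
    · exact ⟨x, h⟩
    · exact isEmptyElim b
  choose g hg using h
  have hg' : ∀ i, X.label (g i) = Y.label i := fun i => by
    rw [← α.lab_left, hg, α.lab_right]
  refine ⟨g, hg', ?_⟩
  rw [Hom.circ_eq]
  exact (Hom.mk_eq' (hβ := circuit_isStringDiagram g hg')
    { toHom := circuitDesc α.left
      lab_wire := α.lab_left
      lab_box := fun b => b.elim
      map_left := fun _ => rfl
      map_right := hg } fun k l => ⟨fun b => b.elim,
        fun b => isEmptyElim (⟨k, l, b⟩ : α.G.Box)⟩).symm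

/-- An initial box can be executed first: copy those inputs of the diagram that it uses, apply it to
the copies beside the identity, and continue with the rest. -/
theorem mk_eq_comp_peel {α : Cospan X Y} (hα : α.IsStringDiagram) {k l : ℕ} (b : α.G.B k l)
    (hb : ∀ i, α.G.src b i ∈ Set.range α.left) :
    ∃ g hg, Hom.mk α hα =
      ((show X ⟶ X ⊗ dom (α.lab.box b) from Hom.circ g hg) ≫ (𝟙 X ⊗ₘ gen (α.lab.box b))) ≫
        Hom.mk (α.peel b) (peel_isStringDiagram hα b) := by
  obtain ⟨g, hg⟩ : ∃ g : Fin (dom (α.lab.box b)).n → Fin X.n, ∀ i, α.left (g i) = α.G.src b i :=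
    ⟨fun i => (hb i).choose, fun i => (hb i).choose_spec⟩
  have hg' : ∀ i, X.label (Fin.append id g i) = (X.tensor (dom (α.lab.box b))).label i :=
    Fin.addCases (fun i => by
      rw [Fin.append_left]
      exact (tensor_label_castAdd X _ i).symm) (fun i => by
      rw [Fin.append_right]
      refine Eq.trans ?_ (tensor_label_natAdd X (dom (α.lab.box b)) i).symm
      rw [← α.lab_left, hg]
      exact α.lab.wire_src b i)
  refine ⟨Fin.append id g, hg', ?_⟩
  change Hom.mk α hα = Hom.comp (Hom.comp (Hom.circ (X := X)
    (Y := X.tensor (dom (α.lab.box b))) (Fin.append id g) hg')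
    (Hom.tensor (Hom.circ id fun _ => rfl)
      (gen (α.lab.box b)))) (Hom.mk (α.peel b) (peel_isStringDiagram hα b))
  rw [gen, Hom.circ_eq, Hom.circ_eq, Hom.mk_tensor, Hom.mk_comp, Hom.mk_comp]
  -- The map from the iterated composite to `α` is assembled from its restrictions to the pieces. On
  -- boxes it is bijective because a box of `α` either is `b` or survives in `peel`.
  refine (Hom.mk_eq' ?_ ?_).symm
  · refine
    { toHom := compDesc (compDesc (circuitDesc α.left)
        (tensorDesc (circuitDesc α.left) (singleDesc b)) ?_) (α.peelIncl b) ?_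
      lab_wire := ?_
      lab_box := ?_
      map_left := fun _ => rfl
      map_right := fun _ => rfl }
    · refine Fin.addCases (fun i => ?_) (fun i => ?_)
      · refine (congrArg α.left (Fin.append_left id g i)).trans ?_
        exact (congrArg (tensorDesc (circuitDesc α.left) (singleDesc b)).wire
          (tensor_left_castAdd (circuit id _) (single (α.lab.box b)) i)).symm
      · refine (congrArg α.left (Fin.append_right id g i)).trans ((hg i).trans ?_)
        exact (congrArg (tensorDesc (circuitDesc α.left) (singleDesc b)).wire
          (tensor_left_natAdd (circuit id _) (single (α.lab.box b)) i)).symm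
    · refine Fin.addCases (fun i => ?_) (fun i => ?_)
      · refine Eq.trans ?_ (Fin.append_left α.left (α.G.tgt b) i).symm
        exact congrArg (tensorDesc (circuitDesc α.left) (singleDesc b)).wire
          (tensor_right_castAdd (circuit id _) (single (α.lab.box b)) i)
      · refine Eq.trans ?_ (Fin.append_right α.left (α.G.tgt b) i).symm
        exact congrArg (tensorDesc (circuitDesc α.left) (singleDesc b)).wire
          (tensor_right_natAdd (circuit id _) (single (α.lab.box b)) i)
    · intro w
      obtain ⟨w | w, rfl⟩ := Quot.exists_rep w
      · obtain ⟨i | i | i | j, rfl⟩ := Quot.exists_rep w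
        · exact α.lab_left i
        · exact α.lab_left i
        · exact α.lab.wire_src b i
        · exact α.lab.wire_tgt b j
      · rfl
    · rintro k l ((⟨⟨⟩⟩ | ⟨⟨⟩⟩ | ⟨⟨⟩⟩) | b')
      · rfl
      · rfl
  · intro k' l'
    constructor
    · rintro ((⟨⟨⟩⟩ | ⟨⟨⟩⟩ | ⟨⟨⟩⟩) | b₁) ((⟨⟨⟩⟩ | ⟨⟨⟩⟩ | _) | b₂) e
      · rename_i c
        cases c
        rfl
      · exact (b₂.2 (congrArg (fun b => (⟨k, l, b⟩ : α.G.Box)) e.symm)).elim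
      · rename_i c
        cases c
        exact (b₁.2 (congrArg (fun b => (⟨k, l, b⟩ : α.G.Box)) e)).elim
      · exact congrArg Sum.inr (Subtype.ext e)
    · intro b'
      by_cases h : (⟨k', l', b'⟩ : α.G.Box) = ⟨k, l, b⟩
      · cases h
        exact ⟨Sum.inl (Sum.inr (Sum.inr .box)), rfl⟩
      · exact ⟨Sum.inr ⟨b', h⟩, rfl⟩

end FreeMarkov

end Generation


/-! ### Generators of the free Markov category and induction on morphisms -/

section Induction

open scoped ComonObj

variable {S : Hypergraph.{u, v}}

namespace FreeMarkov

theorem succ_eq_tensor {n : ℕ} (l : Fin (n + 1) → S.W) :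
    (⟨n + 1, l⟩ : FreeMarkov S) = (wireObj (l 0)).tensor ⟨n, fun i => l i.succ⟩ :=
  mk_eq_mk (Nat.add_comm n 1) (Fin.cases
    (Fin.append_left (fun _ : Fin 1 => l 0) (fun i => l i.succ) 0).symm fun i =>
    (Fin.append_right (fun _ : Fin 1 => l 0) (fun i => l i.succ) i).symm.trans
      (congrArg _ (Fin.ext (by simp; omega))))

theorem label_cast {n : ℕ} (l : Fin (n + 1) → S.W) (i : Fin (1 + n)) :
    l (Fin.cast (Nat.add_comm 1 n) i) =
      ((wireObj (l 0)).tensor ⟨n, fun i => l i.succ⟩).label i := by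
  refine Fin.addCases (fun i => ?_) (fun i => ?_) i
  · refine Eq.trans (congrArg l (Fin.ext ?_))
      (Fin.append_left (fun _ : Fin 1 => l 0) (fun i => l i.succ) i).symm
    simp
  · refine Eq.trans (congrArg l (Fin.ext ?_))
      (Fin.append_right (fun _ : Fin 1 => l 0) (fun i => l i.succ) i).symm
    simp

/-- Removing initial boxes one by one reduces the claim to diagrams without boxes. Such a diagram is
a tuple of projections to single wires, built by copying the whole source. No case for braidings is
needed, because copies of arbitrary objects, together with projections, produce all permutations. -/
theorem hom_induction {P : ∀ ⦃X Y : FreeMarkov S⦄, (X ⟶ Y) → Prop}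
    (comp : ∀ ⦃X Y Z : FreeMarkov S⦄ (f : X ⟶ Y) (g : Y ⟶ Z), P f → P g → P (f ≫ g))
    (tensor : ∀ ⦃X Y X' Y' : FreeMarkov S⦄ (f : X ⟶ Y) (g : X' ⟶ Y'), P f → P g → P (f ⊗ₘ g))
    (eqToHom : ∀ ⦃X Y : FreeMarkov S⦄ (h : X = Y), P (eqToHom h))
    (copy : ∀ X : FreeMarkov S, P Δ[X]) (discard : ∀ X : FreeMarkov S, P ε[X])
    (gen : ∀ ⦃k l : ℕ⦄ (b : S.B k l), P (gen b)) ⦃X Y : FreeMarkov S⦄ (f : X ⟶ Y) : P f := by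
  have hcast : ∀ {X Y : FreeMarkov S} (_ : X = Y) (e : Fin Y.n → Fin X.n)
      (he : ∀ i, X.label (e i) = Y.label i) (_ : ∀ i, (e i : ℕ) = i), P (Hom.circ e he) := by
    intro X Y h e he hv
    rw [eqToHom_eq h e he hv]
    exact eqToHom h
  have hcomp : ∀ {X Y Z : FreeMarkov S} {e : Fin Y.n → Fin X.n}
      {he : ∀ i, X.label (e i) = Y.label i} {e' : Fin Z.n → Fin Y.n}
      {he' : ∀ i, Y.label (e' i) = Z.label i}, P (Hom.circ e he) → P (Hom.circ e' he') →
      ∀ (e'' : Fin Z.n → Fin X.n) (he'' : ∀ i, X.label (e'' i) = Z.label i),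
      (∀ i, e (e' i) = e'' i) → P (Hom.circ e'' he'') := by
    intro X Y Z e he e' he' h h' e'' he'' hc
    rw [← Hom.circ_congr hc (hf := fun i => (he _).trans (he' i)), ← Hom.circ_comp]
    exacts [comp _ _ h h', he, he']
  have htensor : ∀ {X Y X' Y' : FreeMarkov S} {e : Fin Y.n → Fin X.n}
      {he : ∀ i, X.label (e i) = Y.label i} {e' : Fin Y'.n → Fin X'.n}
      {he' : ∀ i, X'.label (e' i) = Y'.label i}, P (Hom.circ e he) → P (Hom.circ e' he') →
      ∃ h, P (Hom.circ (X := X.tensor X') (Y := Y.tensor Y') (tmap e e') h) := by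
    intro X Y X' Y' e he e' he' h h'
    refine ⟨Fin.addCases (fun i => by simpa using he i) (fun i => by simpa using he' i), ?_⟩
    rw [← Hom.circ_tensor e he e' he']
    exact tensor _ _ h h'
  have hid : ∀ X : FreeMarkov S, P (Hom.circ (X := X) id fun _ => rfl) := fun X => eqToHom rfl
  have hdel : ∀ X : FreeMarkov S, P (Hom.circ (X := X) (Y := unit S) Fin.elim0 fun i => i.elim0) :=
    discard
  have hdbl : ∀ X : FreeMarkov S, P (Hom.circ (X := X) (Y := X.tensor X) (dbl X.n) (dbl_label X)) :=
    copy
  -- Projection to one wire: split off the first wire, then discard either the rest or the first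
  -- wire.
  have hproj : ∀ (n : ℕ) (l : Fin n → S.W) (i : Fin n),
      P (Hom.circ (X := ⟨n, l⟩) (Y := wireObj (l i)) (fun _ => i) fun _ => rfl) := by
    intro n
    induction n with
    | zero => exact fun l i => i.elim0
    | succ n ih =>
      intro l i
      have h₁ := hcast (succ_eq_tensor l) _ (label_cast l) fun i => rfl
      refine Fin.cases (motive := fun i => P (Hom.circ (X := ⟨n + 1, l⟩) (Y := wireObj (l i))
        (fun _ => i) fun _ => rfl)) ?_ (fun i => ?_) i
      · obtain ⟨e₂, h₂⟩ := htensor (hid (wireObj (l 0))) (hdel ⟨n, fun i => l i.succ⟩)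
        have h₃ := hcast (X := (wireObj (l 0)).tensor (unit S)) (Y := wireObj (l 0))
          (IsStrictMonoidal.tensor_unit (wireObj (l 0))) (Fin.castAdd 0)
          (runitE_label (wireObj (l 0))) fun _ => rfl
        refine hcomp (hcomp h₁ h₂ _ (fun i => (label_cast l _).trans (e₂ i)) fun _ => rfl) h₃ _ _
          fun j => ?_
        rw [tmap_castAdd]
        exact Fin.ext (Nat.lt_one_iff.1 j.2)
      · obtain ⟨e₂, h₂⟩ := htensor (hdel (wireObj (l 0))) (ih (fun i => l i.succ) i)
        have h₃ := hcast (X := (unit S).tensor (wireObj (l i.succ))) (Y := wireObj (l i.succ))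
          (IsStrictMonoidal.unit_tensor (wireObj (l i.succ))) (lunitE _)
          (lunitE_label (wireObj (l i.succ))) fun _ => rfl
        refine hcomp (hcomp h₁ h₂ _ (fun i => (label_cast l _).trans (e₂ i)) fun _ => rfl) h₃ _ _
          fun j => ?_
        rw [lunitE_apply, tmap_natAdd]
        exact Fin.ext (Nat.add_comm 1 i)
  -- Copy the source, project one copy to the first output wire, and obtain the remaining output
  -- wires from the other copy.
  have hcirc : ∀ (n : ℕ) (X : FreeMarkov S) (l : Fin n → S.W) (g : Fin n → Fin X.n)
      (hg : ∀ i, X.label (g i) = l i), P (Hom.circ (X := X) (Y := ⟨n, l⟩) g hg) := by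
    intro n
    induction n with
    | zero =>
      intro X l g hg
      obtain rfl : l = Fin.elim0 := funext fun i => i.elim0
      obtain rfl : g = Fin.elim0 := funext fun i => i.elim0
      exact hdel X
    | succ n ih =>
      intro X l g hg
      obtain rfl : (fun i => X.label (g i)) = l := funext hg
      obtain ⟨e₂, h₂⟩ := htensor (hproj X.n X.label (g 0))
        (ih X (fun i => X.label (g i.succ)) (fun i => g i.succ) fun _ => rfl)
      have h₃ := hcast (succ_eq_tensor fun i => X.label (g i)).symm
        (Fin.cast (Nat.add_comm n 1)) (fun i => (label_cast (fun i => X.label (g i)) _).symm)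
        fun i => rfl
      refine hcomp (hcomp (hdbl X) h₂ _ (fun i => (dbl_label X _).trans (e₂ i)) fun _ => rfl)
        h₃ _ _ ?_
      refine Fin.cases ?_ (fun i => ?_)
      · have : Fin.cast (Nat.add_comm n 1) 0 = Fin.castAdd n 0 := rfl
        exact (congrArg _ ((congrArg _ this).trans (tmap_castAdd ..))).trans (dbl_castAdd _)
      · have : Fin.cast (Nat.add_comm n 1) i.succ = Fin.natAdd 1 i := Fin.ext (by simp; omega)
        exact (congrArg _ ((congrArg _ this).trans (tmap_natAdd ..))).trans (dbl_natAdd _)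
  have hmk : ∀ (N : ℕ) (X Y : FreeMarkov S) (α : Cospan X Y) (hα : α.IsStringDiagram),
      Nat.card α.G.Box = N → P (Hom.mk α hα) := by
    intro N
    induction N using Nat.strong_induction_on with
    | _ N ih =>
      rintro X Y α hα rfl
      rcases isEmpty_or_nonempty α.G.Box with hB | hB
      · obtain ⟨g, hg, h⟩ := mk_eq_circ hα
        rw [h]
        exact hcirc Y.n X Y.label g hg
      · obtain ⟨k, l, b, hb⟩ := Cospan.exists_initial hα
        obtain ⟨g, hg, h⟩ := mk_eq_comp_peel hα b hb
        rw [h]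
        exact comp _ _ (comp _ _ (hcirc _ _ _ g hg) (tensor _ _ (eqToHom rfl) (gen _)))
          (ih _ (α.card_peel_lt b) _ _ _ _ rfl)
  obtain ⟨α, hα, rfl⟩ := Hom.exists_mk f
  exact hmk _ _ _ α hα rfl

end FreeMarkov

end Induction


/-! ### The universal property -/

section Universal

open scoped ComonObj

variable {C : Type u₁} [Category.{v₁} C]

theorem eq_of_eqToHom_comp_eq {X Y X' Y' Z Z' T T' : C} {f : X ⟶ Y} {g : X' ⟶ Y'} {a : Z = X}
    {b : Y = Z'} {a' : T = X'} {b' : Y' = T'} {c : Z = T} {c' : T' = Z'}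
    (h : eqToHom a ≫ f ≫ eqToHom b =
      eqToHom c ≫ (eqToHom a' ≫ g ≫ eqToHom b') ≫ eqToHom c') (d : X = X') (d' : Y' = Y) :
    f = eqToHom d ≫ g ≫ eqToHom d' := by
  subst a b c c' d d'
  simpa using h

variable [MonoidalCategory C]

theorem eqToHom_tensor_eqToHom {X Y X' Y' : C} (h : X = Y) (h' : X' = Y') :
    eqToHom h ⊗ₘ eqToHom h' = eqToHom (congrArg₂ (· ⊗ ·) h h') := by
  subst h h'
  simp

theorem exists_of_hyp_box_eq {k l : ℕ} {A B : Fin k → C} {A' B' : Fin l → C}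
    {m : tensorPow A ⟶ tensorPow A'} {m' : tensorPow B ⟶ tensorPow B'}
    (h : (⟨A, A', m⟩ : (hyp C).B k l) = ⟨B, B', m'⟩) :
    ∃ (e : tensorPow A = tensorPow B) (e' : tensorPow B' = tensorPow A'),
      m = eqToHom e ≫ m' ≫ eqToHom e' := by
  cases h
  exact ⟨rfl, rfl, by simp⟩

variable [CopyDiscardCategory C]

theorem copy_eq_of_eq {X Y : C} (h : X = Y) :
    Δ[X] = eqToHom h ≫ Δ[Y] ≫ eqToHom (congrArg₂ (· ⊗ ·) h h).symm := by
  subst h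
  simp

theorem discard_eq_of_eq {X Y : C} (h : X = Y) : ε[X] = eqToHom h ≫ ε[Y] := by
  subst h
  simp

theorem StrictGSFunctor.ext_toFunctor {D : Type u₂} [Category.{v₂} D] [MonoidalCategory D]
    [CopyDiscardCategory D] {F F' : StrictGSFunctor D C} (h : F.toFunctor = F'.toFunctor) :
    F = F' := by
  obtain ⟨F, _, _, _, _, _, _⟩ := F
  obtain ⟨F', _, _, _, _, _, _⟩ := F'
  obtain rfl : F = F' := h
  rfl

namespace FreeMarkov

variable {S : Hypergraph.{u, v}}

theorem obj_eq_tensorPow (F : StrictGSFunctor (FreeMarkov S) C) (X : FreeMarkov S) :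
    F.obj X = tensorPow fun i => F.obj (wireObj (X.label i)) :=
  (congrArg F.obj (tensorPow_wireObj X.label).symm).trans (F.obj_tensorPow _)

/-- Two functors with the same restriction agree on single wires, hence on all objects, which are
tensor products of these. On morphisms `hom_induction` applies, with `eqToHom` transporting between
the two values of each object. -/
theorem restrict_injective :
    Function.Injective
      (restrict : StrictGSFunctor (FreeMarkov S) C → Hypergraph.Hom S (hyp C)) := by
  intro F F' h
  have hw : ∀ w, F.obj (wireObj w) = F'.obj (wireObj w) :=
    congrFun (congrArg Hypergraph.Hom.wire h)
  have ho : ∀ X, F.obj X = F'.obj X := fun X => by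
    rw [obj_eq_tensorPow, obj_eq_tensorPow]
    exact congrArg tensorPow (funext fun i => hw _)
  refine StrictGSFunctor.ext_toFunctor (CategoryTheory.Functor.ext ho fun X Y f => ?_)
  refine hom_induction (P := fun X Y f => F.map f = eqToHom (ho X) ≫ F'.map f ≫
    eqToHom (ho Y).symm) ?_ ?_ ?_ ?_ ?_ ?_ f
  · intro X Y Z f g hf hg
    rw [Functor.map_comp, Functor.map_comp, hf, hg]
    simp
  · intro X Y X' Y' f g hf hg
    rw [F.map_tensor, F'.map_tensor, hf, hg]
    simp only [← tensorHom_comp_tensorHom, eqToHom_tensor_eqToHom, Category.assoc,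
      eqToHom_trans, eqToHom_trans_assoc]
  · rintro X _ rfl
    simp
  · intro X
    rw [F.map_copy, F'.map_copy, copy_eq_of_eq (ho X)]
    simp
  · intro X
    rw [F.map_del, F'.map_del, discard_eq_of_eq (ho X)]
    simp
  · intro k l b
    have hb := congrArg (fun f : Hypergraph.Hom S (hyp C) => f.box b) h
    simp only [restrict_box] at hb
    obtain ⟨e, e', hm⟩ := exists_of_hyp_box_eq hb
    exact eq_of_eqToHom_comp_eq hm _ _

/-- Both the functor and `e.equiv` turn concatenation into tensor products, so agreement on single
wires extends to words by induction on their length. -/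
theorem obj_eq_iff (F : StrictGSFunctor (FreeMarkov S) C) (e : FreeOnObjects S.W C) :
    (∀ X, F.obj X = e.equiv X.word) ↔
      ∀ w, (restrict F).wire w = e.equiv (FreeMonoid.of w) := by
  refine ⟨fun h w => (h (wireObj w)).trans ?_, fun h X => ?_⟩
  · rfl
  · have key : ∀ (n : ℕ) (l : Fin n → S.W), (tensorPow fun i => F.obj (wireObj (l i))) =
        e.equiv (FreeMonoid.ofList (List.ofFn l)) := by
      intro n
      induction n with
      | zero => exact fun l => e.map_one.symm
      | succ n ih =>
        intro l
        rw [List.ofFn_succ, FreeMonoid.ofList_cons, e.map_mul, ← ih, ← h]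
        rfl
    exact (obj_eq_tensorPow F X).trans (key _ _)

end FreeMarkov

end Universal

end GSMon

theorem mainTheorem4
    (S : GSMon.Hypergraph.{u, v})
    (C : Type u₁) [CategoryTheory.Category.{v₁} C] [CategoryTheory.MonoidalCategory C]
    [CategoryTheory.MarkovCategory C] [GSMon.IsStrictMonoidal C]
    (e : GSMon.FreeOnObjects S.W C) :
    Function.Bijective
      (fun F : GSMon.StrictGSFunctor (GSMon.FreeMarkov S) C => GSMon.FreeMarkov.restrict F) ∧
    Set.BijOn
      (fun F : GSMon.StrictGSFunctor (GSMon.FreeMarkov S) C => GSMon.FreeMarkov.restrict F)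
      {F | ∀ X : GSMon.FreeMarkov S, F.obj X = e.equiv X.word}
      {f | ∀ w : S.W, f.wire w = e.equiv (FreeMonoid.of w)} := by
  have hs := fun f : GSMon.Hypergraph.Hom S (GSMon.hyp C) => GSMon.FreeMarkov.restrict_lift f
  refine ⟨⟨GSMon.FreeMarkov.restrict_injective, fun f => ⟨_, hs f⟩⟩,
    fun F hF => (GSMon.FreeMarkov.obj_eq_iff F e).1 hF,
    GSMon.FreeMarkov.restrict_injective.injOn, fun f hf => ⟨GSMon.FreeMarkov.lift f, ?_, hs f⟩⟩
  refine (GSMon.FreeMarkov.obj_eq_iff _ e).2 ?_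
  rwa [hs]
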